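/- Notation. Let $\boldsymbol\eta=\mathrm{diag}(-1,1,1,1)$. For $m>0$ and $a\in\mathbb{R}$, the Kerr metric in Kerr–Schild coordinates $(x^\mu)=(t,x,y,z)$ is ${\bf g}_{m,a}=\boldsymbol\eta+2H\,\boldsymbol\ell\otimes\boldsymbol\ell$, where $$H=\frac{m\tilde r^3}{\tilde r^4+a^2z^2},\qquad \boldsymbol\ell=\Big(1,\frac{\tilde r x+ay}{\tilde r^2+a^2},\frac{\tilde r y-ax}{\tilde r^2+a^2},\frac{z}{\tilde r}\Big),$$ and $\tilde r>0$ is defined by $\frac{x^2+y^2}{\tilde r^2+a^2}+\frac{z^2}{\tilde r^2}=1$. A proper orthochronous Poincaré transformation is a map $x'^\mu=\Lambda^\mu{}_\nu x^\nu+\xi^\mu$ with $\xi\in\mathbb{R}^4$, $\Lambda^\top\boldsymbol\eta\Lambda=\boldsymbol\eta$, $\det\Lambda=1$ and $\Lambda^0{}_0>0$. For data $(g,k)$ on (the exterior of a ball in) $\mathbb{R}^3$, with $e$ the Euclidean metric, $\nu$ the outward Euclidean unit normal to a sphere $S$ centered at the origin, and $Y_l=e_l\times x$ the rotation fields, put (summing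 over repeated indices) $$\mathbf E[(g,k);S]=\tfrac12\int_S(\partial_ig_{ij}-\partial_jg_{ii})\nu^j\,dS,\qquad \mathbf P_i[(g,k);S]=\int_S(k_{ij}-\delta_{ij}\,\mathrm{tr}_ek)\nu^j\,dS,$$ $$\mathbf C_l[(g,k);S]=\tfrac12\int_S\big(x_l(\partial_ig_{ij}-\partial_jg_{ii})-\delta_{il}(g-e)_{ij}+\delta_{jl}(g-e)_{ii}\big)\nu^j\,dS,\qquad \mathbf J_l[(g,k);S]=\int_S(k_{ij}-\delta_{ij}\,\mathrm{tr}_ek)Y_l^i\nu^j\,dS.$$ The ADM charges are the limits of these quantities on the spheres $\{|x|=r\}$ as $r\to\infty$. Proposition. Let $\mathbf E_*>0$ and $\mathbf P_*,\mathbf J_*\in\mathbb{R}^3$ satisfy $\mathbf E_*>|\mathbf P_*|$. Then there exist a Kerr metric ${\bf g}_{m,a}$ with $m>0$, $a\in\mathbb{R}$, in Kerr–Schild coordinates, a proper orthochronous Poincaré transformation $x'=\Lambda x+\xi$, and constants $R>0$, $C$ (all depending only on $\mathbf E_*,\mathbf P_*,\mathbf J_*$) with the following properties. On the part $\{t'=0,\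 r'\ge R\}$ of the slice $\{t'=0\}$, where $r'=\sqrt{x'^2+y'^2+z'^2}$, the metric ${\bf g}_{m,a}$ is smooth and the slice is spacelike. Let $(g',k')$ be the data induced by ${\bf g}_{m,a}$ on $\{t'=0\}$ in the coordinates $(x',y',z')$, where $k'=-\frac12\mathcal L_{\mathbf n}{\bf g}_{m,a}$ and $\mathbf n$ is the future unit normal. Then: 1. for $r'\ge R$, every component satisfies $|(g'-e)_{ij}|\le C/r'$ and $|k'_{ij}|\le C/r'^2$; 2. for every $r\ge R$, on $S'_r=\{t'=0,\ r'=r\}$, componentwise and with errors of absolute value at most $C/r$, $$\mathbf E[(g',k');S'_r]=\mathbf E_*+O(r^{-1}),\quad \mathbf P[(g',k');S'_r]=\mathbf P_*+O(r^{-1}),\quad \mathbf C[(g',k');S'_r]=O(r^{-1}),\quad \mathbf J[(g',k');S'_r]=\mathbf J_*+O(r^{-1});$$ 3. the ADM charges of $(g',k')$ exist and equal $(\mathbf E^{ADM},\mathbf P^{ADM},\mathbf C^{ADM},\mathbf J^{ADM})=(\mathbf E_*,\mathbf P_*,0,\mathbf J_*)$. -/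

import Mathlib

open MeasureTheory Filter Topology
open scoped ContDiff Matrix

noncomputable section

namespace KerrData

/-! Spacetime points are coordinate vectors `x : Fin 4 → ℝ`, with `x 0` the time coordinate.
A spacetime metric is its matrix of components in these coordinates. -/

/-- Euclidean three-space. -/
abbrev E3 : Type := EuclideanSpace ℝ (Fin 3)

/-- A symmetric two-tensor on `ℝ³` (or a tensor of the same type), by its Cartesian components. -/
abbrev Tensor3 : Type := E3 → Matrix (Fin 3) (Fin 3) ℝ

/-- A two-tensor on spacetime, by its components in the given coordinates. -/
abbrev Tensor4 : Type := (Fin 4 → ℝ) → Matrix (Fin 4) (Fin 4) ℝ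

/-- The Minkowski metric, signature `(-,+,+,+)`. -/
def minkowski : Matrix (Fin 4) (Fin 4) ℝ := Matrix.diagonal ![-1, 1, 1, 1]

/-! ### The Kerr metric in Kerr-Schild coordinates -/

/-- The Kerr-Schild radius `r̃(x,y,z)`: the positive solution of
`(x² + y²)/(r̃² + a²) + z²/r̃² = 1`, in closed form. It is characterized by
`kerrRadius_pos`, `kerrRadius_spec` and `eq_kerrRadius` below. -/
def kerrRadius (a : ℝ) (x : Fin 4 → ℝ) : ℝ :=
  √((((x 1 ^ 2 + x 2 ^ 2 + x 3 ^ 2) - a ^ 2) +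
    √(((x 1 ^ 2 + x 2 ^ 2 + x 3 ^ 2) - a ^ 2) ^ 2 + 4 * a ^ 2 * x 3 ^ 2)) / 2)

/-- The function `H = m r̃³ / (r̃⁴ + a² z²)`. -/
def kerrH (m a : ℝ) (x : Fin 4 → ℝ) : ℝ :=
  m * kerrRadius a x ^ 3 / (kerrRadius a x ^ 4 + a ^ 2 * x 3 ^ 2)

/-- The covector `ℓ = (1, (r̃x + ay)/(r̃² + a²), (r̃y - ax)/(r̃² + a²), z/r̃)`. -/
def kerrEll (a : ℝ) (x : Fin 4 → ℝ) : Fin 4 → ℝ :=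
  ![1,
    (kerrRadius a x * x 1 + a * x 2) / (kerrRadius a x ^ 2 + a ^ 2),
    (kerrRadius a x * x 2 - a * x 1) / (kerrRadius a x ^ 2 + a ^ 2),
    x 3 / kerrRadius a x]

/-- The Kerr metric `g_{m,a} = η + 2 H ℓ ⊗ ℓ` in Kerr-Schild coordinates `(t,x,y,z)`. -/
def kerrMetric (m a : ℝ) : Tensor4 := fun x =>
  minkowski + (2 * kerrH m a x) • Matrix.vecMulVec (kerrEll a x) (kerrEll a x)

/-- Off the disc `{z = 0, x² + y² ≤ a²}` the Kerr-Schild radius is positive. -/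
theorem kerrRadius_pos {a : ℝ} {x : Fin 4 → ℝ}
    (hx : ¬ (x 3 = 0 ∧ x 1 ^ 2 + x 2 ^ 2 ≤ a ^ 2)) : 0 < kerrRadius a x := by
  unfold kerrRadius
  apply Real.sqrt_pos.2
  set s := (x 1 ^ 2 + x 2 ^ 2 + x 3 ^ 2) - a ^ 2 with hs
  by_cases h0 : 0 < s
  · have := Real.sqrt_nonneg (s ^ 2 + 4 * a ^ 2 * x 3 ^ 2)
    linarith
  · push Not at h0
    have hz : x 3 ≠ 0 := by
      intro hz
      apply hx
      refine ⟨hz, ?_⟩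
      rw [hz] at hs
      nlinarith
    have ha : a ≠ 0 := by
      rintro rfl
      have : 0 < x 3 ^ 2 := by positivity
      nlinarith [sq_nonneg (x 1), sq_nonneg (x 2)]
    have hpos : 0 < 4 * a ^ 2 * x 3 ^ 2 := by positivity
    have : -s < √(s ^ 2 + 4 * a ^ 2 * x 3 ^ 2) := by
      apply Real.lt_sqrt_of_sq_lt
      nlinarith
    linarith

/-- Off the disc, the Kerr-Schild radius solves its defining equation. -/
theorem kerrRadius_spec {a : ℝ} {x : Fin 4 → ℝ}
    (hx : ¬ (x 3 = 0 ∧ x 1 ^ 2 + x 2 ^ 2 ≤ a ^ 2)) :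
    (x 1 ^ 2 + x 2 ^ 2) / (kerrRadius a x ^ 2 + a ^ 2) + x 3 ^ 2 / kerrRadius a x ^ 2 = 1 := by
  have hp := kerrRadius_pos hx
  set s := (x 1 ^ 2 + x 2 ^ 2 + x 3 ^ 2) - a ^ 2 with hs
  have hq : 0 ≤ s ^ 2 + 4 * a ^ 2 * x 3 ^ 2 := by positivity
  have hsq : kerrRadius a x ^ 2 = (s + √(s ^ 2 + 4 * a ^ 2 * x 3 ^ 2)) / 2 := by
    have h := Real.sqrt_pos.1 hp
    unfold kerrRadius
    exact Real.sq_sqrt h.le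
  have hq2 := Real.sq_sqrt hq
  have key : (kerrRadius a x ^ 2) ^ 2 - s * kerrRadius a x ^ 2 - a ^ 2 * x 3 ^ 2 = 0 := by
    rw [hsq]; nlinarith
  have h1 : kerrRadius a x ^ 2 + a ^ 2 ≠ 0 := by positivity
  have h2 : kerrRadius a x ^ 2 ≠ 0 := by positivity
  rw [div_add_div _ _ h1 h2, div_eq_one_iff_eq (mul_ne_zero h1 h2)]
  rw [hs] at key
  linarith

/-- The Kerr-Schild radius is the only positive solution of its defining equation. -/
theorem eq_kerrRadius {a s : ℝ} {x : Fin 4 → ℝ} (hs : 0 < s)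
    (h : (x 1 ^ 2 + x 2 ^ 2) / (s ^ 2 + a ^ 2) + x 3 ^ 2 / s ^ 2 = 1) : s = kerrRadius a x := by
  have h1 : s ^ 2 + a ^ 2 ≠ 0 := by positivity
  have h2 : s ^ 2 ≠ 0 := by positivity
  rw [div_add_div _ _ h1 h2, div_eq_one_iff_eq (mul_ne_zero h1 h2)] at h
  unfold kerrRadius
  set q := (x 1 ^ 2 + x 2 ^ 2 + x 3 ^ 2) - a ^ 2 with hq
  have key : q * s ^ 2 = (s ^ 2) ^ 2 - a ^ 2 * x 3 ^ 2 := by rw [hq]; linarith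
  have hnn : 0 ≤ 2 * s ^ 2 - q := by
    have : 0 ≤ (2 * s ^ 2 - q) * s ^ 2 := by
      have e : (2 * s ^ 2 - q) * s ^ 2 = (s ^ 2) ^ 2 + a ^ 2 * x 3 ^ 2 := by linarith
      rw [e]; positivity
    exact nonneg_of_mul_nonneg_left this (by positivity)
  have hr : √(q ^ 2 + 4 * a ^ 2 * x 3 ^ 2) = 2 * s ^ 2 - q := by
    have e : q ^ 2 + 4 * a ^ 2 * x 3 ^ 2 = (2 * s ^ 2 - q) ^ 2 := by linarith
    rw [e, Real.sqrt_sq hnn]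
  rw [hr]
  have e : (q + (2 * s ^ 2 - q)) / 2 = s ^ 2 := by ring
  rw [e, Real.sqrt_sq hs.le]

/-! ### Poincaré transformations -/

/-- An element of the proper orthochronous Poincaré group: a pair `(ξ, Λ)` acting on spacetime
by `x ↦ Λ x + ξ`. -/
structure PoincareTransformation where
  /-- The Lorentz matrix `Λ`. -/
  lorentz : Matrix (Fin 4) (Fin 4) ℝ
  /-- The translation `ξ`. -/
  translation : Fin 4 → ℝ
  preserves : lorentzᵀ * minkowski * lorentz = minkowski
  proper : lorentz.det = 1
  orthochronous : 0 < lorentz 0 0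

namespace PoincareTransformation

/-- The new coordinates `x' = Λ x + ξ`. -/
def newCoords (T : PoincareTransformation) (x : Fin 4 → ℝ) : Fin 4 → ℝ :=
  T.lorentz *ᵥ x + T.translation

/-- The old coordinates `x = Λ⁻¹ (x' - ξ)`. -/
def oldCoords (T : PoincareTransformation) (x' : Fin 4 → ℝ) : Fin 4 → ℝ :=
  T.lorentz⁻¹ *ᵥ (x' - T.translation)

theorem oldCoords_newCoords (T : PoincareTransformation) (x : Fin 4 → ℝ) :
    T.oldCoords (T.newCoords x) = x := by
  have h : IsUnit T.lorentz.det := by rw [T.proper]; exact isUnit_one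
  simp [oldCoords, newCoords, Matrix.mulVec_mulVec, Matrix.nonsing_inv_mul _ h]

theorem newCoords_oldCoords (T : PoincareTransformation) (x' : Fin 4 → ℝ) :
    T.newCoords (T.oldCoords x') = x' := by
  have h : IsUnit T.lorentz.det := by rw [T.proper]; exact isUnit_one
  simp [oldCoords, newCoords, Matrix.mulVec_mulVec, Matrix.mul_nonsing_inv _ h]

/-- The components of the metric `G` in the new coordinates:
`G'_{μν}(x') = (∂x^α/∂x'^μ) (∂x^β/∂x'^ν) G_{αβ}(x)`, where `∂x/∂x' = Λ⁻¹`. -/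
def transform (T : PoincareTransformation) (G : Tensor4) : Tensor4 := fun x' =>
  (T.lorentz⁻¹)ᵀ * G (T.oldCoords x') * T.lorentz⁻¹

end PoincareTransformation

/-! ### Induced data on the slice where the time coordinate vanishes -/

/-- The point `(0, y)` of the slice. -/
def slicePoint (y : E3) : Fin 4 → ℝ := Matrix.vecCons 0 (fun i => y i)

/-- The partial derivative `∂_μ f` on spacetime. -/
def pd4 (μ : Fin 4) (f : (Fin 4 → ℝ) → ℝ) (x : Fin 4 → ℝ) : ℝ :=
  fderiv ℝ f x (Pi.single μ 1)

/-- The Christoffel symbol `Γ^μ_{αβ}` of the metric `G`. -/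
def christoffel (G : Tensor4) (x : Fin 4 → ℝ) (μ α β : Fin 4) : ℝ :=
  (1 / 2) * ∑ ρ, (G x)⁻¹ μ ρ *
    (pd4 α (fun y => G y ρ β) x + pd4 β (fun y => G y ρ α) x - pd4 ρ (fun y => G y α β) x)

/-- The future unit conormal `n_μ = (-N, 0, 0, 0)` of the slices of constant time, where
`N = (-G^{00})^{-1/2}` is the lapse. -/
def conormal (G : Tensor4) (x : Fin 4 → ℝ) (μ : Fin 4) : ℝ :=
  if μ = 0 then -(1 / √(-((G x)⁻¹ 0 0))) else 0

/-- The induced metric `g_{ij}` on the slice. -/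
def inducedMetric (G : Tensor4) : Tensor3 := fun y =>
  Matrix.of fun i j => G (slicePoint y) i.succ j.succ

/-- The second fundamental form of the slice,
`k_{ij} = -(1/2) (L_n G)_{ij} = -∇_i n_j = -(∂_i n_j - Γ^μ_{ij} n_μ)`. -/
def secondFundamentalForm (G : Tensor4) : Tensor3 := fun y =>
  Matrix.of fun i j =>
    -(pd4 i.succ (fun x => conormal G x j.succ) (slicePoint y) -
      ∑ μ, christoffel G (slicePoint y) μ i.succ j.succ * conormal G (slicePoint y) μ)

/-! ### Charges on coordinate spheres -/

/-- The partial derivative `∂_i f` on `ℝ³`. -/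
def pd3 (i : Fin 3) (f : E3 → ℝ) (x : E3) : ℝ :=
  fderiv ℝ f x (EuclideanSpace.single i 1)

/-- The surface integral `∫_{∂B_r} f(x, ν) dS` over the sphere of radius `r` about the origin, with
outward unit normal `ν`; `volume.toSphere` is the area measure of the unit sphere. -/
def sphereIntegral (r : ℝ) (f : E3 → E3 → ℝ) : ℝ :=
  r ^ 2 * ∫ ν : Metric.sphere (0 : E3) 1, f (r • (ν : E3)) (ν : E3)
    ∂((volume : Measure E3).toSphere)

/-- The covector `∂_i g_{ij} - ∂_j g_{ii}` (summed over `i`). -/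
def energyDensity (g : Tensor3) (x : E3) (j : Fin 3) : ℝ :=
  ∑ i, (pd3 i (fun y => g y i j) x - pd3 j (fun y => g y i i) x)

/-- The tensor `k_{ij} - δ_{ij} tr k`, with the Euclidean trace. -/
def momentumDensity (k : Tensor3) (x : E3) : Matrix (Fin 3) (Fin 3) ℝ :=
  k x - (k x).trace • (1 : Matrix (Fin 3) (Fin 3) ℝ)

/-- The rotation vector field `Y_l = e_l × x`, that is `Y_l^i = ε_{lji} x^j`. -/
def rotationField (l : Fin 3) (x : E3) : Fin 3 → ℝ :=
  crossProduct (Pi.single l (1 : ℝ)) (fun j => x j)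

/-- The energy flux `E[(g,k); ∂B_r]`. -/
def energyCharge (g : Tensor3) (r : ℝ) : ℝ :=
  (1 / 2) * sphereIntegral r fun x ν => ∑ j, energyDensity g x j * ν j

/-- The linear momentum flux `P_i[(g,k); ∂B_r]`. -/
def momentumCharge (k : Tensor3) (r : ℝ) (i : Fin 3) : ℝ :=
  sphereIntegral r fun x ν => ∑ j, momentumDensity k x i j * ν j

/-- The center of mass flux `C_l[(g,k); ∂B_r]`. -/
def centerCharge (g : Tensor3) (r : ℝ) (l : Fin 3) : ℝ :=
  (1 / 2) * sphereIntegral r fun x ν => ∑ j,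
    (x l * energyDensity g x j - (g x - 1) l j +
      (if j = l then (g x - 1).trace else 0)) * ν j

/-- The angular momentum flux `J_l[(g,k); ∂B_r]`. -/
def angularCharge (k : Tensor3) (r : ℝ) (l : Fin 3) : ℝ :=
  sphereIntegral r fun x ν => ∑ i, ∑ j, momentumDensity k x i j * rotationField l x i * ν j

/-- The ADM charges of `(g,k)`, the limits of the fluxes through `∂B_r` as `r → ∞`, exist and are
`(E, P, C, J)`. -/
def HasADMCharges (g k : Tensor3) (E : ℝ) (P C J : E3) : Prop :=
  Tendsto (energyCharge g) atTop (𝓝 E) ∧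
  (∀ i, Tendsto (fun r => momentumCharge k r i) atTop (𝓝 (P i))) ∧
  (∀ i, Tendsto (fun r => centerCharge g r i) atTop (𝓝 (C i))) ∧
  (∀ i, Tendsto (fun r => angularCharge k r i) atTop (𝓝 (J i)))

end KerrData

end

open KerrData

/-! Put ε = 1/r. When points, spin and translation are scaled together, the Kerr function H is
homogeneous of degree −1 and the covector ℓ of degree 0. Hence in boosted coordinates the metric is
exactly η + ε A_ε(εx), where A_ε is the Kerr–Schild perturbation with the same mass, spin εa and
translation εζ (`BoostedKerr.metric_scaled`). The sphere of radius r becomes the unit sphere, and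
the large-r asymptotics become the dependence on ε near 0 of a family that is smooth along the unit
sphere up to and including ε = 0, where it is a boosted Schwarzschild perturbation.

The powers of ε are exact: the energy and linear momentum fluxes are unit-sphere integrals without a
prefactor, the center of mass and angular momentum fluxes carry ε⁻¹. Taylor expansion in ε, uniform
on the compact sphere (`exists_uniform_taylor`, `exists_integral_taylor`), then gives every O(1/r)
error. For E and P only the coefficient at ε = 0 has to be integrated. For C and J that coefficient
must integrate to zero, and the charge is the integral of the first derivative in ε. The same
smoothness gives the decay of the data. The second fundamental form is explicit because ℓ is null,
so the inverse metric is linear in the perturbation (`inv_kerrSchild`); spatial positivity holds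
because the induced metric is the identity plus a nonnegative rank-one matrix.

The data and the charges are covariant under spatial rotations, so P may be put on the third axis
and J in the plane of the first and third axes (`exists_adapted_rotation`). In that normal form a
boost along z, a spin tilted in the xz-plane and a translation along y suffice. On the unit sphere
the inverse rest-frame radius is q = (1 + β²z²)^(-1/2), a function of height alone, so parity in the
coordinates and Archimedes' theorem reduce each flux to an elementary antiderivative in z
(`integral_sphere_eq`). The results are E = 8πmγ, P = (0, 0, −8πmβ), C = (0, 8πm(γζ − β·as), 0), J =
(8πm(γ·as − βζ), 0, 8πm·ac), where as and ac are the components of the spin parameter across and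
along the boost.

Boosting a spin that is transverse to the motion displaces the center of mass along y; the
translation ζ is there to cancel this. Since γ² − β² = 1, the resulting system is solved in closed
form exactly when E² > |P|² with E > 0 (`BoostedKerr.exists_parameters`). -/

namespace KerrData

/-! ### Taylor expansion in a parameter, uniformly on the unit sphere -/

section Taylor

variable {V : Type*} [NormedAddCommGroup V] [NormedSpace ℝ V]

/-- A second order Taylor bound for a function of one variable. -/
theorem abs_sub_sub_le_of_second_deriv {φ φ' φ'' : ℝ → ℝ} {δ C : ℝ}
    (h1 : ∀ s, |s| < δ → HasDerivAt φ (φ' s) s) (h2 : ∀ s, |s| < δ → HasDerivAt φ' (φ'' s) s)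
    (hC : ∀ s, |s| < δ → |φ'' s| ≤ C) {ε : ℝ} (hε : |ε| < δ) :
    |φ ε - φ 0 - ε * φ' 0| ≤ C * ε ^ 2 := by
  have hC0 : 0 ≤ C := (abs_nonneg _).trans (hC ε hε)
  have hlt : ∀ s ∈ Set.Icc (-|ε|) |ε|, |s| < δ := fun s hs => (abs_le.2 hs).trans_lt hε
  have h0 : (0 : ℝ) ∈ Set.Icc (-|ε|) |ε| := ⟨by simp, by simp⟩
  have hε' : ε ∈ Set.Icc (-|ε|) |ε| := ⟨neg_abs_le ε, le_abs_self ε⟩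
  have hd : ∀ s ∈ Set.Icc (-|ε|) |ε|, ‖φ' s - φ' 0‖ ≤ C * |ε| := by
    intro s hs
    refine ((convex_Icc (-|ε|) |ε|).norm_image_sub_le_of_norm_hasDerivWithin_le
      (fun x hx => (h2 x (hlt x hx)).hasDerivWithinAt)
      (fun x hx => hC x (hlt x hx)) h0 hs).trans ?_
    rw [sub_zero]
    exact mul_le_mul_of_nonneg_left (abs_le.2 hs) hC0
  -- The mean value inequality is applied a second time, now to φ minus its linear part. Using it
  -- twice costs the factor 1/2 of Taylor's formula, which is not needed.
  have hmain := (convex_Icc (-|ε|) |ε|).norm_image_sub_le_of_norm_hasDerivWithin_le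
    (f := fun s => φ s - s * φ' 0) (f' := fun s => φ' s - φ' 0)
    (fun x hx => (((h1 x (hlt x hx)).sub
      ((hasDerivAt_id x).mul_const (φ' 0))).congr_deriv (by simp)).hasDerivWithinAt)
    hd h0 hε'
  simp only [Real.norm_eq_abs, zero_mul, sub_zero] at hmain
  calc |φ ε - φ 0 - ε * φ' 0| = |φ ε - ε * φ' 0 - φ 0| := by ring_nf
    _ ≤ C * |ε| * |ε| := hmain
    _ = C * ε ^ 2 := by rw [mul_assoc, abs_mul_abs_self, sq]

theorem hasDerivAt_fst_curry {F : ℝ → V → ℝ} {ε : ℝ} {v : V}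
    (h : DifferentiableAt ℝ (Function.uncurry F) (ε, v)) :
    HasDerivAt (fun s => F s v) (fderiv ℝ (Function.uncurry F) (ε, v) (1, 0)) ε := by
  have h1 : HasDerivAt (fun s : ℝ => (s, v)) ((1 : ℝ), (0 : V)) ε :=
    (hasDerivAt_id ε).prodMk (hasDerivAt_const ε v)
  exact h.hasFDerivAt.comp_hasDerivAt ε h1

theorem hasFDerivAt_snd_curry {F : ℝ → V → ℝ} {ε : ℝ} {v : V}
    (h : DifferentiableAt ℝ (Function.uncurry F) (ε, v)) :
    HasFDerivAt (F ε)
      ((fderiv ℝ (Function.uncurry F) (ε, v)).comp (ContinuousLinearMap.inr ℝ ℝ V)) v :=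
  h.hasFDerivAt.comp v (hasFDerivAt_prodMk_right ε v)

/-- For a function of a parameter and a point, the parameter derivative of a spatial derivative
is the spatial derivative of the parameter derivative. -/
theorem hasDerivAt_fderiv_curry {F : ℝ → V → ℝ} {v : V}
    (h : ContDiffAt ℝ 2 (Function.uncurry F) (0, v)) (w : V) :
    HasDerivAt (fun ε => fderiv ℝ (F ε) v w)
      (fderiv ℝ (fun u => deriv (fun ε => F ε u) 0) v w) 0 := by
  have hev : ∀ᶠ p in 𝓝 ((0 : ℝ), v), DifferentiableAt ℝ (Function.uncurry F) p := by
    filter_upwards [h.eventually (by decide)] with p hp using hp.differentiableAt (by decide)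
  have hD : DifferentiableAt ℝ (fderiv ℝ (Function.uncurry F)) (0, v) :=
    (h.fderiv_right (m := 1) (by norm_num)).differentiableAt (by decide)
  -- The whole statement is the symmetry of the second derivative of the uncurried function in the
  -- directions (1, 0) and (0, w); the rest identifies both sides with it.
  have hsymm : IsSymmSndFDerivAt ℝ (Function.uncurry F) (0, v) :=
    h.isSymmSndFDerivAt (by simp)
  have e1 : (fun ε => fderiv ℝ (F ε) v w) =ᶠ[𝓝 0]
      fun ε => fderiv ℝ (Function.uncurry F) (ε, v) (0, w) := by
    have : Tendsto (fun ε : ℝ => (ε, v)) (𝓝 0) (𝓝 (0, v)) :=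
      (by fun_prop : Continuous fun ε : ℝ => (ε, v)).tendsto 0
    filter_upwards [this.eventually hev] with ε hε
    rw [(hasFDerivAt_snd_curry hε).fderiv]; simp
  have e2 : (fun u => deriv (fun ε => F ε u) 0) =ᶠ[𝓝 v]
      fun u => fderiv ℝ (Function.uncurry F) (0, u) (1, 0) := by
    have : Tendsto (fun u : V => ((0 : ℝ), u)) (𝓝 v) (𝓝 (0, v)) :=
      (by fun_prop : Continuous fun u : V => ((0 : ℝ), u)).tendsto v
    filter_upwards [this.eventually hev] with u hu
    exact (hasDerivAt_fst_curry hu).deriv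
  rw [e2.fderiv_eq]
  have hR : HasFDerivAt (fun u => fderiv ℝ (Function.uncurry F) (0, u) (1, 0))
      (((ContinuousLinearMap.apply ℝ ℝ ((1 : ℝ), (0 : V))).comp
        ((fderiv ℝ (fderiv ℝ (Function.uncurry F)) (0, v)).comp
          (ContinuousLinearMap.inr ℝ ℝ V)))) v :=
    (ContinuousLinearMap.apply ℝ ℝ ((1 : ℝ), (0 : V))).hasFDerivAt.comp v
      (hD.hasFDerivAt.comp v (hasFDerivAt_prodMk_right (0 : ℝ) v))
  rw [hR.fderiv]
  have hp : HasDerivAt (fun s : ℝ => (s, v)) ((1 : ℝ), (0 : V)) 0 :=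
    (hasDerivAt_id (0 : ℝ)).prodMk (hasDerivAt_const (0 : ℝ) v)
  have hL := (ContinuousLinearMap.apply ℝ ℝ ((0 : ℝ), w)).hasFDerivAt.comp_hasDerivAt (0 : ℝ)
    (hD.hasFDerivAt.comp_hasDerivAt (0 : ℝ) hp)
  refine (hL.congr_of_eventuallyEq e1).congr_deriv ?_
  simpa using hsymm (1, 0) (0, w)

/-- Order `∞` absorbs the lost derivative, so first derivatives of the rescaled metric can be
expanded in ε in the same way as the metric itself. -/
theorem contDiffAt_fderiv_curry {F : ℝ → V → ℝ} {ε : ℝ} {v : V}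
    (h : ContDiffAt ℝ ∞ (Function.uncurry F) (ε, v)) (w : V) :
    ContDiffAt ℝ ∞ (Function.uncurry fun ε v => fderiv ℝ (F ε) v w) (ε, v) := by
  have h1 : ContDiffAt ℝ ∞ (fun p : ℝ × V => fderiv ℝ (F p.1) p.2) (ε, v) := by
    refine ContDiffAt.fderiv (f := fun p : ℝ × V => F p.1) (n := ∞) ?_ contDiffAt_snd (by simp)
    exact ContDiffAt.comp ((ε, v), v) (f := fun p : (ℝ × V) × V => (p.1.1, p.2)) h
      ((contDiffAt_fst.comp _ contDiffAt_fst).prodMk contDiffAt_snd)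
  exact h1.clm_apply contDiffAt_const

/-- A function of a parameter and a point which is smooth along `{0} × S`, `S` compact, has a
second order Taylor expansion in the parameter, uniformly on `S`. -/
theorem exists_uniform_taylor {F : ℝ → V → ℝ} {S : Set V} (hS : IsCompact S)
    (h : ∀ v ∈ S, ContDiffAt ℝ 2 (Function.uncurry F) (0, v)) :
    ∃ δ > 0, ∃ C ≥ 0, ∀ ε, |ε| < δ → ∀ v ∈ S,
      ContDiffAt ℝ 2 (Function.uncurry F) (ε, v) ∧
      |F ε v - F 0 v - ε * deriv (fun s => F s v) 0| ≤ C * ε ^ 2 := by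
  refine hS.induction_on (p := fun S => ∃ δ > 0, ∃ C ≥ 0, ∀ ε, |ε| < δ → ∀ v ∈ S,
      ContDiffAt ℝ 2 (Function.uncurry F) (ε, v) ∧
      |F ε v - F 0 v - ε * deriv (fun s => F s v) 0| ≤ C * ε ^ 2) ?_ ?_ ?_ ?_
  · exact ⟨1, one_pos, 0, le_rfl, by simp⟩
  · rintro s t hst ⟨δ, hδ, C, hC, H⟩
    exact ⟨δ, hδ, C, hC, fun ε hε v hv => H ε hε v (hst hv)⟩
  · rintro s t ⟨δ, hδ, C, hC, H⟩ ⟨δ', hδ', C', hC', H'⟩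
    refine ⟨min δ δ', lt_min hδ hδ', max C C', le_max_of_le_left hC, ?_⟩
    rintro ε hε v (hv | hv)
    · obtain ⟨h1, h2⟩ := H ε (hε.trans_le (min_le_left _ _)) v hv
      exact ⟨h1, h2.trans (by gcongr; exact le_max_left _ _)⟩
    · obtain ⟨h1, h2⟩ := H' ε (hε.trans_le (min_le_right _ _)) v hv
      exact ⟨h1, h2.trans (by gcongr; exact le_max_right _ _)⟩
  · intro v hv
    have hv' := h v hv
    set G : ℝ × V → ℝ := Function.uncurry F with hG
    have hD : ContDiffAt ℝ 1 (fun p => fderiv ℝ G p (1, 0)) (0, v) :=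
      (hv'.fderiv_right (m := 1) (by norm_num)).clm_apply contDiffAt_const
    have hD2 : ContinuousAt (fun p => fderiv ℝ (fun p => fderiv ℝ G p (1, 0)) p (1, 0)) (0, v) :=
      ((hD.fderiv_right (m := 0) (by norm_num)).clm_apply contDiffAt_const).continuousAt
    -- Locally the second parameter derivative is bounded by its value at (0, v) plus 1. A product
    -- neighbourhood then gives one interval of parameters valid for all nearby points, and
    -- compactness glues finitely many of these.
    set C := |fderiv ℝ (fun p => fderiv ℝ G p (1, 0)) (0, v) (1, 0)| + 1 with hC
    have hev : ∀ᶠ p in 𝓝 ((0 : ℝ), v), ContDiffAt ℝ 2 G p ∧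
        ContDiffAt ℝ 1 (fun p => fderiv ℝ G p (1, 0)) p ∧
        |fderiv ℝ (fun p => fderiv ℝ G p (1, 0)) p (1, 0)| < C := by
      refine (hv'.eventually (by decide)).and ((hD.eventually (by decide)).and ?_)
      exact hD2.abs.eventually_lt continuousAt_const (by simp [hC])
    rw [nhds_prod_eq, eventually_prod_iff] at hev
    obtain ⟨pa, hpa, pb, hpb, H⟩ := hev
    obtain ⟨δ, hδ, hball⟩ := Metric.eventually_nhds_iff.1 hpa
    refine ⟨{u | pb u}, mem_nhdsWithin_of_mem_nhds hpb, δ, hδ, C, by positivity, ?_⟩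
    intro ε hε u hu
    have hin : ∀ s : ℝ, |s| < δ → pa s := fun s hs => hball (by simpa using hs)
    refine ⟨(H (hin ε hε) hu).1, ?_⟩
    have hd1 : ∀ s : ℝ, |s| < δ → HasDerivAt (fun s => F s u) (fderiv ℝ G (s, u) (1, 0)) s :=
      fun s hs => hasDerivAt_fst_curry ((H (hin s hs) hu).1.differentiableAt (by decide))
    have hd2 : ∀ s : ℝ, |s| < δ → HasDerivAt (fun s => fderiv ℝ G (s, u) (1, 0))
        (fderiv ℝ (fun p => fderiv ℝ G p (1, 0)) (s, u) (1, 0)) s :=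
      fun s hs => hasDerivAt_fst_curry (F := fun s u => fderiv ℝ G (s, u) (1, 0))
        ((H (hin s hs) hu).2.1.differentiableAt (by decide))
    have := abs_sub_sub_le_of_second_deriv hd1 hd2 (fun s hs => (H (hin s hs) hu).2.2.le) hε
    rwa [(hd1 0 (by simpa using hδ)).deriv]

/-- A function of a parameter and a point which is smooth along `{0} × S`, `S` compact, is
bounded on a neighbourhood of `{0} × S` in `ℝ × S`. -/
theorem exists_uniform_bound {V : Type*} [TopologicalSpace V] {F : ℝ → V → ℝ} {S : Set V} (hS : IsCompact S)
    (h : ∀ v ∈ S, ContinuousAt (Function.uncurry F) (0, v)) :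
    ∃ δ > 0, ∃ C ≥ 0, ∀ ε, |ε| < δ → ∀ v ∈ S, |F ε v| ≤ C := by
  refine hS.induction_on (p := fun S => ∃ δ > 0, ∃ C ≥ 0, ∀ ε, |ε| < δ → ∀ v ∈ S,
      |F ε v| ≤ C) ?_ ?_ ?_ ?_
  · exact ⟨1, one_pos, 0, le_rfl, by simp⟩
  · rintro s t hst ⟨δ, hδ, C, hC, H⟩
    exact ⟨δ, hδ, C, hC, fun ε hε v hv => H ε hε v (hst hv)⟩
  · rintro s t ⟨δ, hδ, C, hC, H⟩ ⟨δ', hδ', C', hC', H'⟩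
    refine ⟨min δ δ', lt_min hδ hδ', max C C', le_max_of_le_left hC, ?_⟩
    rintro ε hε v (hv | hv)
    · exact (H ε (hε.trans_le (min_le_left _ _)) v hv).trans (le_max_left _ _)
    · exact (H' ε (hε.trans_le (min_le_right _ _)) v hv).trans (le_max_right _ _)
  · intro v hv
    have hev : ∀ᶠ p in 𝓝 ((0 : ℝ), v), |Function.uncurry F p| < |F 0 v| + 1 :=
      (h v hv).abs.eventually_lt continuousAt_const (by simp [Function.uncurry])
    rw [nhds_prod_eq, eventually_prod_iff] at hev
    obtain ⟨pa, hpa, pb, hpb, H⟩ := hev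
    obtain ⟨δ, hδ, hball⟩ := Metric.eventually_nhds_iff.1 hpa
    exact ⟨{u | pb u}, mem_nhdsWithin_of_mem_nhds hpb, δ, hδ, |F 0 v| + 1, by positivity,
      fun ε hε u hu => (H (hball (by simpa using hε)) hu).le⟩

end Taylor

/-! ### Parameter-dependent integrals over the unit sphere -/

/-- The area measure of the unit sphere. -/
noncomputable abbrev sphereMeasure : Measure (Metric.sphere (0 : E3) 1) :=
  (volume : Measure E3).toSphere

theorem integrable_sphere {f : E3 → ℝ} (hf : ∀ v : E3, ‖v‖ = 1 → ContinuousAt f v) :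
    Integrable (fun ν : Metric.sphere (0 : E3) 1 => f ν) sphereMeasure := by
  have hc : Continuous fun ν : Metric.sphere (0 : E3) 1 => f ν :=
    continuous_iff_continuousAt.2 fun ν =>
      (hf ν (by simp)).comp continuous_subtype_val.continuousAt
  exact hc.integrable_of_hasCompactSupport (HasCompactSupport.of_compactSpace _)

theorem two_le_infty : (2 : WithTop ℕ∞) ≤ ∞ := WithTop.coe_le_coe.2 (le_top : (2 : ℕ∞) ≤ ⊤)

/-- Taylor expansion of a sphere integral depending on a parameter. -/
theorem exists_integral_taylor {F : ℝ → E3 → ℝ} {F₁ : E3 → ℝ}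
    (h : ∀ v : E3, ‖v‖ = 1 → ContDiffAt ℝ ∞ (Function.uncurry F) (0, v))
    (h1 : ∀ v : E3, ‖v‖ = 1 → HasDerivAt (fun ε => F ε v) (F₁ v) 0) :
    ∃ δ > 0, ∃ C ≥ 0, ∀ ε, |ε| < δ →
      |∫ ν : Metric.sphere (0 : E3) 1, F ε ν ∂sphereMeasure
        - ∫ ν : Metric.sphere (0 : E3) 1, F 0 ν ∂sphereMeasure
        - ε * ∫ ν : Metric.sphere (0 : E3) 1, F₁ ν ∂sphereMeasure| ≤ C * ε ^ 2 := by
  have h' : ∀ v ∈ Metric.sphere (0 : E3) 1, ContDiffAt ℝ 2 (Function.uncurry F) (0, v) :=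
    fun v hv => (h v (by simpa using hv)).of_le two_le_infty
  obtain ⟨δ, hδ, C, hC, H⟩ := exists_uniform_taylor (isCompact_sphere (0 : E3) 1) h'
  refine ⟨δ, hδ, C * sphereMeasure.real Set.univ, by positivity, fun ε hε => ?_⟩
  have hcont : ∀ s, |s| < δ → ∀ v : E3, ‖v‖ = 1 → ContinuousAt (F s) v := fun s hs v hv =>
    ContinuousAt.comp (f := fun v => (s, v)) (g := Function.uncurry F)
      (H s hs v (by simpa using hv)).1.continuousAt (by fun_prop)
  have hI := integrable_sphere (hcont ε hε)
  have hI0 := integrable_sphere (hcont 0 (by simpa using hδ))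
  -- Nothing is assumed about the continuity of `F₁`: by uniqueness of derivatives it agrees on the
  -- sphere with a partial derivative of the uncurried function, which is continuous there.
  have hI1 : Integrable (fun ν : Metric.sphere (0 : E3) 1 => F₁ ν) sphereMeasure := by
    have hc := integrable_sphere (f := fun v => fderiv ℝ (Function.uncurry F) (0, v) (1, 0))
      fun v hv => by
        have := ((h v hv).fderiv_right (m := ∞) (by simp)).clm_apply
          (contDiffAt_const (c := ((1 : ℝ), (0 : E3))))
        exact ContinuousAt.comp (f := fun v : E3 => ((0 : ℝ), v))
          (g := fun p => fderiv ℝ (Function.uncurry F) p (1, 0)) this.continuousAt (by fun_prop)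
    refine hc.congr (Eventually.of_forall fun ν => ?_)
    exact (hasDerivAt_fst_curry ((h ν (by simp)).differentiableAt (by simp))).unique
      (h1 ν (by simp))
  rw [← integral_const_mul, ← integral_sub hI hI0,
    ← integral_sub (f := fun ν : Metric.sphere (0 : E3) 1 => F ε ν - F 0 ν)
      (hI.sub hI0) (hI1.const_mul ε)]
  have := norm_integral_le_of_norm_le_const (μ := sphereMeasure)
    (f := fun ν : Metric.sphere (0 : E3) 1 => F ε ν - F 0 ν - ε * F₁ ν) (C := C * ε ^ 2)
    (Eventually.of_forall fun ν => by
      rw [Real.norm_eq_abs, ← (h1 ν (by simp)).deriv]; exact (H ε hε ν ν.2).2)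
  calc _ ≤ _ := this
    _ = _ := by ring

/-! ### Gradients of functions on spacetime -/

/-- `f` is differentiable at `x` with partial derivatives `d`. -/
def HasGrad (f : (Fin 4 → ℝ) → ℝ) (d : Fin 4 → ℝ) (x : Fin 4 → ℝ) : Prop :=
  DifferentiableAt ℝ f x ∧ ∀ μ, pd4 μ f x = d μ

theorem hasGrad_coord (ρ : Fin 4) (x : Fin 4 → ℝ) :
    HasGrad (fun y => y ρ) (Pi.single ρ 1) x := by
  have h : HasFDerivAt (fun y : Fin 4 → ℝ => y ρ) (ContinuousLinearMap.proj ρ) x :=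
    (ContinuousLinearMap.proj (R := ℝ) (φ := fun _ : Fin 4 => ℝ) ρ).hasFDerivAt
  refine ⟨h.differentiableAt, fun μ => ?_⟩
  rw [pd4, h.fderiv]
  simp [Pi.single_apply, eq_comm]

theorem hasGrad_const (c : ℝ) (x : Fin 4 → ℝ) : HasGrad (fun _ => c) 0 x :=
  ⟨differentiableAt_const c, fun μ => by simp [pd4]⟩

namespace HasGrad

variable {f g : (Fin 4 → ℝ) → ℝ} {d e : Fin 4 → ℝ} {x : Fin 4 → ℝ}

theorem congr_grad (hf : HasGrad f d x) (h : ∀ μ, d μ = e μ) : HasGrad f e x :=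
  ⟨hf.1, fun μ => (hf.2 μ).trans (h μ)⟩

theorem add (hf : HasGrad f d x) (hg : HasGrad g e x) :
    HasGrad (fun y => f y + g y) (fun μ => d μ + e μ) x :=
  ⟨hf.1.add hg.1, fun μ => by
    rw [pd4, fderiv_fun_add hf.1 hg.1]; simp [← hf.2 μ, ← hg.2 μ, pd4]⟩

theorem sub (hf : HasGrad f d x) (hg : HasGrad g e x) :
    HasGrad (fun y => f y - g y) (fun μ => d μ - e μ) x :=
  ⟨hf.1.sub hg.1, fun μ => by
    rw [pd4, fderiv_fun_sub hf.1 hg.1]; simp [← hf.2 μ, ← hg.2 μ, pd4]⟩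

theorem mul (hf : HasGrad f d x) (hg : HasGrad g e x) :
    HasGrad (fun y => f y * g y) (fun μ => d μ * g x + f x * e μ) x :=
  ⟨hf.1.mul hg.1, fun μ => by
    rw [pd4, fderiv_fun_mul hf.1 hg.1]; simp [← hf.2 μ, ← hg.2 μ, pd4]; ring⟩

theorem const_mul (c : ℝ) (hf : HasGrad f d x) :
    HasGrad (fun y => c * f y) (fun μ => c * d μ) x :=
  ((hasGrad_const c x).mul hf).congr_grad fun μ => by simp

theorem comp {φ : ℝ → ℝ} {φ' : ℝ} (hφ : HasDerivAt φ φ' (f x)) (hf : HasGrad f d x) :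
    HasGrad (fun y => φ (f y)) (fun μ => φ' * d μ) x := by
  have h := hφ.comp_hasFDerivAt x hf.1.hasFDerivAt
  refine ⟨h.differentiableAt, fun μ => ?_⟩
  have h2 : fderiv ℝ (fun y => φ (f y)) x = φ' • fderiv ℝ f x := h.fderiv
  rw [pd4, h2]; simp [← hf.2 μ, pd4]

end HasGrad

/-! ### Integration over the unit sphere -/

section Sphere

open scoped Pointwise

/-- `toSphere` measures a set by the volume of the open cone over it, so computing with it requires
a description of that cone by norm and direction. -/
theorem mem_Ioo_smul_sphere {A : Set (Metric.sphere (0 : E3) 1)} {x : E3} :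
    x ∈ Set.Ioo (0 : ℝ) 1 • ((↑) '' A : Set E3) ↔
      0 < ‖x‖ ∧ ‖x‖ < 1 ∧ ∃ ν ∈ A, (ν : E3) = ‖x‖⁻¹ • x := by
  rw [Set.mem_smul]
  constructor
  · rintro ⟨r, ⟨h0, h1⟩, _, ⟨ν, hν, rfl⟩, rfl⟩
    have hn : ‖r • (ν : E3)‖ = r := by simp [norm_smul, abs_of_pos h0]
    rw [hn]
    exact ⟨h0, h1, ν, hν, by rw [smul_smul, inv_mul_cancel₀ h0.ne', one_smul]⟩
  · rintro ⟨h0, h1, ν, hν, h⟩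
    refine ⟨‖x‖, ⟨h0, h1⟩, ν, ⟨ν, hν, rfl⟩, ?_⟩
    rw [h, smul_smul, mul_inv_cancel₀ h0.ne', one_smul]

/-- The action of a linear isometry on the unit sphere. -/
noncomputable def sphereIsometry (e : E3 ≃ₗᵢ[ℝ] E3) : Metric.sphere (0 : E3) 1 ≃ₜ Metric.sphere (0 : E3) 1 where
  toFun ν := ⟨e ν, by simp⟩
  invFun ν := ⟨e.symm ν, by simp⟩
  left_inv ν := by simp
  right_inv ν := by simp
  continuous_toFun := (e.continuous.comp continuous_subtype_val).subtype_mk _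
  continuous_invFun := (e.symm.continuous.comp continuous_subtype_val).subtype_mk _

/-- The area of a set is three times the volume of its cone; an isometry commutes with taking cones
and preserves volume. -/
theorem measurePreserving_sphereIsometry (e : E3 ≃ₗᵢ[ℝ] E3) :
    MeasurePreserving (sphereIsometry e) sphereMeasure sphereMeasure := by
  refine ⟨(sphereIsometry e).measurable, Measure.ext fun A hA => ?_⟩
  have hA' : MeasurableSet (sphereIsometry e ⁻¹' A) := (sphereIsometry e).measurable hA
  rw [Measure.map_apply (sphereIsometry e).measurable hA, Measure.toSphere_apply' _ hA',
    Measure.toSphere_apply' _ hA]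
  congr 1
  have hp : MeasurePreserving e.toHomeomorph.toMeasurableEquiv (volume : Measure E3) volume :=
    e.measurePreserving
  rw [← hp.measure_preimage_equiv (Set.Ioo (0 : ℝ) 1 • ((↑) '' A : Set E3))]
  congr 1
  ext x
  have hx : e.toHomeomorph.toMeasurableEquiv x = e x := rfl
  rw [Set.mem_preimage, mem_Ioo_smul_sphere, mem_Ioo_smul_sphere, hx, e.norm_map]
  refine and_congr_right fun _ => and_congr_right fun _ => ?_
  constructor
  · rintro ⟨ν, hν, h⟩
    exact ⟨sphereIsometry e ν, hν, by simp [sphereIsometry, h]⟩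
  · rintro ⟨ν, hν, h⟩
    refine ⟨(sphereIsometry e).symm ν, by simpa using hν, ?_⟩
    simp [sphereIsometry, h]

theorem integral_sphere_comp_isometry (e : E3 ≃ₗᵢ[ℝ] E3) (f : E3 → ℝ) :
    ∫ ν : Metric.sphere (0 : E3) 1, f (e ν) ∂sphereMeasure =
      ∫ ν : Metric.sphere (0 : E3) 1, f ν ∂sphereMeasure :=
  (measurePreserving_sphereIsometry e).integral_comp (sphereIsometry e).measurableEmbedding
    (fun ν => f ν)

/-- The cylindrical decomposition of `ℝ³` into axis and orthogonal plane. -/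
theorem measurePreserving_axis_plane :
    MeasurePreserving (fun x : E3 => (x 2, (x 0, x 1))) volume volume := by
  have h1 := EuclideanSpace.volume_preserving_symm_measurableEquiv_toLp (Fin 3)
  have h2 := volume_preserving_piFinSuccAbove (fun _ : Fin 3 => ℝ) 2
  have h3 := volume_preserving_piFinTwo (fun _ : Fin 2 => ℝ)
  have h4 := ((MeasurePreserving.id (volume : Measure ℝ)).prod h3).comp (h2.comp h1)
  exact h4

/-- Polar coordinates, with the angle contributing 2π. -/
theorem lintegral_plane_radial (f : ℝ → ENNReal) (hf : Measurable f) :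
    ∫⁻ p : ℝ × ℝ, f (p.1 ^ 2 + p.2 ^ 2) =
      ENNReal.ofReal (2 * Real.pi) * ∫⁻ s in Set.Ioi (0 : ℝ), ENNReal.ofReal s * f (s ^ 2) := by
  rw [← lintegral_comp_polarCoord_symm]
  have e : ∀ p : ℝ × ℝ, ENNReal.ofReal p.1 • f ((polarCoord.symm p).1 ^ 2 +
      (polarCoord.symm p).2 ^ 2) = (ENNReal.ofReal p.1 * f (p.1 ^ 2)) * 1 := by
    intro p
    have : (p.1 * Real.cos p.2) ^ 2 + (p.1 * Real.sin p.2) ^ 2 = p.1 ^ 2 := by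
      linear_combination p.1 ^ 2 * Real.cos_sq_add_sin_sq p.2
    simp [this]
  simp only [e]
  rw [polarCoord_target, Measure.volume_eq_prod, ← Measure.prod_restrict,
    lintegral_prod_mul (f := fun s => ENNReal.ofReal s * f (s ^ 2)) (g := fun _ => 1)
      (by fun_prop) (by fun_prop)]
  rw [lintegral_one, Measure.restrict_apply_univ, Real.volume_Ioo, mul_comm]
  congr 2; ring

/-- In polar coordinates the half plane is cut out by angles in (0, π). With the axis of ℝ³ as first
coordinate and the distance to it as second, the angle is the colatitude. -/
theorem lintegral_upper_half_plane (f : ℝ × ℝ → ENNReal) :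
    ∫⁻ p in {p : ℝ × ℝ | 0 < p.2}, f p =
      ∫⁻ p in Set.Ioi (0 : ℝ) ×ˢ Set.Ioo 0 Real.pi,
        ENNReal.ofReal p.1 * f (p.1 * Real.cos p.2, p.1 * Real.sin p.2) := by
  have hm : MeasurableSet {p : ℝ × ℝ | 0 < p.2} := measurableSet_lt measurable_const measurable_snd
  have hm2 : MeasurableSet (Set.Ioi (0 : ℝ) ×ˢ Set.Ioo 0 Real.pi) :=
    measurableSet_Ioi.prod measurableSet_Ioo
  rw [← lintegral_indicator hm, ← lintegral_comp_polarCoord_symm,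
    ← lintegral_indicator polarCoord.open_target.measurableSet, ← lintegral_indicator hm2]
  congr 1
  ext p
  rw [polarCoord_target]
  by_cases hp : p ∈ Set.Ioi (0 : ℝ) ×ˢ Set.Ioo 0 Real.pi
  · have hp' : p ∈ Set.Ioi (0 : ℝ) ×ˢ Set.Ioo (-Real.pi) Real.pi :=
      ⟨hp.1, by linarith [hp.2.1, Real.pi_pos], hp.2.2⟩
    have hpos : 0 < p.1 * Real.sin p.2 :=
      mul_pos hp.1 (Real.sin_pos_of_pos_of_lt_pi hp.2.1 hp.2.2)
    rw [Set.indicator_of_mem hp, Set.indicator_of_mem hp', Set.indicator_of_mem] <;>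
      simp [hpos]
  · rw [Set.indicator_of_notMem hp]
    by_cases hp' : p ∈ Set.Ioi (0 : ℝ) ×ˢ Set.Ioo (-Real.pi) Real.pi
    · have hneg : ¬ 0 < p.1 * Real.sin p.2 := by
        have h1 : p.2 ≤ 0 := by
          by_contra h
          exact hp ⟨hp'.1, not_le.1 h, hp'.2.2⟩
        have h2 : Real.sin p.2 ≤ 0 := Real.sin_nonpos_of_nonpos_of_neg_pi_le h1 hp'.2.1.le
        exact not_lt.2 (mul_nonpos_of_nonneg_of_nonpos (le_of_lt hp'.1) h2)
      rw [Set.indicator_of_mem hp', Set.indicator_of_notMem] <;> simp [hneg]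
    · rw [Set.indicator_of_notMem hp']

/-- Cylindrical coordinates: the factor `p.2` is the distance to the axis. Together with polar
coordinates in the meridian half plane this yields spherical coordinates. -/
theorem lintegral_axisymmetric (G : ℝ × ℝ → ENNReal) (hG : Measurable G) :
    ∫⁻ x : E3, G (x 2, x 0 ^ 2 + x 1 ^ 2) =
      ENNReal.ofReal (2 * Real.pi) * ∫⁻ p in {p : ℝ × ℝ | 0 < p.2},
        ENNReal.ofReal p.2 * G (p.1, p.2 ^ 2) := by
  have h := measurePreserving_axis_plane.lintegral_comp
    (f := fun p => G (p.1, p.2.1 ^ 2 + p.2.2 ^ 2)) (by fun_prop)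
  simp only at h
  rw [h, Measure.volume_eq_prod, lintegral_prod _ (by fun_prop)]
  have e : {p : ℝ × ℝ | 0 < p.2} = Set.univ ×ˢ Set.Ioi 0 := by ext p; simp
  rw [e, Measure.volume_eq_prod ℝ ℝ, ← Measure.prod_restrict, Measure.restrict_univ,
    lintegral_prod _ (by fun_prop), ← lintegral_const_mul' _ _ ENNReal.ofReal_ne_top]
  refine lintegral_congr fun z => ?_
  exact lintegral_plane_radial (fun w => G (z, w)) (by fun_prop)

theorem norm_sq_E3 (x : E3) : ‖x‖ ^ 2 = x 0 ^ 2 + x 1 ^ 2 + x 2 ^ 2 := by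
  rw [EuclideanSpace.norm_sq_eq, Fin.sum_univ_three]
  simp

/-- The substitution c = cos θ, which maps (0, π) injectively onto (−1, 1) with Jacobian sin θ. -/
theorem lintegral_sin_indicator {B : Set ℝ} (hB : MeasurableSet B) :
    ∫⁻ θ in Set.Ioo 0 Real.pi, ENNReal.ofReal (Real.sin θ) *
      B.indicator (fun _ => (1 : ENNReal)) (Real.cos θ) = volume (B ∩ Set.Ioo (-1) 1) := by
  have himg : Real.cos '' Set.Ioo 0 Real.pi = Set.Ioo (-1) 1 := by
    apply Set.Subset.antisymm
    · rintro _ ⟨θ, hθ, rfl⟩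
      constructor
      · have := Real.cos_lt_cos_of_nonneg_of_le_pi hθ.1.le le_rfl hθ.2
        simpa using this
      · have := Real.cos_lt_cos_of_nonneg_of_le_pi le_rfl hθ.2.le hθ.1
        simpa using this
    · rintro c ⟨h1, h2⟩
      refine ⟨Real.arccos c, ⟨Real.arccos_pos.2 h2, ?_⟩, Real.cos_arccos h1.le h2.le⟩
      rcases (Real.arccos_le_pi c).lt_or_eq with h | h
      · exact h
      · have := Real.cos_arccos h1.le h2.le
        rw [h, Real.cos_pi] at this
        linarith
  have h := lintegral_image_eq_lintegral_abs_deriv_mul (s := Set.Ioo 0 Real.pi) (f := Real.cos)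
    (f' := fun θ => -Real.sin θ) measurableSet_Ioo
    (fun θ _ => (Real.hasDerivAt_cos θ).hasDerivWithinAt)
    (Real.injOn_cos.mono Set.Ioo_subset_Icc_self) (B.indicator 1)
  rw [himg, lintegral_indicator_one hB, Measure.restrict_apply hB] at h
  rw [h]
  refine setLIntegral_congr_fun measurableSet_Ioo fun θ hθ => ?_
  rw [abs_neg, abs_of_pos (Real.sin_pos_of_pos_of_lt_pi hθ.1 hθ.2)]
  rfl

/-- Archimedes: the height function pushes the area of the unit sphere forward to `2π` times
Lebesgue measure on `[-1,1]`. -/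
theorem map_height_sphereMeasure :
    sphereMeasure.map (fun ν : Metric.sphere (0 : E3) 1 => (ν : E3) 2) =
      ENNReal.ofReal (2 * Real.pi) • volume.restrict (Set.Ioo (-1) 1) := by
  have hmeas : Measurable fun ν : Metric.sphere (0 : E3) 1 => (ν : E3) 2 :=
    (by fun_prop : Continuous fun ν : Metric.sphere (0 : E3) 1 => (ν : E3) 2).measurable
  refine Measure.ext fun (B : Set ℝ) hB => ?_
  rw [Measure.map_apply hmeas hB, Measure.smul_apply, Measure.restrict_apply hB,
    Measure.toSphere_apply' _ (hmeas hB)]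
  -- The indicator of the cone over the set of heights in `B`, written in terms of z and the squared
  -- distance to the axis.
  set G : ℝ × ℝ → ENNReal := fun p =>
    (Set.Ioo (0 : ℝ) 1).indicator (fun _ => 1) √(p.1 ^ 2 + p.2) *
      B.indicator (fun _ => 1) (p.1 / √(p.1 ^ 2 + p.2)) with hG
  have hGm : Measurable G := by
    refine Measurable.mul ?_ ?_
    · exact (measurable_const.indicator measurableSet_Ioo).comp (by fun_prop)
    · exact (measurable_const.indicator hB).comp (by fun_prop)
  have hset : volume (Set.Ioo (0 : ℝ) 1 •
      ((↑) '' ((fun ν : Metric.sphere (0 : E3) 1 => (ν : E3) 2) ⁻¹' B) : Set E3)) =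
      ∫⁻ x : E3, G (x 2, x 0 ^ 2 + x 1 ^ 2) := by
    set S := Set.Ioo (0 : ℝ) 1 •
      ((↑) '' ((fun ν : Metric.sphere (0 : E3) 1 => (ν : E3) 2) ⁻¹' B) : Set E3) with hS
    have hind : ∀ x : E3, G (x 2, x 0 ^ 2 + x 1 ^ 2) = S.indicator 1 x := by
      intro x
      have hn : √(x 2 ^ 2 + (x 0 ^ 2 + x 1 ^ 2)) = ‖x‖ := by
        rw [show x 2 ^ 2 + (x 0 ^ 2 + x 1 ^ 2) = ‖x‖ ^ 2 by rw [norm_sq_E3]; ring]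
        exact Real.sqrt_sq (norm_nonneg x)
      have hiff : x ∈ S ↔ ‖x‖ ∈ Set.Ioo (0 : ℝ) 1 ∧ x 2 / ‖x‖ ∈ B := by
        rw [hS, mem_Ioo_smul_sphere, Set.mem_Ioo, and_assoc]
        refine and_congr_right fun h0 => and_congr_right fun _ => ?_
        constructor
        · rintro ⟨ν, hν, h⟩
          rw [Set.mem_preimage, h] at hν
          simpa [div_eq_inv_mul] using hν
        · intro h
          refine ⟨⟨‖x‖⁻¹ • x, by simp [norm_smul, h0.ne']⟩, ?_, rfl⟩
          simpa [div_eq_inv_mul] using h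
      simp only [hG, hn]
      by_cases hx : x ∈ S
      · rw [Set.indicator_of_mem hx, Set.indicator_of_mem (hiff.1 hx).1,
          Set.indicator_of_mem (hiff.1 hx).2]; simp
      · rw [Set.indicator_of_notMem hx]
        rcases not_and_or.1 (fun h => hx (hiff.2 h)) with h | h
        · rw [Set.indicator_of_notMem h, zero_mul]
        · rw [Set.indicator_of_notMem h, mul_zero]
    -- The cone is measurable because its indicator is `G` composed with a continuous map.
    have hSm : MeasurableSet S := by
      have : Measurable (S.indicator (1 : E3 → ENNReal)) := by
        rw [← funext hind]; exact hGm.comp (by fun_prop)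
      exact (measurable_indicator_const_iff (1 : ENNReal)).1 this
    simp only [hind]
    rw [lintegral_indicator_one hSm]
  rw [hset, lintegral_axisymmetric G hGm, lintegral_upper_half_plane]
  -- In spherical coordinates the integrand separates into r² on (0, 1) and sin θ times the
  -- condition on cos θ.
  have e : ∀ p ∈ Set.Ioi (0 : ℝ) ×ˢ Set.Ioo 0 Real.pi,
      ENNReal.ofReal p.1 * (ENNReal.ofReal (p.1 * Real.sin p.2) *
        G (p.1 * Real.cos p.2, (p.1 * Real.sin p.2) ^ 2)) =
      (Set.Ioo (0 : ℝ) 1).indicator (fun r => ENNReal.ofReal (r ^ 2)) p.1 *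
        (ENNReal.ofReal (Real.sin p.2) * B.indicator (fun _ => (1 : ENNReal)) (Real.cos p.2)) := by
    rintro ⟨r, θ⟩ ⟨hr, hθ⟩
    have hr : 0 < r := hr
    have hn : √((r * Real.cos θ) ^ 2 + (r * Real.sin θ) ^ 2) = r := by
      rw [show (r * Real.cos θ) ^ 2 + (r * Real.sin θ) ^ 2 = r ^ 2 by
        linear_combination r ^ 2 * Real.cos_sq_add_sin_sq θ]
      exact Real.sqrt_sq hr.le
    have hc : r * Real.cos θ / r = Real.cos θ := by field_simp
    simp only [hG, hn, hc]
    rw [ENNReal.ofReal_mul hr.le]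
    by_cases h1 : r ∈ Set.Ioo (0 : ℝ) 1
    · rw [Set.indicator_of_mem h1, Set.indicator_of_mem h1, sq, ENNReal.ofReal_mul hr.le]
      ring
    · rw [Set.indicator_of_notMem h1, Set.indicator_of_notMem h1]; simp
  rw [setLIntegral_congr_fun (measurableSet_Ioi.prod measurableSet_Ioo) e,
    Measure.volume_eq_prod ℝ ℝ, ← Measure.prod_restrict,
    lintegral_prod_mul (f := (Set.Ioo (0 : ℝ) 1).indicator fun r => ENNReal.ofReal (r ^ 2))
      (g := fun θ => ENNReal.ofReal (Real.sin θ) *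
        B.indicator (fun _ => (1 : ENNReal)) (Real.cos θ))
      ((Measurable.indicator (by fun_prop) measurableSet_Ioo).aemeasurable)
      ((Measurable.mul (by fun_prop)
        ((measurable_const.indicator hB).comp Real.measurable_cos)).aemeasurable),
    lintegral_sin_indicator hB, setLIntegral_indicator measurableSet_Ioo]
  -- The radial integral 1/3 cancels the dimension factor 3 in `toSphere`.
  have h13 : ∫⁻ r in Set.Ioo (0 : ℝ) 1 ∩ Set.Ioi 0, ENNReal.ofReal (r ^ 2) =
      ENNReal.ofReal (1 / 3) := by
    rw [Set.inter_eq_left.2 (fun r hr => hr.1)]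
    rw [← ofReal_integral_eq_lintegral_ofReal]
    · rw [← integral_Ioc_eq_integral_Ioo, ← intervalIntegral.integral_of_le zero_le_one]
      norm_num
    · exact (continuous_pow 2).continuousOn.integrableOn_Icc.mono_set Set.Ioo_subset_Icc_self
    · exact Eventually.of_forall fun r => sq_nonneg r
  rw [h13]
  simp only [finrank_euclideanSpace, Fintype.card_fin, smul_eq_mul]
  have h3 : ((3 : ℕ) : ENNReal) * ENNReal.ofReal (1 / 3) = 1 := by
    rw [← ENNReal.ofReal_natCast, ← ENNReal.ofReal_mul (by norm_num)]; norm_num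
  calc _ = (((3 : ℕ) : ENNReal) * ENNReal.ofReal (1 / 3)) *
        (ENNReal.ofReal (2 * Real.pi) * volume (B ∩ Set.Ioo (-1) 1)) := by ring
    _ = _ := by rw [h3, one_mul]

/-- Integral over the sphere of the derivative of a function of the height. -/
theorem integral_sphere_deriv_height {G g : ℝ → ℝ} (hG : ∀ c, HasDerivAt G (g c) c)
    (hg : Continuous g) :
    ∫ ν : Metric.sphere (0 : E3) 1, g ((ν : E3) 2) ∂sphereMeasure =
      2 * Real.pi * (G 1 - G (-1)) := by
  have hmeas : Measurable fun ν : Metric.sphere (0 : E3) 1 => (ν : E3) 2 :=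
    (by fun_prop : Continuous fun ν : Metric.sphere (0 : E3) 1 => (ν : E3) 2).measurable
  rw [← integral_map (f := g) hmeas.aemeasurable hg.aestronglyMeasurable,
    map_height_sphereMeasure, integral_smul_measure, ← integral_Ioc_eq_integral_Ioo,
    ← intervalIntegral.integral_of_le (by norm_num),
    intervalIntegral.integral_eq_sub_of_hasDerivAt (fun c _ => hG c) (hg.intervalIntegrable _ _),
    ENNReal.toReal_ofReal (by positivity), smul_eq_mul]

end Sphere

/-! ### Kerr-Schild metrics -/

/-- The inverse of a Kerr-Schild metric `η + 2H ℓ ⊗ ℓ` with `ℓ` null. -/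
theorem inv_kerrSchild {c : ℝ} {ℓ : Fin 4 → ℝ} (h : ℓ 1 ^ 2 + ℓ 2 ^ 2 + ℓ 3 ^ 2 = ℓ 0 ^ 2) :
    (minkowski + c • Matrix.vecMulVec ℓ ℓ)⁻¹ =
      minkowski - c • Matrix.vecMulVec (minkowski *ᵥ ℓ) (minkowski *ᵥ ℓ) := by
  have hη : minkowski * minkowski = 1 := by
    rw [minkowski, Matrix.diagonal_mul_diagonal, ← Matrix.diagonal_one]
    congr 1; ext i; fin_cases i <;> simp
  have hs : minkowskiᵀ = minkowski := by simp [minkowski]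
  -- Nullity kills the term quadratic in the perturbation, so the first-order inverse is exact.
  have hnull : (minkowski *ᵥ ℓ) ⬝ᵥ ℓ = 0 := by
    simp [minkowski, Matrix.mulVec_diagonal, dotProduct, Fin.sum_univ_four]
    linarith
  refine Matrix.inv_eq_left_inv ?_
  rw [sub_mul, mul_add, mul_add, hη, Matrix.smul_mul, Matrix.mul_smul, Matrix.smul_mul,
    Matrix.mul_smul, Matrix.vecMulVec_mul_vecMulVec, hnull, Matrix.mul_vecMulVec,
    Matrix.vecMulVec_mul, ← Matrix.mulVec_transpose, hs, Matrix.mulVec_mulVec, hη]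
  simp

/-- The combination `∂_i A_{ρj} + ∂_j A_{ρi} - ∂_ρ A_{ij}` of first derivatives, with `i`, `j`
spatial. -/
noncomputable def koszul (A : Tensor4) (x : Fin 4 → ℝ) (ρ : Fin 4) (i j : Fin 3) : ℝ :=
  pd4 i.succ (fun y => A y ρ j.succ) x + pd4 j.succ (fun y => A y ρ i.succ) x -
    pd4 ρ (fun y => A y i.succ j.succ) x

/-- The second fundamental form, up to a power of `ε`, of the slice in the rescaled Kerr-Schild
metric `η + εA`. -/
noncomputable def scaledSecondForm (ε : ℝ) (A : Tensor4) (y : E3) : Matrix (Fin 3) (Fin 3) ℝ :=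
  Matrix.of fun i j => (1 / 2) * (√(1 + ε * A (slicePoint y) 0 0) * koszul A (slicePoint y) 0 i j -
    ε / √(1 + ε * A (slicePoint y) 0 0) *
      ∑ l : Fin 3, A (slicePoint y) 0 l.succ * koszul A (slicePoint y) l.succ i j)

theorem slicePoint_smul (c : ℝ) (y : E3) : slicePoint (c • y) = c • slicePoint y := by
  ext i
  refine Fin.cases ?_ (fun i => ?_) i <;> simp [slicePoint]

/-- One factor ε comes from the amplitude and one from the chain rule. Differentiability is not
needed, so the scaling laws below hold at every point, including singular ones. -/
theorem fderiv_scaled {V : Type*} [NormedAddCommGroup V] [NormedSpace ℝ V] (f : V → ℝ) (c ε : ℝ)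
    (x w : V) :
    fderiv ℝ (fun y => c + ε * f (ε • y)) x w = ε ^ 2 * fderiv ℝ f (ε • x) w := by
  rw [fderiv_const_add]
  have h2 : fderiv ℝ (fun y => ε * f (ε • y)) x = ε • fderiv ℝ (fun y => f (ε • y)) x :=
    congrFun (fderiv_const_smul_field (f := fun y => f (ε • y)) ε) x
  rw [h2, fderiv_comp_smul]
  simp; ring

theorem pd4_scaled {G A : Tensor4} {ε : ℝ} (hG : ∀ x, G x = minkowski + ε • A (ε • x))
    (μ α β : Fin 4) (x : Fin 4 → ℝ) :
    pd4 μ (fun y => G y α β) x = ε ^ 2 * pd4 μ (fun y => A y α β) (ε • x) := by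
  have e : (fun y => G y α β) = fun y => minkowski α β + ε * (fun z => A z α β) (ε • y) := by
    ext y; simp [hG]
  rw [pd4, e]
  exact fderiv_scaled (fun z => A z α β) (minkowski α β) ε x _

/-- The spatial components of the conormal vanish identically, so only Γ⁰ᵢⱼ times the lapse
survives, and it involves only the first row of the inverse metric. That row enters as a hypothesis
because its formula rests on ℓ being null. -/
theorem secondFundamentalForm_scaled {G A : Tensor4} {ε : ℝ}
    (hG : ∀ x, G x = minkowski + ε • A (ε • x)) {y : E3}
    (h00 : (G (slicePoint y))⁻¹ 0 0 = -(1 + ε * A (slicePoint (ε • y)) 0 0))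
    (h0i : ∀ l : Fin 3, (G (slicePoint y))⁻¹ 0 l.succ = ε * A (slicePoint (ε • y)) 0 l.succ) :
    secondFundamentalForm G y = ε ^ 2 • scaledSecondForm ε A (ε • y) := by
  ext i j
  have hc : (fun x => conormal G x j.succ) = fun _ => 0 := by
    ext x; simp [conormal]
  have hc' : ∀ l : Fin 3, conormal G (slicePoint y) l.succ = 0 := fun l => by simp [conormal]
  have hpd : pd4 i.succ (fun _ : Fin 4 → ℝ => (0 : ℝ)) (slicePoint y) = 0 := by simp [pd4]
  have hn0 : conormal G (slicePoint y) 0 = -(1 / √(1 + ε * A (slicePoint (ε • y)) 0 0)) := by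
    simp [conormal, h00]
  simp only [secondFundamentalForm, Matrix.of_apply, hc, hpd, Fin.sum_univ_succ (n := 3), hc', hn0,
    mul_zero, Finset.sum_const_zero, add_zero, zero_sub, neg_neg, christoffel, h00, h0i,
    Matrix.smul_apply, scaledSecondForm, smul_eq_mul, pd4_scaled hG]
  have hk : ∀ ρ, ε ^ 2 * pd4 i.succ (fun z => A z ρ j.succ) (ε • slicePoint y) +
      ε ^ 2 * pd4 j.succ (fun z => A z ρ i.succ) (ε • slicePoint y) -
      ε ^ 2 * pd4 ρ (fun z => A z i.succ j.succ) (ε • slicePoint y) =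
      ε ^ 2 * koszul A (slicePoint (ε • y)) ρ i j := by
    intro ρ; rw [koszul, slicePoint_smul]; ring
  simp only [hk]
  have hs : ∑ l : Fin 3, ε * A (slicePoint (ε • y)) 0 l.succ *
      (ε ^ 2 * koszul A (slicePoint (ε • y)) l.succ i j) =
      ε ^ 3 * ∑ l : Fin 3, A (slicePoint (ε • y)) 0 l.succ *
        koszul A (slicePoint (ε • y)) l.succ i j := by
    rw [Finset.mul_sum]; exact Finset.sum_congr rfl fun l _ => by ring
  rw [hs]
  set u := 1 + ε * A (slicePoint (ε • y)) 0 0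
  -- Valid for every real u, so positivity under the square root plays no role here.
  have hu : u * (1 / √u) = √u := by rw [mul_one_div, Real.div_sqrt]
  linear_combination (1 / 2) * ε ^ 2 * koszul A (slicePoint (ε • y)) 0 i j * hu

/-! ### Scaling of the charges -/

theorem pd3_scaled {g B : Tensor3} {ε : ℝ} (hg : ∀ y : E3, g y = 1 + ε • B (ε • y))
    (i a b : Fin 3) (y : E3) :
    pd3 i (fun y => g y a b) y = ε ^ 2 * pd3 i (fun y => B y a b) (ε • y) := by
  have e : (fun y => g y a b) = fun y =>
      (1 : Matrix (Fin 3) (Fin 3) ℝ) a b + ε * (fun z => B z a b) (ε • y) := by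
    ext y; simp [hg]
  rw [pd3, e]
  exact fderiv_scaled (fun z => B z a b) ((1 : Matrix (Fin 3) (Fin 3) ℝ) a b) ε y _

theorem energyDensity_scaled {g B : Tensor3} {ε : ℝ} (hg : ∀ y : E3, g y = 1 + ε • B (ε • y))
    (y : E3) (j : Fin 3) :
    energyDensity g y j = ε ^ 2 * energyDensity B (ε • y) j := by
  simp only [energyDensity, pd3_scaled hg, Finset.mul_sum]
  exact Finset.sum_congr rfl fun i _ => by ring

/-- The area factor ε⁻² cancels the ε² of a first derivative. -/
theorem energyCharge_scaled {g B : Tensor3} {ε : ℝ} (hε : 0 < ε)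
    (hg : ∀ y : E3, g y = 1 + ε • B (ε • y)) :
    energyCharge g ε⁻¹ = (1 / 2) * ∫ ν : Metric.sphere (0 : E3) 1,
      ∑ j, energyDensity B ν j * (ν : E3) j ∂sphereMeasure := by
  simp only [energyCharge, sphereIntegral, energyDensity_scaled hg, smul_smul,
    mul_inv_cancel₀ hε.ne', one_smul]
  rw [← integral_const_mul]
  congr 1
  refine integral_congr_ae (Eventually.of_forall fun ν => ?_)
  simp only [Finset.mul_sum]
  refine Finset.sum_congr rfl fun j _ => ?_
  field_simp

/-- The integrand of the center of mass flux through the unit sphere for `1 + B`. -/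
noncomputable def centerFlux (B : Tensor3) (l : Fin 3) (y : E3) : ℝ :=
  ∑ j, (y l * energyDensity B y j - B y l j + (if j = l then (B y).trace else 0)) * y j

/-- The derivative terms gain ε⁻¹ from the weight x_l; the undifferentiated terms have no weight but
only one factor ε of amplitude, so both kinds carry the same total power. -/
theorem centerCharge_scaled {g B : Tensor3} {ε : ℝ} (hε : 0 < ε)
    (hg : ∀ y : E3, g y = 1 + ε • B (ε • y)) (l : Fin 3) :
    centerCharge g ε⁻¹ l = ε⁻¹ * ((1 / 2) * ∫ ν : Metric.sphere (0 : E3) 1,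
      centerFlux B l ν ∂sphereMeasure) := by
  have hg1 : ∀ y : E3, g y - 1 = ε • B (ε • y) := fun y => by rw [hg]; simp
  simp only [centerCharge, sphereIntegral, energyDensity_scaled hg, hg1, smul_smul,
    mul_inv_cancel₀ hε.ne', one_smul]
  rw [mul_left_comm ε⁻¹]
  congr 1
  rw [← integral_const_mul, ← integral_const_mul]
  refine integral_congr_ae (Eventually.of_forall fun ν => ?_)
  simp only [Finset.mul_sum, centerFlux]
  refine Finset.sum_congr rfl fun j _ => ?_
  split_ifs <;> simp <;> field_simp

/-- The integrand of the linear momentum flux through the unit sphere. -/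
noncomputable def momentumFlux (K : Tensor3) (i : Fin 3) (y : E3) : ℝ :=
  ∑ j, momentumDensity K y i j * y j

/-- The integrand of the angular momentum flux through the unit sphere. -/
noncomputable def angularFlux (K : Tensor3) (l : Fin 3) (y : E3) : ℝ :=
  ∑ i, ∑ j, momentumDensity K y i j * rotationField l y i * y j

theorem momentumDensity_scaled {k K : Tensor3} {ε : ℝ} {y : E3}
    (hk : k y = ε ^ 2 • K (ε • y)) :
    momentumDensity k y = ε ^ 2 • momentumDensity K (ε • y) := by
  rw [momentumDensity, momentumDensity, hk, Matrix.trace_smul, smul_sub, smul_smul]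
  rfl

/-- The scaling of `k` is required only on the sphere of integration, since the formula for the
second fundamental form is available only at regular points. -/
theorem momentumCharge_scaled {k K : Tensor3} {ε : ℝ} (hε : 0 < ε)
    (hk : ∀ y : E3, ‖y‖ = ε⁻¹ → k y = ε ^ 2 • K (ε • y)) (i : Fin 3) :
    momentumCharge k ε⁻¹ i = ∫ ν : Metric.sphere (0 : E3) 1,
      momentumFlux K i ν ∂sphereMeasure := by
  simp only [momentumCharge, sphereIntegral]
  rw [← integral_const_mul]
  refine integral_congr_ae (Eventually.of_forall fun ν => ?_)
  have hn : ‖ε⁻¹ • (ν : E3)‖ = ε⁻¹ := by simp [norm_smul, abs_of_pos hε]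
  simp only [momentumDensity_scaled (hk _ hn), smul_smul, mul_inv_cancel₀ hε.ne', one_smul,
    Finset.mul_sum, momentumFlux, Matrix.smul_apply, smul_eq_mul]
  refine Finset.sum_congr rfl fun j _ => ?_
  field_simp

theorem rotationField_smul (l : Fin 3) (c : ℝ) (y : E3) (i : Fin 3) :
    rotationField l (c • y) i = c * rotationField l y i := by
  have : (fun j => (c • y) j) = c • fun j => y j := by ext j; simp
  rw [rotationField, this, map_smul]; simp [rotationField]

/-- Compared with linear momentum, the rotation field is homogeneous of degree one and contributes
the extra ε⁻¹. -/
theorem angularCharge_scaled {k K : Tensor3} {ε : ℝ} (hε : 0 < ε)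
    (hk : ∀ y : E3, ‖y‖ = ε⁻¹ → k y = ε ^ 2 • K (ε • y)) (l : Fin 3) :
    angularCharge k ε⁻¹ l = ε⁻¹ * ∫ ν : Metric.sphere (0 : E3) 1,
      angularFlux K l ν ∂sphereMeasure := by
  simp only [angularCharge, sphereIntegral]
  rw [← integral_const_mul, ← integral_const_mul]
  refine integral_congr_ae (Eventually.of_forall fun ν => ?_)
  have hn : ‖ε⁻¹ • (ν : E3)‖ = ε⁻¹ := by simp [norm_smul, abs_of_pos hε]
  simp only [momentumDensity_scaled (hk _ hn), smul_smul, mul_inv_cancel₀ hε.ne', one_smul,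
    Finset.mul_sum, angularFlux, Matrix.smul_apply, smul_eq_mul, rotationField_smul]
  refine Finset.sum_congr rfl fun i _ => Finset.sum_congr rfl fun j _ => ?_
  field_simp

/-! ### Smoothness and scaling of the Kerr metric -/

/-- Joint smoothness of the Kerr-Schild radius in the parameter and the point. -/
theorem contDiffAt_kerrRadius {p : ℝ × (Fin 4 → ℝ)}
    (hp : p.1 ^ 2 < p.2 1 ^ 2 + p.2 2 ^ 2 + p.2 3 ^ 2) :
    ContDiffAt ℝ ∞ (fun p : ℝ × (Fin 4 → ℝ) => kerrRadius p.1 p.2) p := by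
  unfold kerrRadius
  have hs : 0 < p.2 1 ^ 2 + p.2 2 ^ 2 + p.2 3 ^ 2 - p.1 ^ 2 := by linarith
  have hd : 0 < (p.2 1 ^ 2 + p.2 2 ^ 2 + p.2 3 ^ 2 - p.1 ^ 2) ^ 2 +
      4 * p.1 ^ 2 * p.2 3 ^ 2 := by positivity
  have hc : ∀ i : Fin 4, ContDiffAt ℝ ∞ (fun p : ℝ × (Fin 4 → ℝ) => p.2 i) p := fun i =>
    (contDiffAt_apply ℝ ℝ i _).comp p contDiffAt_snd
  have hS : ContDiffAt ℝ ∞ (fun p : ℝ × (Fin 4 → ℝ) =>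
      p.2 1 ^ 2 + p.2 2 ^ 2 + p.2 3 ^ 2 - p.1 ^ 2) p :=
    ((((hc 1).pow 2).add ((hc 2).pow 2)).add ((hc 3).pow 2)).sub (contDiffAt_fst.pow 2)
  refine ContDiffAt.sqrt (ContDiffAt.div_const (hS.add (ContDiffAt.sqrt ?_ hd.ne')) 2) ?_
  · exact (hS.pow 2).add ((contDiffAt_const.mul (contDiffAt_fst.pow 2)).mul ((hc 3).pow 2))
  · have := Real.sqrt_nonneg ((p.2 1 ^ 2 + p.2 2 ^ 2 + p.2 3 ^ 2 - p.1 ^ 2) ^ 2 +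
      4 * p.1 ^ 2 * p.2 3 ^ 2)
    positivity

theorem not_mem_disc {a : ℝ} {x : Fin 4 → ℝ} (h : a ^ 2 < x 1 ^ 2 + x 2 ^ 2 + x 3 ^ 2) :
    ¬ (x 3 = 0 ∧ x 1 ^ 2 + x 2 ^ 2 ≤ a ^ 2) := by
  rintro ⟨h3, h12⟩
  rw [h3] at h
  linarith

theorem contDiffAt_kerrH (m : ℝ) {p : ℝ × (Fin 4 → ℝ)}
    (hp : p.1 ^ 2 < p.2 1 ^ 2 + p.2 2 ^ 2 + p.2 3 ^ 2) :
    ContDiffAt ℝ ∞ (fun p : ℝ × (Fin 4 → ℝ) => kerrH m p.1 p.2) p := by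
  have hr := contDiffAt_kerrRadius hp
  have hpos := kerrRadius_pos (not_mem_disc hp)
  have hc : ContDiffAt ℝ ∞ (fun p : ℝ × (Fin 4 → ℝ) => p.2 3) p :=
    (contDiffAt_apply ℝ ℝ 3 _).comp p contDiffAt_snd
  exact (contDiffAt_const.mul (hr.pow 3)).div
    ((hr.pow 4).add ((contDiffAt_fst.pow 2).mul (hc.pow 2))) (by positivity)

theorem contDiffAt_kerrEll {p : ℝ × (Fin 4 → ℝ)}
    (hp : p.1 ^ 2 < p.2 1 ^ 2 + p.2 2 ^ 2 + p.2 3 ^ 2) (μ : Fin 4) :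
    ContDiffAt ℝ ∞ (fun p : ℝ × (Fin 4 → ℝ) => kerrEll p.1 p.2 μ) p := by
  have hr := contDiffAt_kerrRadius hp
  have hpos := kerrRadius_pos (not_mem_disc hp)
  have hc : ∀ i : Fin 4, ContDiffAt ℝ ∞ (fun p : ℝ × (Fin 4 → ℝ) => p.2 i) p := fun i =>
    (contDiffAt_apply ℝ ℝ i _).comp p contDiffAt_snd
  have h1 : ContDiffAt ℝ ∞ (fun p : ℝ × (Fin 4 → ℝ) => p.1) p := contDiffAt_fst
  fin_cases μ
  · exact contDiffAt_const
  · exact ((hr.mul (hc 1)).add (h1.mul (hc 2))).div ((hr.pow 2).add (h1.pow 2)) (by positivity)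
  · exact ((hr.mul (hc 2)).sub (h1.mul (hc 1))).div ((hr.pow 2).add (h1.pow 2)) (by positivity)
  · exact (hc 3).div hr hpos.ne'

/-- Away from the disc, the covector `ℓ` of the Kerr metric is null. -/
theorem kerrEll_null {a : ℝ} {x : Fin 4 → ℝ} (h : a ^ 2 < x 1 ^ 2 + x 2 ^ 2 + x 3 ^ 2) :
    kerrEll a x 1 ^ 2 + kerrEll a x 2 ^ 2 + kerrEll a x 3 ^ 2 = 1 := by
  have hpos := kerrRadius_pos (not_mem_disc h)
  rw [← kerrRadius_spec (not_mem_disc h)]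
  simp only [kerrEll, Matrix.cons_val]
  field_simp
  ring

/-- The defining equation is homogeneous when the spin is treated as a length. The degrees −1 of H
and 0 of ℓ follow, with the mass unscaled. -/
theorem kerrRadius_smul {ε : ℝ} (hε : 0 < ε) (a : ℝ) (x : Fin 4 → ℝ) :
    kerrRadius (ε * a) (ε • x) = ε * kerrRadius a x := by
  unfold kerrRadius
  simp only [Pi.smul_apply, smul_eq_mul]
  set S := x 1 ^ 2 + x 2 ^ 2 + x 3 ^ 2 - a ^ 2
  have e1 : (ε * x 1) ^ 2 + (ε * x 2) ^ 2 + (ε * x 3) ^ 2 - (ε * a) ^ 2 = ε ^ 2 * S := by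
    simp only [S]; ring
  have e2 : (ε ^ 2 * S) ^ 2 + 4 * (ε * a) ^ 2 * (ε * x 3) ^ 2 =
      (ε ^ 2) ^ 2 * (S ^ 2 + 4 * a ^ 2 * x 3 ^ 2) := by ring
  have e3 : (ε ^ 2 * S + ε ^ 2 * √(S ^ 2 + 4 * a ^ 2 * x 3 ^ 2)) / 2 =
      ε ^ 2 * ((S + √(S ^ 2 + 4 * a ^ 2 * x 3 ^ 2)) / 2) := by ring
  rw [e1, e2, Real.sqrt_mul (by positivity), Real.sqrt_sq (by positivity), e3,
    Real.sqrt_mul (by positivity), Real.sqrt_sq hε.le]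

theorem kerrH_smul {ε : ℝ} (hε : 0 < ε) (m a : ℝ) (x : Fin 4 → ℝ) :
    ε * kerrH m (ε * a) (ε • x) = kerrH m a x := by
  unfold kerrH
  rw [kerrRadius_smul hε]
  simp only [Pi.smul_apply, smul_eq_mul]
  set r := kerrRadius a x
  rw [show (ε * r) ^ 4 + (ε * a) ^ 2 * (ε * x 3) ^ 2 = ε ^ 4 * (r ^ 4 + a ^ 2 * x 3 ^ 2) by ring,
    ← mul_div_assoc, show ε * (m * (ε * r) ^ 3) = ε ^ 4 * (m * r ^ 3) by ring,
    mul_div_mul_left _ _ (by positivity)]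

theorem kerrEll_smul {ε : ℝ} (hε : 0 < ε) (a : ℝ) (x : Fin 4 → ℝ) :
    kerrEll (ε * a) (ε • x) = kerrEll a x := by
  unfold kerrEll
  rw [kerrRadius_smul hε]
  simp only [Pi.smul_apply, smul_eq_mul]
  set r := kerrRadius a x
  rw [show (ε * r) ^ 2 + (ε * a) ^ 2 = ε ^ 2 * (r ^ 2 + a ^ 2) by ring,
    show ε * r * (ε * x 1) + ε * a * (ε * x 2) = ε ^ 2 * (r * x 1 + a * x 2) by ring,
    show ε * r * (ε * x 2) - ε * a * (ε * x 1) = ε ^ 2 * (r * x 2 - a * x 1) by ring,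
    mul_div_mul_left _ _ (by positivity), mul_div_mul_left _ _ (by positivity),
    mul_div_mul_left _ _ hε.ne']

/-! ### Boosted Kerr metrics -/

/-- Parameters of a Kerr metric whose spin axis lies in the `xz`-plane, translated along the
`y`-axis and boosted along the `z`-axis. -/
structure BoostedKerr where
  /-- The mass. -/
  m : ℝ
  /-- The spin parameter. -/
  a : ℝ
  /-- The cosine of the angle between the spin axis and the `z`-axis. -/
  c : ℝ
  /-- The sine of the angle between the spin axis and the `z`-axis. -/
  s : ℝ
  /-- The Lorentz factor of the boost. -/
  γ : ℝ
  /-- The velocity of the boost, multiplied by the Lorentz factor. -/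
  β : ℝ
  /-- The translation. -/
  ζ : ℝ
  cs : c ^ 2 + s ^ 2 = 1
  γβ : γ ^ 2 = 1 + β ^ 2
  γ_pos : 0 < γ

namespace BoostedKerr

variable (p : BoostedKerr)

/-- The matrix of the linear part of the change from the boosted to the Kerr coordinates. -/
def frame : Matrix (Fin 4) (Fin 4) ℝ :=
  !![p.γ, 0, 0, p.β; -(p.s * p.β), p.c, 0, -(p.s * p.γ); 0, 0, 1, 0; p.c * p.β, p.s, 0, p.c * p.γ]

/-- The Kerr coordinates, with translation `εζ`, of a point given in the boosted coordinates. -/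
def restPoint (ε : ℝ) (x : Fin 4 → ℝ) : Fin 4 → ℝ :=
  ![p.γ * x 0 + p.β * x 3, p.c * x 1 - p.s * (p.γ * x 3 + p.β * x 0), x 2 - ε * p.ζ,
    p.s * x 1 + p.c * (p.γ * x 3 + p.β * x 0)]

/-- The covector `ℓ` in the boosted coordinates, for the spin `εa` and translation `εζ`. -/
noncomputable def ell (ε : ℝ) (x : Fin 4 → ℝ) : Fin 4 → ℝ :=
  kerrEll (ε * p.a) (p.restPoint ε x) ᵥ* p.frame

/-- The perturbation `2Hℓ ⊗ ℓ` in the boosted coordinates, for the spin `εa` and translation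
`εζ`. -/
noncomputable def perturbation (ε : ℝ) : Tensor4 := fun x =>
  (2 * kerrH p.m (ε * p.a) (p.restPoint ε x)) • Matrix.vecMulVec (p.ell ε x) (p.ell ε x)

theorem restPoint_eq (ε : ℝ) (x : Fin 4 → ℝ) :
    p.restPoint ε x = p.frame *ᵥ x - ε • Pi.single 2 p.ζ := by
  ext i
  fin_cases i <;> simp [restPoint, frame, dotProduct, Fin.sum_univ_four] <;> ring

theorem restPoint_smul (ε : ℝ) (x : Fin 4 → ℝ) :
    p.restPoint ε (ε • x) = ε • p.restPoint 1 x := by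
  rw [restPoint_eq, restPoint_eq, Matrix.mulVec_smul, one_smul, smul_sub]

theorem frame_lorentz : p.frameᵀ * minkowski * p.frame = minkowski := by
  have h1 := p.cs
  have h2 := p.γβ
  ext i j
  fin_cases i <;> fin_cases j <;>
    simp [frame, minkowski, Matrix.mul_apply, Fin.sum_univ_four, Matrix.diagonal_apply] <;>
    grind

theorem frame_det : p.frame.det = 1 := by
  have h1 := p.cs
  have h2 := p.γβ
  simp [frame, Matrix.det_succ_row_zero, Fin.sum_univ_succ, Fin.succAbove]
  grind

theorem minkowski_mul_self : minkowski * minkowski = 1 := by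
  rw [minkowski, Matrix.diagonal_mul_diagonal, ← Matrix.diagonal_one]
  congr 1; ext i; fin_cases i <;> simp

/-- The inverse of the frame matrix. -/
theorem frame_mul_inv : p.frame * (minkowski * p.frameᵀ * minkowski) = 1 := by
  rw [mul_eq_one_comm, Matrix.mul_assoc, Matrix.mul_assoc, ← Matrix.mul_assoc p.frameᵀ,
    frame_lorentz, minkowski_mul_self]

/-- The Poincaré transformation from the Kerr to the boosted coordinates, followed by a rotation
of the latter. -/
noncomputable def transformation (R : Matrix (Fin 4) (Fin 4) ℝ)
    (hR : Rᵀ * minkowski * R = minkowski) (hdet : R.det = 1) (h00 : R 0 = Pi.single 0 1) :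
    PoincareTransformation where
  -- For a Lorentz matrix F the product ηFᵀη is F⁻¹, so this is the rotation after the inverse
  -- frame.
  lorentz := R * (minkowski * p.frameᵀ * minkowski)
  -- The frame fixes the y-axis, so a translation along it has the same components before and after
  -- the boost.
  translation := R *ᵥ Pi.single 2 p.ζ
  preserves := by
    have hm : minkowskiᵀ = minkowski := by simp [minkowski]
    have h := p.frame_mul_inv
    rw [mul_eq_one_comm] at h
    have h2 : minkowski * p.frameᵀ * minkowski * p.frame = 1 := h
    have h3 : p.frame * minkowski * p.frameᵀ = minkowski := by
      have := p.frame_mul_inv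
      calc p.frame * minkowski * p.frameᵀ
          = (p.frame * (minkowski * p.frameᵀ * minkowski)) * minkowski := by
            simp only [Matrix.mul_assoc, minkowski_mul_self, Matrix.mul_one]
        _ = minkowski := by rw [this, Matrix.one_mul]
    rw [Matrix.transpose_mul]
    calc (minkowski * p.frameᵀ * minkowski)ᵀ * Rᵀ * minkowski *
          (R * (minkowski * p.frameᵀ * minkowski))
        = (minkowski * p.frameᵀ * minkowski)ᵀ * (Rᵀ * minkowski * R) *
          (minkowski * p.frameᵀ * minkowski) := by simp only [Matrix.mul_assoc]
      _ = minkowski * p.frame * (minkowski * minkowski) * minkowski * p.frameᵀ * minkowski := by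
          rw [hR]; simp only [Matrix.transpose_mul, Matrix.transpose_transpose, hm,
            Matrix.mul_assoc]
      _ = minkowski * (p.frame * minkowski * p.frameᵀ) * minkowski := by
          rw [minkowski_mul_self]; simp only [Matrix.mul_assoc, Matrix.one_mul]
      _ = minkowski := by rw [h3, Matrix.mul_assoc, minkowski_mul_self, Matrix.mul_one]
  proper := by
    have h := congrArg Matrix.det minkowski_mul_self
    rw [Matrix.det_mul, Matrix.det_one] at h
    rw [Matrix.det_mul, Matrix.det_mul, Matrix.det_mul, Matrix.det_transpose, p.frame_det, hdet]
    linear_combination h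
  orthochronous := by
    rw [Matrix.mul_apply_eq_vecMul, h00]
    simp [frame, minkowski, p.γ_pos]

end BoostedKerr

/-! ### The boosted metric: scaling, regularity and inverse -/

namespace BoostedKerr

variable (p : BoostedKerr)

/-- The Kerr metric in the boosted coordinates. -/
noncomputable def metric : Tensor4 := fun x => minkowski + p.perturbation 1 x

/-- The identity on which the asymptotics rest: looking at radius 1/ε is the same as looking at
radius 1 with spin and translation multiplied by ε. -/
theorem metric_scaled {ε : ℝ} (hε : 0 < ε) (x : Fin 4 → ℝ) :
    p.metric x = minkowski + ε • p.perturbation ε (ε • x) := by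
  have h1 : p.ell ε (ε • x) = p.ell 1 x := by
    rw [ell, ell, restPoint_smul, kerrEll_smul hε, one_mul]
  rw [metric, perturbation, perturbation, h1, restPoint_smul, smul_smul, mul_left_comm,
    kerrH_smul hε, one_mul]

theorem transformation_lorentz_inv (R : Matrix (Fin 4) (Fin 4) ℝ)
    (hR : Rᵀ * minkowski * R = minkowski) (hdet : R.det = 1) (h00 : R 0 = Pi.single 0 1)
    (hRR : Rᵀ * R = 1) :
    (p.transformation R hR hdet h00).lorentz⁻¹ = p.frame * Rᵀ := by
  refine Matrix.inv_eq_left_inv ?_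
  calc p.frame * Rᵀ * (R * (minkowski * p.frameᵀ * minkowski))
      = p.frame * (Rᵀ * R) * (minkowski * p.frameᵀ * minkowski) := by
        simp only [Matrix.mul_assoc]
    _ = 1 := by rw [hRR, Matrix.mul_one, p.frame_mul_inv]

/-- The frame is Lorentz, so it fixes η and merely replaces ℓ by its boosted components; the
rotation is left outside to be handled by covariance. -/
theorem transform_kerrMetric (R : Matrix (Fin 4) (Fin 4) ℝ)
    (hR : Rᵀ * minkowski * R = minkowski) (hdet : R.det = 1) (h00 : R 0 = Pi.single 0 1)
    (hRR : Rᵀ * R = 1) (x : Fin 4 → ℝ) :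
    (p.transformation R hR hdet h00).transform (kerrMetric p.m p.a) x =
      R * p.metric (Rᵀ *ᵥ x) * Rᵀ := by
  have hold : (p.transformation R hR hdet h00).oldCoords x = p.restPoint 1 (Rᵀ *ᵥ x) := by
    have hcol : p.frame *ᵥ Pi.single 2 p.ζ = Pi.single 2 p.ζ := by
      ext i; fin_cases i <;> simp [frame]
    rw [PoincareTransformation.oldCoords, transformation_lorentz_inv _ _ _ _ _ hRR, restPoint_eq,
      ← Matrix.mulVec_mulVec, Matrix.mulVec_sub]
    change p.frame *ᵥ (Rᵀ *ᵥ x - Rᵀ *ᵥ (R *ᵥ Pi.single 2 p.ζ)) = _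
    rw [Matrix.mulVec_mulVec _ Rᵀ, hRR, Matrix.one_mulVec, Matrix.mulVec_sub, hcol, one_smul]
  rw [PoincareTransformation.transform, transformation_lorentz_inv _ _ _ _ _ hRR, hold,
    Matrix.transpose_mul, Matrix.transpose_transpose, metric, kerrMetric, perturbation, ell,
    one_mul]
  set ℓ := kerrEll p.a (p.restPoint 1 (Rᵀ *ᵥ x))
  have h1 : p.frameᵀ * Matrix.vecMulVec ℓ ℓ * p.frame =
      Matrix.vecMulVec (ℓ ᵥ* p.frame) (ℓ ᵥ* p.frame) := by
    rw [Matrix.mul_vecMulVec, Matrix.vecMulVec_mul, Matrix.mulVec_transpose]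
  rw [← h1]
  conv_rhs => rw [← p.frame_lorentz]
  simp only [Matrix.mul_add, Matrix.add_mul, Matrix.mul_smul, Matrix.smul_mul, Matrix.mul_assoc]

/-- The points whose Kerr coordinates, for the spin `εa` and translation `εζ`, have Euclidean
radius larger than the spin. -/
def Regular (ε : ℝ) (x : Fin 4 → ℝ) : Prop :=
  (ε * p.a) ^ 2 < p.restPoint ε x 1 ^ 2 + p.restPoint ε x 2 ^ 2 + p.restPoint ε x 3 ^ 2

/-- The tilt of the spin axis is a rotation in the xz-plane and drops out of the radius. -/
theorem restPoint_norm (ε : ℝ) (x : Fin 4 → ℝ) :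
    p.restPoint ε x 1 ^ 2 + p.restPoint ε x 2 ^ 2 + p.restPoint ε x 3 ^ 2 =
      x 1 ^ 2 + (x 2 - ε * p.ζ) ^ 2 + (p.γ * x 3 + p.β * x 0) ^ 2 := by
  simp only [restPoint, Matrix.cons_val]
  linear_combination (x 1 ^ 2 + (p.γ * x 3 + p.β * x 0) ^ 2) * p.cs

/-- A bound on `ε` below which the unit sphere in the slice is regular. -/
noncomputable def regularityBound : ℝ := 1 / (2 * |p.ζ| + p.a ^ 2 + 1)

theorem regularityBound_pos : 0 < p.regularityBound := by
  rw [regularityBound]; positivity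

/-- Within the slice the boost only stretches the third coordinate, because γ² = 1 + β² ≥ 1. The
squared rest-frame radius is therefore at least 1 − 2|εζ|, which must exceed (εa)². -/
theorem regular_of_norm {ε : ℝ} (hε : |ε| ≤ p.regularityBound) {y : E3} (hy : ‖y‖ = 1) :
    p.Regular ε (slicePoint y) := by
  have hD : 0 < 2 * |p.ζ| + p.a ^ 2 + 1 := by positivity
  have h1 : |ε| * (2 * |p.ζ| + p.a ^ 2 + 1) ≤ 1 := by
    rwa [regularityBound, le_div_iff₀ hD] at hε
  have hε1 : |ε| ≤ 1 := by nlinarith [abs_nonneg ε, abs_nonneg p.ζ, sq_nonneg p.a]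
  have hn := norm_sq_E3 y
  rw [hy] at hn
  have hy1 : |y 1| ≤ 1 := abs_le_one_iff_mul_self_le_one.2 (by nlinarith [sq_nonneg (y 0), sq_nonneg (y 2)])
  have h2 : ε * p.ζ * y 1 ≤ |ε| * |p.ζ| := by
    calc ε * p.ζ * y 1 ≤ |ε * p.ζ * y 1| := le_abs_self _
      _ = |ε| * |p.ζ| * |y 1| := by rw [abs_mul, abs_mul]
      _ ≤ |ε| * |p.ζ| * 1 := by gcongr
      _ = _ := mul_one _
  have h3 : (ε * p.a) ^ 2 ≤ |ε| * p.a ^ 2 := by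
    rw [mul_pow, ← sq_abs ε]
    have : |ε| ^ 2 ≤ |ε| := by nlinarith [abs_nonneg ε]
    gcongr
  -- The summand 1 in the denominator of the bound makes the inequality strict for ε ≠ 0; at ε = 0
  -- regularity is immediate.
  have h4 : |ε| * p.a ^ 2 < 1 - 2 * (|ε| * |p.ζ|) ∨ |ε| = 0 := by
    rcases (abs_nonneg ε).eq_or_lt with h | h
    · exact Or.inr h.symm
    · left; nlinarith
  have h5 : y 2 ^ 2 ≤ (p.γ * y 2) ^ 2 := by
    rw [mul_pow, p.γβ]; nlinarith [mul_nonneg (sq_nonneg p.β) (sq_nonneg (y 2))]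
  rw [Regular, restPoint_norm]
  have e0 : slicePoint y 0 = 0 := rfl
  have e1 : slicePoint y 1 = y 0 := rfl
  have e2 : slicePoint y 2 = y 1 := rfl
  have e3 : slicePoint y 3 = y 2 := rfl
  rw [e0, e1, e2, e3, mul_zero, add_zero]
  rcases h4 with h4 | h4
  · nlinarith [sq_nonneg (ε * p.ζ)]
  · rw [abs_eq_zero.1 h4] at *; nlinarith

theorem regular_zero {x : Fin 4 → ℝ} :
    p.Regular 0 x ↔ 0 < x 1 ^ 2 + x 2 ^ 2 + (p.γ * x 3 + p.β * x 0) ^ 2 := by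
  rw [Regular, restPoint_norm]; simp

theorem contDiff_restPoint :
    ContDiff ℝ ∞ (fun q : ℝ × (Fin 4 → ℝ) => p.restPoint q.1 q.2) := by
  refine contDiff_pi.2 fun i => ?_
  have hc : ∀ i : Fin 4, ContDiff ℝ ∞ (fun p : ℝ × (Fin 4 → ℝ) => p.2 i) := fun i =>
    (contDiff_apply ℝ ℝ i).comp contDiff_snd
  have h1 := hc 0
  have h2 := hc 1
  have h3 := hc 2
  have h4 := hc 3
  fin_cases i <;> simp [restPoint] <;> fun_prop

theorem contDiffAt_comp_restPoint {f : ℝ × (Fin 4 → ℝ) → ℝ}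
    (hf : ∀ r : ℝ × (Fin 4 → ℝ), r.1 ^ 2 < r.2 1 ^ 2 + r.2 2 ^ 2 + r.2 3 ^ 2 → ContDiffAt ℝ ∞ f r)
    {q : ℝ × (Fin 4 → ℝ)} (hq : p.Regular q.1 q.2) :
    ContDiffAt ℝ ∞ (fun q : ℝ × (Fin 4 → ℝ) => f (q.1 * p.a, p.restPoint q.1 q.2)) q := by
  have hφ : ContDiffAt ℝ ∞ (fun q : ℝ × (Fin 4 → ℝ) => (q.1 * p.a, p.restPoint q.1 q.2)) q :=
    (contDiffAt_fst.mul contDiffAt_const).prodMk p.contDiff_restPoint.contDiffAt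
  exact (hf (q.1 * p.a, p.restPoint q.1 q.2) hq).comp q hφ

theorem contDiffAt_ell {q : ℝ × (Fin 4 → ℝ)} (hq : p.Regular q.1 q.2) (μ : Fin 4) :
    ContDiffAt ℝ ∞ (fun q : ℝ × (Fin 4 → ℝ) => p.ell q.1 q.2 μ) q := by
  have h : ∀ ν, ContDiffAt ℝ ∞ (fun q : ℝ × (Fin 4 → ℝ) =>
      kerrEll (q.1 * p.a) (p.restPoint q.1 q.2) ν) q := fun ν =>
    p.contDiffAt_comp_restPoint (f := fun r => kerrEll r.1 r.2 ν)
      (fun r hr => contDiffAt_kerrEll hr ν) hq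
  have e : (fun q : ℝ × (Fin 4 → ℝ) => p.ell q.1 q.2 μ) = fun q : ℝ × (Fin 4 → ℝ) =>
      ∑ ν, kerrEll (q.1 * p.a) (p.restPoint q.1 q.2) ν * p.frame ν μ := by
    ext q; simp only [ell, Matrix.vecMul, dotProduct]
  rw [e]
  exact ContDiffAt.sum fun ν _ => (h ν).mul contDiffAt_const

theorem contDiffAt_perturbation {q : ℝ × (Fin 4 → ℝ)} (hq : p.Regular q.1 q.2) (μ ν : Fin 4) :
    ContDiffAt ℝ ∞ (Function.uncurry fun ε x => p.perturbation ε x μ ν) q := by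
  have hH : ContDiffAt ℝ ∞ (fun q : ℝ × (Fin 4 → ℝ) =>
      kerrH p.m (q.1 * p.a) (p.restPoint q.1 q.2)) q :=
    p.contDiffAt_comp_restPoint (f := fun r => kerrH p.m r.1 r.2)
      (fun r hr => contDiffAt_kerrH p.m hr) hq
  have e : (Function.uncurry fun ε x => p.perturbation ε x μ ν) = fun q : ℝ × (Fin 4 → ℝ) =>
      2 * kerrH p.m (q.1 * p.a) (p.restPoint q.1 q.2) *
        (p.ell q.1 q.2 μ * p.ell q.1 q.2 ν) := by
    ext q
    simp [Function.uncurry, perturbation, Matrix.vecMulVec_apply]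
  rw [e]
  exact (contDiffAt_const.mul hH).mul ((p.contDiffAt_ell hq μ).mul (p.contDiffAt_ell hq ν))

/-- Nullity is Lorentz invariant and holds in Kerr coordinates. -/
theorem ell_null {ε : ℝ} {x : Fin 4 → ℝ} (h : p.Regular ε x) :
    p.ell ε x 1 ^ 2 + p.ell ε x 2 ^ 2 + p.ell ε x 3 ^ 2 = p.ell ε x 0 ^ 2 := by
  have hn := kerrEll_null h
  have h0 : kerrEll (ε * p.a) (p.restPoint ε x) 0 = 1 := rfl
  have h1 := p.cs
  have h2 := p.γβ
  rw [ell]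
  set ℓ := kerrEll (ε * p.a) (p.restPoint ε x)
  simp only [Matrix.vecMul, dotProduct, Fin.sum_univ_four, frame, Matrix.of_apply,
    Matrix.cons_val, h0]
  grind

/-- The Kerr–Schild inverse reverses the sign of the perturbation, and raising each time index
reverses it again: two raisings in the first entry, one in the mixed entries. -/
theorem inv_metric {ε : ℝ} (hε : 0 < ε) {x : Fin 4 → ℝ} (h : p.Regular ε (ε • x)) :
    (p.metric x)⁻¹ 0 0 = -(1 + ε * p.perturbation ε (ε • x) 0 0) ∧
      ∀ l : Fin 3, (p.metric x)⁻¹ 0 l.succ = ε * p.perturbation ε (ε • x) 0 l.succ := by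
  rw [metric_scaled p hε, perturbation, smul_smul, inv_kerrSchild (p.ell_null h)]
  constructor
  · simp [minkowski, Matrix.vecMulVec_apply, Matrix.mulVec_diagonal]
    ring
  · intro l
    fin_cases l <;> simp [minkowski, Matrix.vecMulVec_apply, Matrix.mulVec_diagonal] <;> ring

end BoostedKerr

namespace BoostedKerr

variable (p : BoostedKerr)

/-! ### Expansion in the scaling parameter -/

/-- The boosted coordinate along the direction of the boost. -/
def height (x : Fin 4 → ℝ) : ℝ := p.γ * x 3 + p.β * x 0

/-- The inverse of the distance to the origin in the boosted frame. -/
noncomputable def invRadius (x : Fin 4 → ℝ) : ℝ := (√(x 1 ^ 2 + x 2 ^ 2 + p.height x ^ 2))⁻¹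

/-- The covector `ℓ` at `ε = 0`. -/
noncomputable def ellZero (x : Fin 4 → ℝ) : Fin 4 → ℝ :=
  ![p.γ + p.β * (p.invRadius x * p.height x), p.invRadius x * x 1, p.invRadius x * x 2,
    p.β + p.γ * (p.invRadius x * p.height x)]

/-- The covector `dℓ/dε` at `ε = 0`. -/
noncomputable def ellOne (x : Fin 4 → ℝ) : Fin 4 → ℝ :=
  ![p.β * (p.ζ * (p.height x * x 2 * p.invRadius x ^ 3) - p.a * p.s * (x 2 * p.invRadius x ^ 2)),
    p.ζ * (x 1 * x 2 * p.invRadius x ^ 3) + p.a * p.c * (x 2 * p.invRadius x ^ 2),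
    p.ζ * (x 2 * x 2 * p.invRadius x ^ 3) - p.ζ * p.invRadius x -
      p.a * p.c * (x 1 * p.invRadius x ^ 2) + p.a * p.s * (p.height x * p.invRadius x ^ 2),
    p.γ * (p.ζ * (p.height x * x 2 * p.invRadius x ^ 3) - p.a * p.s * (x 2 * p.invRadius x ^ 2))]

/-- The perturbation at `ε = 0`. -/
noncomputable def pertZero : Tensor4 := fun x =>
  Matrix.of fun μ ν => 2 * p.m * (p.invRadius x * (p.ellZero x μ * p.ellZero x ν))

/-- The `ε`-derivative of the perturbation at `ε = 0`. -/
noncomputable def pertOne : Tensor4 := fun x =>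
  Matrix.of fun μ ν => 2 * p.m * (p.ζ * (x 2 * p.invRadius x ^ 3) *
      (p.ellZero x μ * p.ellZero x ν) + p.invRadius x *
      (p.ellOne x μ * p.ellZero x ν + p.ellZero x μ * p.ellOne x ν))

variable {p} {x : Fin 4 → ℝ}

theorem invRadius_pos (h : p.Regular 0 x) : 0 < p.invRadius x := by
  rw [regular_zero] at h
  exact inv_pos.2 (Real.sqrt_pos.2 h)

theorem kerrRadius_zero (h : p.Regular 0 x) :
    kerrRadius (0 * p.a) (p.restPoint 0 x) = (p.invRadius x)⁻¹ := by
  have h' := regular_zero p |>.1 h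
  have hn := p.restPoint_norm 0 x
  rw [invRadius, inv_inv, kerrRadius, hn]
  simp only [zero_mul, sub_zero, ne_eq, OfNat.ofNat_ne_zero, not_false_eq_true, zero_pow,
    mul_zero, add_zero]
  rw [Real.sqrt_sq h'.le, height]
  congr 1; ring

theorem hasDerivAt_restPoint_two (ε : ℝ) :
    HasDerivAt (fun ε => p.restPoint ε x 2) (-p.ζ) ε := by
  have : HasDerivAt (fun ε => x 2 - ε * p.ζ) (-p.ζ) ε :=
    (((hasDerivAt_id ε).mul_const p.ζ).const_sub (x 2)).congr_deriv (by simp)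
  exact this

/-- The spin enters the radius only through its square, so at first order only the translation acts.
-/
theorem hasDerivAt_kerrRadius (h : p.Regular 0 x) :
    HasDerivAt (fun ε => kerrRadius (ε * p.a) (p.restPoint ε x))
      (-(p.ζ * x 2 * p.invRadius x)) 0 := by
  have h' := regular_zero p |>.1 h
  have hq := invRadius_pos h
  have hn := p.restPoint_norm 0 x
  simp only [zero_mul, sub_zero] at hn
  set D := x 1 ^ 2 + x 2 ^ 2 + (p.γ * x 3 + p.β * x 0) ^ 2 with hD
  have he : HasDerivAt (fun ε : ℝ => (ε * p.a) ^ 2) 0 0 :=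
    (((hasDerivAt_id (0 : ℝ)).mul_const p.a).pow 2).congr_deriv (by simp)
  have hS : HasDerivAt (fun ε => p.restPoint ε x 1 ^ 2 + p.restPoint ε x 2 ^ 2 +
      p.restPoint ε x 3 ^ 2 - (ε * p.a) ^ 2) (-(2 * p.ζ * x 2)) 0 := by
    have h1 : HasDerivAt (fun ε => p.restPoint ε x 1 ^ 2) 0 0 :=
      hasDerivAt_const (0 : ℝ) (p.restPoint 0 x 1 ^ 2)
    have h3 : HasDerivAt (fun ε => p.restPoint ε x 3 ^ 2) 0 0 :=
      hasDerivAt_const (0 : ℝ) (p.restPoint 0 x 3 ^ 2)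
    have h2 := (hasDerivAt_restPoint_two (p := p) (x := x) 0).pow 2
    refine (((h1.add h2).add h3).sub he).congr_deriv ?_
    simp [restPoint]; ring
  have hdisc : HasDerivAt (fun ε => (p.restPoint ε x 1 ^ 2 + p.restPoint ε x 2 ^ 2 +
      p.restPoint ε x 3 ^ 2 - (ε * p.a) ^ 2) ^ 2 + 4 * (ε * p.a) ^ 2 * p.restPoint ε x 3 ^ 2)
      (2 * D * -(2 * p.ζ * x 2)) 0 := by
    refine ((hS.pow 2).add ((he.const_mul 4).mul_const (p.restPoint 0 x 3 ^ 2))).congr_deriv ?_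
    rw [hn]; simp
  have hsq := hdisc.sqrt (by rw [hn]; simp; exact h'.ne')
  have hv : (p.restPoint 0 x 1 ^ 2 + p.restPoint 0 x 2 ^ 2 + p.restPoint 0 x 3 ^ 2 -
      (0 * p.a) ^ 2) ^ 2 + 4 * (0 * p.a) ^ 2 * p.restPoint 0 x 3 ^ 2 = D ^ 2 := by
    rw [hn]; ring
  rw [hv, Real.sqrt_sq h'.le] at hsq
  have hfin := ((hS.add hsq).div_const 2).sqrt (by
    simp only [Pi.add_apply]
    rw [hv, Real.sqrt_sq h'.le, hn]; simp; exact h'.ne')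
  refine hfin.congr_deriv ?_
  simp only [Pi.add_apply]
  rw [hv, Real.sqrt_sq h'.le, hn, invRadius, height, ← hD]
  have e : (D - (0 * p.a) ^ 2 + D) / 2 = D := by ring
  rw [e]
  have hs : 0 < √D := Real.sqrt_pos.2 h'
  field_simp
  ring

theorem kerrH_zero (h : p.Regular 0 x) :
    kerrH p.m (0 * p.a) (p.restPoint 0 x) = p.m * p.invRadius x := by
  have hq := invRadius_pos h
  rw [kerrH, kerrRadius_zero h]
  simp only [zero_mul]
  field_simp
  simp

/-- To first order H is m/r̃; the correction a²z² in the denominator is of second order in ε. -/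
theorem hasDerivAt_kerrH (h : p.Regular 0 x) :
    HasDerivAt (fun ε => kerrH p.m (ε * p.a) (p.restPoint ε x))
      (p.m * (p.ζ * (x 2 * p.invRadius x ^ 3))) 0 := by
  have hq := invRadius_pos h
  have hR := hasDerivAt_kerrRadius h
  have he : HasDerivAt (fun ε : ℝ => (ε * p.a) ^ 2) 0 0 :=
    (((hasDerivAt_id (0 : ℝ)).mul_const p.a).pow 2).congr_deriv (by simp)
  have hden := (hR.pow 4).add (he.mul_const (p.restPoint 0 x 3 ^ 2))
  have := ((hR.pow 3).const_mul p.m).div hden (by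
    simp only [Pi.add_apply, Pi.pow_apply, kerrRadius_zero h]; simp; positivity)
  refine this.congr_deriv ?_
  simp only [Pi.add_apply, Pi.pow_apply, kerrRadius_zero h]
  simp only [zero_mul, ne_eq, OfNat.ofNat_ne_zero, not_false_eq_true, zero_pow, add_zero,
    Nat.reduceSub, Nat.cast_ofNat]
  field_simp
  ring

/-- In contrast to H, the covector sees the spin linearly, through the terms ay and −ax in its
numerators. This is the source of the angular momentum at rest. -/
theorem hasDerivAt_kerrEll (h : p.Regular 0 x) (μ : Fin 4) :
    HasDerivAt (fun ε => kerrEll (ε * p.a) (p.restPoint ε x) μ)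
      (![0, p.a * x 2 * p.invRadius x ^ 2 + p.ζ * x 2 * p.restPoint 0 x 1 * p.invRadius x ^ 3,
        p.ζ * x 2 * x 2 * p.invRadius x ^ 3 - p.ζ * p.invRadius x -
          p.a * p.restPoint 0 x 1 * p.invRadius x ^ 2,
        p.ζ * x 2 * p.restPoint 0 x 3 * p.invRadius x ^ 3] μ) 0 := by
  have hq := invRadius_pos h
  have hR := hasDerivAt_kerrRadius h
  have ha : HasDerivAt (fun ε : ℝ => ε * p.a) p.a 0 :=
    ((hasDerivAt_id (0 : ℝ)).mul_const p.a).congr_deriv (by simp)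
  have he : HasDerivAt (fun ε : ℝ => (ε * p.a) ^ 2) 0 0 :=
    (((hasDerivAt_id (0 : ℝ)).mul_const p.a).pow 2).congr_deriv (by simp)
  have hden := (hR.pow 2).add he
  have hden0 : (kerrRadius (0 * p.a) (p.restPoint 0 x)) ^ 2 + (0 * p.a) ^ 2 ≠ 0 := by
    rw [kerrRadius_zero h]; positivity
  have h2 := hasDerivAt_restPoint_two (p := p) (x := x) 0
  have hr2 : p.restPoint 0 x 2 = x 2 := by simp [restPoint]
  fin_cases μ
  · exact hasDerivAt_const _ _
  · have := ((hR.mul_const (p.restPoint 0 x 1)).add (ha.mul h2)).div hden hden0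
    refine this.congr_deriv ?_
    simp only [Pi.add_apply, Pi.mul_apply, Pi.pow_apply, kerrRadius_zero h, hr2]
    simp
    field_simp
    ring
  · have := ((hR.mul h2).sub (ha.mul_const (p.restPoint 0 x 1))).div hden hden0
    refine this.congr_deriv ?_
    simp only [Pi.add_apply, Pi.sub_apply, Pi.mul_apply, Pi.pow_apply, kerrRadius_zero h, hr2]
    simp
    field_simp
    ring
  · have := (hasDerivAt_const (0 : ℝ) (p.restPoint 0 x 3)).div hR
      (by rw [kerrRadius_zero h]; positivity)
    refine this.congr_deriv ?_
    simp only [kerrRadius_zero h]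
    simp
    field_simp

/-- Without spin and translation the tilt cancels by c² + s² = 1, leaving boosted Schwarzschild. -/
theorem ell_zero (h : p.Regular 0 x) : p.ell 0 x = p.ellZero x := by
  have hq := invRadius_pos h
  have h1 := p.cs
  rw [ell, kerrEll, kerrRadius_zero h]
  ext μ
  fin_cases μ <;>
    simp [frame, Matrix.vecMul, dotProduct, Fin.sum_univ_four, ellZero, restPoint, height] <;>
    field_simp <;> grind

theorem hasDerivAt_ell (h : p.Regular 0 x) (μ : Fin 4) :
    HasDerivAt (fun ε => p.ell ε x μ) (p.ellOne x μ) 0 := by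
  have hd := HasDerivAt.fun_sum (u := Finset.univ) fun ν _ =>
    (hasDerivAt_kerrEll h ν).mul_const (p.frame ν μ)
  have e : (fun ε => p.ell ε x μ) = fun ε =>
      ∑ ν, kerrEll (ε * p.a) (p.restPoint ε x) ν * p.frame ν μ := by
    ext ε; simp only [ell, Matrix.vecMul, dotProduct]
  rw [e]
  refine hd.congr_deriv ?_
  have h1 := p.cs
  fin_cases μ <;>
    simp [Fin.sum_univ_four, frame, ellOne, restPoint, height] <;> grind

theorem perturbation_zero (h : p.Regular 0 x) (μ ν : Fin 4) :
    p.perturbation 0 x μ ν = p.pertZero x μ ν := by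
  rw [perturbation, kerrH_zero h, ell_zero h]
  simp [pertZero, Matrix.vecMulVec_apply]
  ring

theorem hasDerivAt_perturbation (h : p.Regular 0 x) (μ ν : Fin 4) :
    HasDerivAt (fun ε => p.perturbation ε x μ ν) (p.pertOne x μ ν) 0 := by
  have e : (fun ε => p.perturbation ε x μ ν) = fun ε =>
      2 * kerrH p.m (ε * p.a) (p.restPoint ε x) * (p.ell ε x μ * p.ell ε x ν) := by
    ext ε; simp [perturbation, Matrix.vecMulVec_apply]
  rw [e]
  refine (((hasDerivAt_kerrH h).const_mul 2).mul
    ((hasDerivAt_ell h μ).mul (hasDerivAt_ell h ν))).congr_deriv ?_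
  simp only [Pi.mul_apply, kerrH_zero h, ell_zero h, pertOne, Matrix.of_apply]
  ring

end BoostedKerr

namespace BoostedKerr

/-! ### First derivatives of the expansion coefficients -/

section Gradients

variable (p : BoostedKerr) (x : Fin 4 → ℝ)

/-- The gradient of `height`. -/
def dHeight : Fin 4 → ℝ := ![p.β, 0, 0, p.γ]

/-- The gradient of `invRadius`. -/
noncomputable def dInvRadius : Fin 4 → ℝ := fun α =>
  -(p.invRadius x ^ 3 * ![p.height x * p.β, x 1, x 2, p.height x * p.γ] α)

/-- The gradient of the coordinate `x`. -/
def dX : Fin 4 → ℝ := ![0, 1, 0, 0]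

/-- The gradient of the coordinate `y`. -/
def dY : Fin 4 → ℝ := ![0, 0, 1, 0]

/-- The gradients of the components of `ellZero`. -/
noncomputable def dEllZero (α : Fin 4) : Fin 4 → ℝ :=
  ![p.β * (p.dInvRadius x α * p.height x + p.invRadius x * p.dHeight α),
    p.dInvRadius x α * x 1 + p.invRadius x * dX α,
    p.dInvRadius x α * x 2 + p.invRadius x * dY α,
    p.γ * (p.dInvRadius x α * p.height x + p.invRadius x * p.dHeight α)]

/-- The gradient of `f * q ^ 2`, with `q` the inverse radius. -/
noncomputable def dMulSq (f : ℝ) (df : Fin 4 → ℝ) (α : Fin 4) : ℝ :=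
  df α * p.invRadius x ^ 2 + f * (2 * p.invRadius x * p.dInvRadius x α)

/-- The gradient of `f * q ^ 3`, with `q` the inverse radius. -/
noncomputable def dMulCube (f : ℝ) (df : Fin 4 → ℝ) (α : Fin 4) : ℝ :=
  df α * p.invRadius x ^ 3 + f * (3 * p.invRadius x ^ 2 * p.dInvRadius x α)

/-- The gradients of the components of `ellOne`. -/
noncomputable def dEllOne (α : Fin 4) : Fin 4 → ℝ :=
  ![p.β * (p.ζ * p.dMulCube x (p.height x * x 2)
        (fun α => p.dHeight α * x 2 + p.height x * dY α) α -
      p.a * p.s * p.dMulSq x (x 2) dY α),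
    p.ζ * p.dMulCube x (x 1 * x 2) (fun α => dX α * x 2 + x 1 * dY α) α +
      p.a * p.c * p.dMulSq x (x 2) dY α,
    p.ζ * p.dMulCube x (x 2 * x 2) (fun α => dY α * x 2 + x 2 * dY α) α -
      p.ζ * p.dInvRadius x α - p.a * p.c * p.dMulSq x (x 1) dX α +
      p.a * p.s * p.dMulSq x (p.height x) p.dHeight α,
    p.γ * (p.ζ * p.dMulCube x (p.height x * x 2)
        (fun α => p.dHeight α * x 2 + p.height x * dY α) α -
      p.a * p.s * p.dMulSq x (x 2) dY α)]

/-- The first derivatives of `pertZero`. -/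
noncomputable def dPertZero (α μ ν : Fin 4) : ℝ :=
  2 * p.m * (p.dInvRadius x α * (p.ellZero x μ * p.ellZero x ν) + p.invRadius x *
    (p.dEllZero x α μ * p.ellZero x ν + p.ellZero x μ * p.dEllZero x α ν))

/-- The first derivatives of `pertOne`. -/
noncomputable def dPertOne (α μ ν : Fin 4) : ℝ :=
  2 * p.m * (p.ζ * p.dMulCube x (x 2) dY α * (p.ellZero x μ * p.ellZero x ν) +
      p.ζ * (x 2 * p.invRadius x ^ 3) *
        (p.dEllZero x α μ * p.ellZero x ν + p.ellZero x μ * p.dEllZero x α ν) +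
    (p.dInvRadius x α * (p.ellOne x μ * p.ellZero x ν + p.ellZero x μ * p.ellOne x ν) +
      p.invRadius x * ((p.dEllOne x α μ * p.ellZero x ν + p.ellOne x μ * p.dEllZero x α ν) +
        (p.dEllZero x α μ * p.ellOne x ν + p.ellZero x μ * p.dEllOne x α ν))))

variable {p x}

theorem hasGrad_x : HasGrad (fun x => x 1) dX x :=
  (hasGrad_coord 1 x).congr_grad fun μ => by fin_cases μ <;> simp [dX]

theorem hasGrad_y : HasGrad (fun x => x 2) dY x :=
  (hasGrad_coord 2 x).congr_grad fun μ => by fin_cases μ <;> simp [dY]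

theorem hasGrad_height : HasGrad p.height p.dHeight x :=
  (((hasGrad_coord 3 x).const_mul p.γ).add ((hasGrad_coord 0 x).const_mul p.β)).congr_grad
    fun μ => by fin_cases μ <;> simp [dHeight]

theorem hasGrad_invRadius (h : p.Regular 0 x) : HasGrad p.invRadius (p.dInvRadius x) x := by
  have h' := (regular_zero p).1 h
  have hW : HasGrad p.height p.dHeight x := hasGrad_height
  have hD := ((hasGrad_x (x := x)).mul hasGrad_x).add (hasGrad_y.mul hasGrad_y) |>.add (hW.mul hW)
  have e : p.invRadius = fun x => (√(x 1 * x 1 + x 2 * x 2 + p.height x * p.height x))⁻¹ := by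
    ext x; rw [invRadius]; congr 2; ring
  have hD0 : x 1 * x 1 + x 2 * x 2 + p.height x * p.height x ≠ 0 := by
    rw [height]; nlinarith
  have hs : 0 < √(x 1 * x 1 + x 2 * x 2 + p.height x * p.height x) := by
    apply Real.sqrt_pos.2; rw [height]; nlinarith
  have hc := HasGrad.comp (f := fun x => x 1 * x 1 + x 2 * x 2 + p.height x * p.height x)
    (φ := fun D => (√D)⁻¹) ((Real.hasDerivAt_sqrt hD0).inv hs.ne') hD
  rw [e]
  refine hc.congr_grad fun μ => ?_
  rw [dInvRadius, show p.invRadius x = (√(x 1 * x 1 + x 2 * x 2 + p.height x * p.height x))⁻¹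
    from congrFun e x]
  fin_cases μ <;> simp [dX, dY, dHeight] <;> field_simp <;> ring

theorem hasGrad_mul_sq (h : p.Regular 0 x) {f : (Fin 4 → ℝ) → ℝ} {d : Fin 4 → ℝ}
    (hf : HasGrad f d x) :
    HasGrad (fun x => f x * p.invRadius x ^ 2) (p.dMulSq x (f x) d) x :=
  hf.mul (HasGrad.comp ((hasDerivAt_pow 2 _).congr_deriv (by simp)) (hasGrad_invRadius h))

theorem hasGrad_mul_cube (h : p.Regular 0 x) {f : (Fin 4 → ℝ) → ℝ} {d : Fin 4 → ℝ}
    (hf : HasGrad f d x) :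
    HasGrad (fun x => f x * p.invRadius x ^ 3) (p.dMulCube x (f x) d) x :=
  hf.mul (HasGrad.comp ((hasDerivAt_pow 3 _).congr_deriv (by simp)) (hasGrad_invRadius h))

theorem hasGrad_ellZero (h : p.Regular 0 x) (μ : Fin 4) :
    HasGrad (fun x => p.ellZero x μ) (fun α => p.dEllZero x α μ) x := by
  have hq := hasGrad_invRadius h
  have hW : HasGrad p.height p.dHeight x := hasGrad_height
  fin_cases μ
  · exact ((hasGrad_const p.γ x).add ((hq.mul hW).const_mul p.β)).congr_grad fun α => by
      simp [dEllZero]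
  · exact hq.mul hasGrad_x
  · exact hq.mul hasGrad_y
  · exact ((hasGrad_const p.β x).add ((hq.mul hW).const_mul p.γ)).congr_grad fun α => by
      simp [dEllZero]

theorem hasGrad_ellOne (h : p.Regular 0 x) (μ : Fin 4) :
    HasGrad (fun x => p.ellOne x μ) (fun α => p.dEllOne x α μ) x := by
  have hq := hasGrad_invRadius h
  have hW : HasGrad p.height p.dHeight x := hasGrad_height
  have h0 := ((hasGrad_mul_cube h (hW.mul hasGrad_y)).const_mul p.ζ).sub
    ((hasGrad_mul_sq h hasGrad_y).const_mul (p.a * p.s))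
  fin_cases μ
  · exact h0.const_mul p.β
  · exact ((hasGrad_mul_cube h (hasGrad_x.mul hasGrad_y)).const_mul p.ζ).add
      ((hasGrad_mul_sq h hasGrad_y).const_mul (p.a * p.c))
  · exact ((((hasGrad_mul_cube h (hasGrad_y.mul hasGrad_y)).const_mul p.ζ).sub
      (hq.const_mul p.ζ)).sub ((hasGrad_mul_sq h hasGrad_x).const_mul (p.a * p.c))).add
      ((hasGrad_mul_sq h hW).const_mul (p.a * p.s))
  · exact h0.const_mul p.γ

theorem hasGrad_pertZero (h : p.Regular 0 x) (μ ν : Fin 4) :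
    HasGrad (fun x => p.pertZero x μ ν) (fun α => p.dPertZero x α μ ν) x :=
  ((hasGrad_invRadius h).mul ((hasGrad_ellZero h μ).mul (hasGrad_ellZero h ν))).const_mul (2 * p.m)

theorem hasGrad_pertOne (h : p.Regular 0 x) (μ ν : Fin 4) :
    HasGrad (fun x => p.pertOne x μ ν) (fun α => p.dPertOne x α μ ν) x :=
  ((((hasGrad_mul_cube h hasGrad_y).const_mul p.ζ).mul
    ((hasGrad_ellZero h μ).mul (hasGrad_ellZero h ν))).add
    ((hasGrad_invRadius h).mul (((hasGrad_ellOne h μ).mul (hasGrad_ellZero h ν)).add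
      ((hasGrad_ellZero h μ).mul (hasGrad_ellOne h ν))))).const_mul (2 * p.m)

end Gradients

/-! ### Jets of the perturbation along the unit sphere -/

section Jets

variable {p : BoostedKerr}

theorem eventually_regular_zero {x : Fin 4 → ℝ} (h : p.Regular 0 x) :
    ∀ᶠ u in 𝓝 x, p.Regular 0 u := by
  simp only [regular_zero] at h ⊢
  have hc : Continuous fun u : Fin 4 → ℝ =>
      u 1 ^ 2 + u 2 ^ 2 + (p.γ * u 3 + p.β * u 0) ^ 2 := by fun_prop
  exact hc.continuousAt.eventually (lt_mem_nhds h)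

theorem pd4_perturbation_zero {x : Fin 4 → ℝ} (h : p.Regular 0 x) (α μ ν : Fin 4) :
    pd4 α (fun u => p.perturbation 0 u μ ν) x = p.dPertZero x α μ ν := by
  have e : (fun u => p.perturbation 0 u μ ν) =ᶠ[𝓝 x] fun u => p.pertZero u μ ν := by
    filter_upwards [eventually_regular_zero h] with u hu using perturbation_zero hu μ ν
  rw [pd4, e.fderiv_eq]
  exact (hasGrad_pertZero h μ ν).2 α

/-- Parameter and space derivatives commute, so the closed form of the first coefficient can be
differentiated instead of the full metric. Regularity at ε = 0 is open, which makes that closed form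
available on a neighbourhood. -/
theorem hasDerivAt_pd4_perturbation {x : Fin 4 → ℝ} (h : p.Regular 0 x) (α μ ν : Fin 4) :
    HasDerivAt (fun ε => pd4 α (fun u => p.perturbation ε u μ ν) x) (p.dPertOne x α μ ν) 0 := by
  have hs : ContDiffAt ℝ 2 (Function.uncurry fun ε u => p.perturbation ε u μ ν) (0, x) :=
    (p.contDiffAt_perturbation (q := (0, x)) h μ ν).of_le two_le_infty
  refine (hasDerivAt_fderiv_curry hs (Pi.single α 1)).congr_deriv ?_
  have e : (fun u => deriv (fun ε => p.perturbation ε u μ ν) 0) =ᶠ[𝓝 x]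
      fun u => p.pertOne u μ ν := by
    filter_upwards [eventually_regular_zero h] with u hu using (hasDerivAt_perturbation hu μ ν).deriv
  rw [e.fderiv_eq]
  exact (hasGrad_pertOne h μ ν).2 α

theorem contDiff_slicePoint : ContDiff ℝ ∞ slicePoint := by
  refine contDiff_pi.2 fun i => ?_
  refine Fin.cases ?_ (fun i => ?_) i
  · exact contDiff_const
  · simp only [slicePoint, Matrix.cons_val_succ]
    fun_prop

theorem contDiffAt_comp_slicePoint {F : ℝ → (Fin 4 → ℝ) → ℝ} {ε : ℝ} {y : E3}
    (h : ContDiffAt ℝ ∞ (Function.uncurry F) (ε, slicePoint y)) :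
    ContDiffAt ℝ ∞ (Function.uncurry fun ε y => F ε (slicePoint y)) (ε, y) :=
  ContDiffAt.comp (ε, y) (f := fun q : ℝ × E3 => (q.1, slicePoint q.2)) h
    (contDiffAt_fst.prodMk (contDiff_slicePoint.contDiffAt.comp _ contDiffAt_snd))

theorem hasFDerivAt_slicePoint (y : E3) (i : Fin 3) :
    fderiv ℝ slicePoint y (EuclideanSpace.single i 1) = Pi.single i.succ 1 := by
  have hL : IsLinearMap ℝ slicePoint :=
    { map_add := fun y z => by
        ext j; refine Fin.cases ?_ (fun j => ?_) j <;> simp [slicePoint]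
      map_smul := fun c y => slicePoint_smul c y }
  have h : HasFDerivAt slicePoint (LinearMap.toContinuousLinearMap (hL.mk' slicePoint)) y :=
    (LinearMap.toContinuousLinearMap (hL.mk' slicePoint)).hasFDerivAt
  rw [h.fderiv]
  ext j
  refine Fin.cases ?_ (fun j => ?_) j <;>
    simp [slicePoint, Pi.single_apply, Fin.succ_ne_zero, eq_comm]

theorem pd3_comp_slicePoint {f : (Fin 4 → ℝ) → ℝ} {y : E3}
    (hf : DifferentiableAt ℝ f (slicePoint y)) (i : Fin 3) :
    pd3 i (fun y => f (slicePoint y)) y = pd4 i.succ f (slicePoint y) := by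
  have hs : DifferentiableAt ℝ slicePoint y :=
    contDiff_slicePoint.contDiffAt.differentiableAt (by simp)
  have h := (hf.hasFDerivAt.comp y hs.hasFDerivAt).fderiv
  have h' : fderiv ℝ (fun y => f (slicePoint y)) y =
    (fderiv ℝ f (slicePoint y)).comp (fderiv ℝ slicePoint y) := h
  rw [pd3, h', pd4, ContinuousLinearMap.comp_apply, hasFDerivAt_slicePoint]

theorem differentiableAt_perturbation {ε : ℝ} {x : Fin 4 → ℝ} (h : p.Regular ε x)
    (μ ν : Fin 4) : DifferentiableAt ℝ (fun u => p.perturbation ε u μ ν) x :=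
  (hasFDerivAt_snd_curry ((p.contDiffAt_perturbation (q := (ε, x)) h μ ν).differentiableAt
    (by simp))).differentiableAt

end Jets

end BoostedKerr

/-! ### Fluxes in terms of jets -/

/-- The covector `∂_i h_{ij} - ∂_j h_{ii}` in terms of the first derivatives `D` of `h`. -/
def energyJet (D : Fin 4 → Fin 4 → Fin 4 → ℝ) (j : Fin 3) : ℝ :=
  ∑ i : Fin 3, (D i.succ i.succ j.succ - D j.succ i.succ i.succ)

/-- The energy flux density. -/
def energyJetFlux (D : Fin 4 → Fin 4 → Fin 4 → ℝ) (y : E3) : ℝ := ∑ j, energyJet D j * y j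

/-- The center of mass flux density. -/
def centerJetFlux (A : Matrix (Fin 4) (Fin 4) ℝ) (D : Fin 4 → Fin 4 → Fin 4 → ℝ) (l : Fin 3)
    (y : E3) : ℝ :=
  ∑ j, (y l * energyJet D j - A l.succ j.succ +
    (if j = l then ∑ i : Fin 3, A i.succ i.succ else 0)) * y j

/-- The combination of first derivatives in `koszul`. -/
def koszulJet (D : Fin 4 → Fin 4 → Fin 4 → ℝ) (ρ : Fin 4) (i j : Fin 3) : ℝ :=
  D i.succ ρ j.succ + D j.succ ρ i.succ - D ρ i.succ j.succ

/-- The second fundamental form at `ε = 0`. -/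
noncomputable def secondFormZero (D : Fin 4 → Fin 4 → Fin 4 → ℝ) : Matrix (Fin 3) (Fin 3) ℝ :=
  Matrix.of fun i j => (1 / 2) * koszulJet D 0 i j

/-- The `ε`-derivative of the second fundamental form at `ε = 0`. -/
noncomputable def secondFormOne (A : Matrix (Fin 4) (Fin 4) ℝ)
    (D D₁ : Fin 4 → Fin 4 → Fin 4 → ℝ) : Matrix (Fin 3) (Fin 3) ℝ :=
  Matrix.of fun i j => (1 / 2) * ((1 / 2) * A 0 0 * koszulJet D 0 i j + koszulJet D₁ 0 i j -
    ∑ l : Fin 3, A 0 l.succ * koszulJet D l.succ i j)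

/-! ### The inverse radius on the unit sphere and its antiderivatives -/

namespace BoostedKerr

variable (p : BoostedKerr)

/-- The inverse radius on the unit sphere, as a function of the third coordinate. -/
noncomputable def sphereInv (z : ℝ) : ℝ := (√(1 + p.β ^ 2 * z ^ 2))⁻¹

theorem sphereInv_sq (z : ℝ) : p.sphereInv z ^ 2 * (1 + p.β ^ 2 * z ^ 2) = 1 := by
  rw [sphereInv, inv_pow, Real.sq_sqrt (by positivity)]
  exact inv_mul_cancel₀ (by positivity)

theorem height_slicePoint (y : E3) : p.height (slicePoint y) = p.γ * y 2 := by
  have e0 : slicePoint y 0 = 0 := rfl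
  have e3 : slicePoint y 3 = y 2 := rfl
  rw [height, e0, e3]; ring

/-- On the unit sphere y₀² + y₁² + γ²y₂² = 1 + β²y₂². That this depends on height alone is what
makes the flux integrals one-dimensional. -/
theorem invRadius_slicePoint {y : E3} (hy : ‖y‖ = 1) :
    p.invRadius (slicePoint y) = p.sphereInv (y 2) := by
  have hn := norm_sq_E3 y
  have e1 : slicePoint y 1 = y 0 := rfl
  have e2 : slicePoint y 2 = y 1 := rfl
  rw [hy] at hn
  rw [invRadius, sphereInv, height_slicePoint, e1, e2]
  congr 2
  linear_combination y 2 ^ 2 * p.γβ - hn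

theorem sphere_relation {y : E3} (hy : ‖y‖ = 1) : y 0 ^ 2 + y 1 ^ 2 + y 2 ^ 2 = 1 := by
  rw [← norm_sq_E3, hy, one_pow]

theorem slicePoint_one (y : E3) : slicePoint y 1 = y 0 := rfl

theorem slicePoint_two (y : E3) : slicePoint y 2 = y 1 := rfl

theorem continuous_sphereInv : Continuous p.sphereInv := by
  unfold sphereInv
  exact Continuous.inv₀ (by fun_prop) fun z => (Real.sqrt_pos.2 (by positivity)).ne'

theorem sphereInv_neg (z : ℝ) : p.sphereInv (-z) = p.sphereInv z := by
  rw [sphereInv, sphereInv, neg_sq]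

theorem sphereInv_one : p.sphereInv 1 = p.γ⁻¹ := by
  rw [sphereInv, one_pow, mul_one, ← p.γβ, Real.sqrt_sq p.γ_pos.le]

theorem hasDerivAt_sphereInv (z : ℝ) :
    HasDerivAt p.sphereInv (-(p.β ^ 2 * z * p.sphereInv z ^ 3)) z := by
  have hpos : 0 < 1 + p.β ^ 2 * z ^ 2 := by positivity
  have h1 : HasDerivAt (fun z => 1 + p.β ^ 2 * z ^ 2) (p.β ^ 2 * (2 * z)) z :=
    (((hasDerivAt_pow 2 z).const_mul (p.β ^ 2)).const_add 1).congr_deriv (by simp)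
  refine ((h1.sqrt hpos.ne').inv (Real.sqrt_pos.2 hpos).ne').congr_deriv ?_
  rw [sphereInv]
  have hs := Real.sqrt_pos.2 hpos
  field_simp

/-- The antiderivative of `q ^ 3`. -/
theorem hasDerivAt_mul_sphereInv (z : ℝ) :
    HasDerivAt (fun z => z * p.sphereInv z) (p.sphereInv z ^ 3) z :=
  ((hasDerivAt_id z).mul (p.hasDerivAt_sphereInv z)).congr_deriv (by
    simp only [id]; linear_combination -p.sphereInv z * p.sphereInv_sq z)

/-- The derivative of `z (1 - z ^ 2) q ^ 2`. -/
theorem hasDerivAt_sphereInv_sq (z : ℝ) :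
    HasDerivAt (fun z => z * (1 - z ^ 2) * p.sphereInv z ^ 2)
      (2 * (1 - z ^ 2) * p.sphereInv z ^ 4 - (1 + z ^ 2) * p.sphereInv z ^ 2) z :=
  (((hasDerivAt_id z).mul ((hasDerivAt_pow 2 z).const_sub 1)).mul
    ((p.hasDerivAt_sphereInv z).pow 2)).congr_deriv (by
      simp
      linear_combination -2 * (1 - z ^ 2) * p.sphereInv z ^ 2 * p.sphereInv_sq z)

/-- The derivative of `z (1 - z ^ 2) q ^ 3`. -/
theorem hasDerivAt_sphereInv_cube (z : ℝ) :
    HasDerivAt (fun z => z * (1 - z ^ 2) * p.sphereInv z ^ 3)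
      (3 * (1 - z ^ 2) * p.sphereInv z ^ 5 - 2 * p.sphereInv z ^ 3) z :=
  (((hasDerivAt_id z).mul ((hasDerivAt_pow 2 z).const_sub 1)).mul
    ((p.hasDerivAt_sphereInv z).pow 3)).congr_deriv (by
      simp
      linear_combination -3 * (1 - z ^ 2) * p.sphereInv z ^ 3 * p.sphereInv_sq z)

end BoostedKerr

/-! ### Integrals over the sphere by parity and height -/

/-- The reflection of one coordinate. -/
noncomputable def flipIsometry (i : Fin 3) : E3 ≃ₗᵢ[ℝ] E3 :=
  LinearIsometryEquiv.piLpCongrRight 2 fun j =>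
    if j = i then LinearIsometryEquiv.neg ℝ else LinearIsometryEquiv.refl ℝ ℝ

theorem flipIsometry_apply (i j : Fin 3) (y : E3) :
    flipIsometry i y j = if j = i then -y j else y j := by
  by_cases h : j = i <;> simp [flipIsometry, h]

/-- The exchange of the first two coordinates. -/
noncomputable def swapIsometry : E3 ≃ₗᵢ[ℝ] E3 :=
  LinearIsometryEquiv.piLpCongrLeft 2 ℝ ℝ (Equiv.swap 0 1)

theorem swapIsometry_apply (j : Fin 3) (y : E3) :
    swapIsometry y j = y (Equiv.swap 0 1 j) := by
  simp [swapIsometry, Equiv.piCongrLeft']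

theorem integral_sphere_odd (i : Fin 3) {f : E3 → ℝ} (h : ∀ y, f (flipIsometry i y) = -f y) :
    ∫ ν : Metric.sphere (0 : E3) 1, f ν ∂sphereMeasure = 0 := by
  have := integral_sphere_comp_isometry (flipIsometry i) f
  simp only [h, integral_neg] at this
  linarith

/-- The integral over the sphere of a function of the form `A(z) + y² B(z)`, up to functions which
are odd in one of the coordinates. -/
theorem integral_sphere_eq {F : E3 → ℝ} {A B G : ℝ → ℝ} (U V W : ℝ → ℝ → ℝ → ℝ)
    (hF : ∀ y : E3, ‖y‖ = 1 → F y = A (y 2) + y 1 ^ 2 * B (y 2) + U (y 0) (y 1) (y 2) +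
      V (y 0) (y 1) (y 2) + W (y 0) (y 1) (y 2))
    (hU : ∀ a b c, U (-a) b c = -U a b c) (hV : ∀ a b c, V a (-b) c = -V a b c)
    (hW : ∀ a b c, W a b (-c) = -W a b c)
    (hA : Continuous A) (hB : Continuous B)
    (cU : Continuous fun y : E3 => U (y 0) (y 1) (y 2))
    (cV : Continuous fun y : E3 => V (y 0) (y 1) (y 2))
    (cW : Continuous fun y : E3 => W (y 0) (y 1) (y 2))
    (hG : ∀ c, HasDerivAt G (A c + (1 - c ^ 2) / 2 * B c) c) :
    ∫ ν : Metric.sphere (0 : E3) 1, F ν ∂sphereMeasure = 2 * Real.pi * (G 1 - G (-1)) := by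
  have hi : ∀ f : E3 → ℝ, Continuous f →
      Integrable (fun ν : Metric.sphere (0 : E3) 1 => f ν) sphereMeasure := fun f hf =>
    integrable_sphere fun v _ => hf.continuousAt
  have iA := hi (fun y => A (y 2)) (by fun_prop)
  have iB := hi (fun y => y 1 ^ 2 * B (y 2)) (by fun_prop)
  have iB' := hi (fun y => y 0 ^ 2 * B (y 2)) (by fun_prop)
  have iU := hi _ cU
  have iV := hi _ cV
  have iW := hi _ cW
  have zU : ∫ ν : Metric.sphere (0 : E3) 1, U ((ν : E3) 0) ((ν : E3) 1) ((ν : E3) 2)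
      ∂sphereMeasure = 0 :=
    integral_sphere_odd 0 (f := fun y => U (y 0) (y 1) (y 2)) fun y => by
      simp [flipIsometry_apply, hU]
  have zV : ∫ ν : Metric.sphere (0 : E3) 1, V ((ν : E3) 0) ((ν : E3) 1) ((ν : E3) 2)
      ∂sphereMeasure = 0 :=
    integral_sphere_odd 1 (f := fun y => V (y 0) (y 1) (y 2)) fun y => by
      simp [flipIsometry_apply, hV]
  have zW : ∫ ν : Metric.sphere (0 : E3) 1, W ((ν : E3) 0) ((ν : E3) 1) ((ν : E3) 2)
      ∂sphereMeasure = 0 :=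
    integral_sphere_odd 2 (f := fun y => W (y 0) (y 1) (y 2)) fun y => by
      simp [flipIsometry_apply, hW]
  -- By symmetry y₁² may be replaced by the mean of y₀² and y₁², which is (1 − z²)/2 on the sphere;
  -- hence the weight of `B` in `hG`.
  have hswap : ∫ ν : Metric.sphere (0 : E3) 1, (ν : E3) 0 ^ 2 * B ((ν : E3) 2) ∂sphereMeasure =
      ∫ ν : Metric.sphere (0 : E3) 1, (ν : E3) 1 ^ 2 * B ((ν : E3) 2) ∂sphereMeasure := by
    rw [← integral_sphere_comp_isometry swapIsometry fun y => y 0 ^ 2 * B (y 2)]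
    simp [swapIsometry_apply, Equiv.swap_apply_of_ne_of_ne]
  have hsum : ∫ ν : Metric.sphere (0 : E3) 1, F ν ∂sphereMeasure =
      ∫ ν : Metric.sphere (0 : E3) 1, A ((ν : E3) 2) ∂sphereMeasure +
      ∫ ν : Metric.sphere (0 : E3) 1, (ν : E3) 1 ^ 2 * B ((ν : E3) 2) ∂sphereMeasure := by
    have h1 := hi (fun y => A (y 2) + y 1 ^ 2 * B (y 2)) (by fun_prop)
    have h2 := hi (fun y => A (y 2) + y 1 ^ 2 * B (y 2) + U (y 0) (y 1) (y 2))
      ((by fun_prop : Continuous fun y : E3 => A (y 2) + y 1 ^ 2 * B (y 2)).add cU)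
    have h3 := hi (fun y => A (y 2) + y 1 ^ 2 * B (y 2) + U (y 0) (y 1) (y 2) +
      V (y 0) (y 1) (y 2))
      (((by fun_prop : Continuous fun y : E3 => A (y 2) + y 1 ^ 2 * B (y 2)).add cU).add cV)
    have hF' : ∀ ν : Metric.sphere (0 : E3) 1, F ν = _ := fun ν => hF ν (by simp)
    simp only [hF']
    rw [integral_add h3 iW, integral_add h2 iV, integral_add h1 iU, integral_add iA iB, zU, zV, zW]
    ring
  have hheight := integral_sphere_deriv_height hG (by fun_prop)
  rw [← hheight, hsum]
  have hsplit : ∀ ν : Metric.sphere (0 : E3) 1,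
      A ((ν : E3) 2) + (1 - (ν : E3) 2 ^ 2) / 2 * B ((ν : E3) 2) =
      A ((ν : E3) 2) + ((1 / 2) * ((ν : E3) 0 ^ 2 * B ((ν : E3) 2)) +
        (1 / 2) * ((ν : E3) 1 ^ 2 * B ((ν : E3) 2))) := fun ν => by
    have hs := BoostedKerr.sphere_relation (y := ν) (by simp)
    linear_combination -(1 / 2) * B ((ν : E3) 2) * hs
  have h4 := hi (fun y => (1 / 2) * (y 0 ^ 2 * B (y 2)) + (1 / 2) * (y 1 ^ 2 * B (y 2)))
    (by fun_prop)
  simp only [hsplit]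
  rw [integral_add iA h4, integral_add (iB'.const_mul _) (iB.const_mul _), integral_const_mul, integral_const_mul, hswap]
  ring

namespace BoostedKerr

/-! ### The flux integrals -/

section Integrals

variable (p : BoostedKerr)

set_option linter.unusedSimpArgs false

/-- The pattern of all the flux integrals: the density is split into an even part given by `A` and
`B` and three odd parts, the antiderivative of the even part is built from zq, z(1 − z²)q² and z(1 −
z²)q³ (or is constant when that part is zero), and only its values at the poles, where q = 1/γ,
matter. -/
theorem integral_energy :
    ∫ ν : Metric.sphere (0 : E3) 1, energyJetFlux (p.dPertZero (slicePoint (ν : E3))) (ν : E3)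
      ∂sphereMeasure =
      16 * Real.pi * p.m * p.γ := by
  have cq := p.continuous_sphereInv
  refine (integral_sphere_eq
    (F := fun y => energyJetFlux (p.dPertZero (slicePoint y)) y)
    (A := fun c => 4 * p.sphereInv c ^ 3 * p.m + 4 * p.sphereInv c ^ 3 * p.β ^ 2 * p.m)
    (B := fun _ => 0)
    (G := fun c => (4 * p.γ ^ 2 * p.m) * (c * p.sphereInv c))
    (fun _ _ _ => 0)
    (fun _ _ _ => 0)
    (fun a b c => 4 * c * p.sphereInv c ^ 4 * p.β * p.m + 4 * c * p.sphereInv c ^ 4 * p.β ^ 3 * p.m)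
    (fun y hy => ?_) (by simp) (by simp) (fun a b c => by simp only [sphereInv_neg]; ring)
    (by fun_prop) (by fun_prop) (by fun_prop) (by fun_prop) (by fun_prop)
    fun c => ((p.hasDerivAt_mul_sphereInv c).const_mul (4 * p.γ ^ 2 * p.m)).congr_deriv ?_).trans ?_
  · have hs := sphere_relation hy
    have hq := p.sphereInv_sq (y 2)
    simp only [energyJetFlux, energyJet]
    simp [Fin.sum_univ_three, dPertZero, dEllZero, dInvRadius, dHeight, dX, dY, ellZero,
      invRadius_slicePoint p hy,
      height_slicePoint, slicePoint_one, slicePoint_two]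
    -- From here the splitting is a polynomial identity modulo γ² = 1 + β², the sphere equation and
    -- q²(1 + β²z²) = 1.
    generalize p.sphereInv (y 2) = q at *
    linear_combination (4 * y 2 ^ 2 * q ^ 3 * p.m + 2 * y 1 ^ 2 * q ^ 3 * p.m + 4 * y 1 ^ 2 * y 2
      * q ^ 4 * p.β * p.m + 2 * y 0 ^ 2 * q ^ 3 * p.m + 4 * y 0 ^ 2 * y 2 * q ^ 4 * p.β * p.m) *
      p.γβ + (4 * q ^ 3 * p.m + 4 * q ^ 3 * p.β ^ 2 * p.m + 4 * y 2 * q ^ 4 * p.β ^ 3 * p.m) * hs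
      + (-4 * y 2 * q ^ 2 * p.β * p.m) * hq
  · linear_combination (4 * p.sphereInv c ^ 3 * p.m) * p.γβ
  · have hγ := p.γ_pos
    rw [sphereInv_neg, sphereInv_one]
    field_simp
    ring

/-- Boosted Schwarzschild is symmetric about the boost axis, so the flux transverse to it is odd. -/
theorem integral_momentum_x :
    ∫ ν : Metric.sphere (0 : E3) 1, momentumFlux (fun _ => secondFormZero (p.dPertZero (slicePoint
      (ν : E3)))) 0 (ν : E3) ∂sphereMeasure =
      0 := by
  have cq := p.continuous_sphereInv
  refine (integral_sphere_eq
    (F := fun y => momentumFlux (fun _ => secondFormZero (p.dPertZero (slicePoint y))) 0 y)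
    (A := fun _ => 0)
    (B := fun _ => 0)
    (G := fun c => 0)
    (fun a b c => 2 * a * p.sphereInv c ^ 2 * p.γ * p.β ^ 2 * p.m - 4 * a * p.sphereInv c ^ 4 *
      p.γ * p.m - 4 * a * p.sphereInv c ^ 4 * p.γ * p.β ^ 2 * p.m + 2 * a * c * p.sphereInv c ^ 3
      * p.γ * p.β ^ 3 * p.m - 3 * a * c * p.sphereInv c ^ 5 * p.γ * p.β * p.m - 3 * a * c *
      p.sphereInv c ^ 5 * p.γ * p.β ^ 3 * p.m)
    (fun _ _ _ => 0)
    (fun _ _ _ => 0)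
    (fun y hy => ?_) (fun a b c => by ring) (by simp) (by simp)
    (by fun_prop) (by fun_prop) (by fun_prop) (by fun_prop) (by fun_prop)
    fun c => (hasDerivAt_const c (0 : ℝ)).congr_deriv ?_).trans ?_
  · have hs := sphere_relation hy
    have hq := p.sphereInv_sq (y 2)
    simp only [momentumFlux, secondFormZero, koszulJet]
    simp [Fin.sum_univ_three, dPertZero, dEllZero, dInvRadius, dHeight, dX, dY, ellZero,
      invRadius_slicePoint p hy,
      height_slicePoint, slicePoint_one, slicePoint_two, momentumDensity, Matrix.trace]
    generalize p.sphereInv (y 2) = q at *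
    linear_combination (-2 * y 0 * q ^ 2 * p.γ * p.m + 4 * y 0 * y 2 ^ 2 * q ^ 4 * p.γ * p.β ^ 2 *
      p.m + 4 * y 0 * y 2 ^ 2 * q ^ 4 * p.γ ^ 3 * p.m + 3 * y 0 * y 2 ^ 3 * q ^ 5 * p.γ * p.β ^ 3
      * p.m + 3 * y 0 * y 2 ^ 3 * q ^ 5 * p.γ ^ 3 * p.β * p.m) * p.γβ + (4 * y 0 * q ^ 2 * p.γ *
      p.m + 4 * y 0 * q ^ 2 * p.γ * p.β ^ 2 * p.m + 3 * y 0 * y 2 * q ^ 3 * p.γ * p.β * p.m + 3 *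
      y 0 * y 2 * q ^ 3 * p.γ * p.β ^ 3 * p.m) * hq
  · ring
  · simp

theorem integral_momentum_y :
    ∫ ν : Metric.sphere (0 : E3) 1, momentumFlux (fun _ => secondFormZero (p.dPertZero (slicePoint
      (ν : E3)))) 1 (ν : E3) ∂sphereMeasure =
      0 := by
  have cq := p.continuous_sphereInv
  refine (integral_sphere_eq
    (F := fun y => momentumFlux (fun _ => secondFormZero (p.dPertZero (slicePoint y))) 1 y)
    (A := fun _ => 0)
    (B := fun _ => 0)
    (G := fun c => 0)
    (fun _ _ _ => 0)
    (fun a b c => 2 * b * p.sphereInv c ^ 2 * p.γ * p.β ^ 2 * p.m - 4 * b * p.sphereInv c ^ 4 *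
      p.γ * p.m - 4 * b * p.sphereInv c ^ 4 * p.γ * p.β ^ 2 * p.m + 2 * b * c * p.sphereInv c ^ 3
      * p.γ * p.β ^ 3 * p.m - 3 * b * c * p.sphereInv c ^ 5 * p.γ * p.β * p.m - 3 * b * c *
      p.sphereInv c ^ 5 * p.γ * p.β ^ 3 * p.m)
    (fun _ _ _ => 0)
    (fun y hy => ?_) (by simp) (fun a b c => by ring) (by simp)
    (by fun_prop) (by fun_prop) (by fun_prop) (by fun_prop) (by fun_prop)
    fun c => (hasDerivAt_const c (0 : ℝ)).congr_deriv ?_).trans ?_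
  · have hs := sphere_relation hy
    have hq := p.sphereInv_sq (y 2)
    simp only [momentumFlux, secondFormZero, koszulJet]
    simp [Fin.sum_univ_three, dPertZero, dEllZero, dInvRadius, dHeight, dX, dY, ellZero,
      invRadius_slicePoint p hy,
      height_slicePoint, slicePoint_one, slicePoint_two, momentumDensity, Matrix.trace]
    generalize p.sphereInv (y 2) = q at *
    linear_combination (-2 * y 1 * q ^ 2 * p.γ * p.m + 4 * y 1 * y 2 ^ 2 * q ^ 4 * p.γ * p.β ^ 2 *
      p.m + 4 * y 1 * y 2 ^ 2 * q ^ 4 * p.γ ^ 3 * p.m + 3 * y 1 * y 2 ^ 3 * q ^ 5 * p.γ * p.β ^ 3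
      * p.m + 3 * y 1 * y 2 ^ 3 * q ^ 5 * p.γ ^ 3 * p.β * p.m) * p.γβ + (4 * y 1 * q ^ 2 * p.γ *
      p.m + 4 * y 1 * q ^ 2 * p.γ * p.β ^ 2 * p.m + 3 * y 1 * y 2 * q ^ 3 * p.γ * p.β * p.m + 3 *
      y 1 * y 2 * q ^ 3 * p.γ * p.β ^ 3 * p.m) * hq
  · ring
  · simp

/-- The sign reflects the frame: the point at rest at the spatial origin of Kerr coordinates moves
with velocity −β/γ along z. -/
theorem integral_momentum_z :
    ∫ ν : Metric.sphere (0 : E3) 1, momentumFlux (fun _ => secondFormZero (p.dPertZero (slicePoint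
      (ν : E3)))) 2 (ν : E3) ∂sphereMeasure =
      -(8 * Real.pi * p.m * p.β) := by
  have cq := p.continuous_sphereInv
  refine (integral_sphere_eq
    (F := fun y => momentumFlux (fun _ => secondFormZero (p.dPertZero (slicePoint y))) 2 y)
    (A := fun c => -4 * p.sphereInv c ^ 3 * p.γ * p.β * p.m + 3 * p.sphereInv c ^ 5 * p.γ * p.β *
      p.m - 3 * c ^ 2 * p.sphereInv c ^ 5 * p.γ * p.β * p.m)
    (B := fun _ => 0)
    (G := fun c => (-2 * p.γ * p.β * p.m) * (c * p.sphereInv c) + (p.γ * p.β * p.m) * (c * (1 - c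
      ^ 2) * p.sphereInv c ^ 3))
    (fun _ _ _ => 0)
    (fun _ _ _ => 0)
    (fun a b c => -4 * c * p.sphereInv c ^ 4 * p.γ * p.m - 4 * c * p.sphereInv c ^ 4 * p.γ * p.β ^
      2 * p.m)
    (fun y hy => ?_) (by simp) (by simp) (fun a b c => by simp only [sphereInv_neg]; ring)
    (by fun_prop) (by fun_prop) (by fun_prop) (by fun_prop) (by fun_prop)
    fun c => (((p.hasDerivAt_mul_sphereInv c).const_mul (-2 * p.γ * p.β * p.m)).add
      ((p.hasDerivAt_sphereInv_cube c).const_mul (p.γ * p.β * p.m))).congr_deriv ?_).trans ?_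
  · have hs := sphere_relation hy
    have hq := p.sphereInv_sq (y 2)
    simp only [momentumFlux, secondFormZero, koszulJet]
    simp [Fin.sum_univ_three, dPertZero, dEllZero, dInvRadius, dHeight, dX, dY, ellZero,
      invRadius_slicePoint p hy,
      height_slicePoint, slicePoint_one, slicePoint_two, momentumDensity, Matrix.trace]
    generalize p.sphereInv (y 2) = q at *
    linear_combination (-4 * y 1 ^ 2 * y 2 * q ^ 4 * p.γ * p.m - 3 * y 1 ^ 2 * y 2 ^ 2 * q ^ 5 *
      p.γ * p.β * p.m - 4 * y 0 ^ 2 * y 2 * q ^ 4 * p.γ * p.m - 3 * y 0 ^ 2 * y 2 ^ 2 * q ^ 5 *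
      p.γ * p.β * p.m) * p.γβ + (-q ^ 3 * p.γ * p.β * p.m - 4 * y 2 * q ^ 4 * p.γ * p.β ^ 2 * p.m
      - 3 * y 2 ^ 2 * q ^ 5 * p.γ * p.β ^ 3 * p.m) * hs + (-3 * q ^ 3 * p.γ * p.β * p.m + 4 * y 2
      * q ^ 2 * p.γ * p.m + 3 * y 2 ^ 2 * q ^ 3 * p.γ * p.β * p.m) * hq
  · ring
  · have hγ := p.γ_pos
    rw [sphereInv_neg, sphereInv_one]
    field_simp
    ring

/-- The vanishing of the order-zero terms of C and J is needed because these fluxes carry the factor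
ε⁻¹. -/
theorem integral_center_zero_x :
    ∫ ν : Metric.sphere (0 : E3) 1, centerJetFlux (p.pertZero (slicePoint (ν : E3))) (p.dPertZero
      (slicePoint (ν : E3))) 0 (ν : E3) ∂sphereMeasure =
      0 := by
  have cq := p.continuous_sphereInv
  refine (integral_sphere_eq
    (F := fun y => centerJetFlux (p.pertZero (slicePoint y)) (p.dPertZero (slicePoint y)) 0 y)
    (A := fun _ => 0)
    (B := fun _ => 0)
    (G := fun c => 0)
    (fun a b c => 2 * a * p.sphereInv c * p.m + 4 * a * p.sphereInv c * p.β ^ 2 * p.m + 2 * a *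
      p.sphereInv c ^ 3 * p.m + 2 * a * p.sphereInv c ^ 3 * p.β ^ 2 * p.m + 2 * a * c *
      p.sphereInv c ^ 2 * p.β * p.m + 4 * a * c * p.sphereInv c ^ 2 * p.β ^ 3 * p.m + 4 * a * c *
      p.sphereInv c ^ 4 * p.β * p.m + 4 * a * c * p.sphereInv c ^ 4 * p.β ^ 3 * p.m)
    (fun _ _ _ => 0)
    (fun _ _ _ => 0)
    (fun y hy => ?_) (fun a b c => by ring) (by simp) (by simp)
    (by fun_prop) (by fun_prop) (by fun_prop) (by fun_prop) (by fun_prop)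
    fun c => (hasDerivAt_const c (0 : ℝ)).congr_deriv ?_).trans ?_
  · have hs := sphere_relation hy
    have hq := p.sphereInv_sq (y 2)
    simp only [centerJetFlux, energyJet]
    simp [Fin.sum_univ_three, dPertZero, dEllZero, dInvRadius, dHeight, dX, dY, ellZero, pertZero,
      invRadius_slicePoint p hy,
      height_slicePoint, slicePoint_one, slicePoint_two]
    generalize p.sphereInv (y 2) = q at *
    linear_combination (4 * y 0 * y 2 * q ^ 2 * p.β * p.m + 4 * y 0 * y 2 ^ 2 * q ^ 3 * p.m + 2 *
      y 0 * y 2 ^ 2 * q ^ 3 * p.β ^ 2 * p.m + 2 * y 0 * y 2 ^ 2 * q ^ 3 * p.γ ^ 2 * p.m + 2 * y 0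
      * y 1 ^ 2 * q ^ 3 * p.m + 4 * y 0 * y 1 ^ 2 * y 2 * q ^ 4 * p.β * p.m + 2 * y 0 ^ 3 * q ^ 3
      * p.m + 4 * y 0 ^ 3 * y 2 * q ^ 4 * p.β * p.m) * p.γβ + (4 * y 0 * q ^ 3 * p.m + 4 * y 0 * q
      ^ 3 * p.β ^ 2 * p.m + 4 * y 0 * y 2 * q ^ 4 * p.β ^ 3 * p.m) * hs + (2 * y 0 * q * p.m + 2 *
      y 0 * q * p.β ^ 2 * p.m - 4 * y 0 * y 2 * q ^ 2 * p.β * p.m) * hq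
  · ring
  · simp

theorem integral_center_zero_y :
    ∫ ν : Metric.sphere (0 : E3) 1, centerJetFlux (p.pertZero (slicePoint (ν : E3))) (p.dPertZero
      (slicePoint (ν : E3))) 1 (ν : E3) ∂sphereMeasure =
      0 := by
  have cq := p.continuous_sphereInv
  refine (integral_sphere_eq
    (F := fun y => centerJetFlux (p.pertZero (slicePoint y)) (p.dPertZero (slicePoint y)) 1 y)
    (A := fun _ => 0)
    (B := fun _ => 0)
    (G := fun c => 0)
    (fun _ _ _ => 0)
    (fun a b c => 2 * b * p.sphereInv c * p.m + 4 * b * p.sphereInv c * p.β ^ 2 * p.m + 2 * b *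
      p.sphereInv c ^ 3 * p.m + 2 * b * p.sphereInv c ^ 3 * p.β ^ 2 * p.m + 2 * b * c *
      p.sphereInv c ^ 2 * p.β * p.m + 4 * b * c * p.sphereInv c ^ 2 * p.β ^ 3 * p.m + 4 * b * c *
      p.sphereInv c ^ 4 * p.β * p.m + 4 * b * c * p.sphereInv c ^ 4 * p.β ^ 3 * p.m)
    (fun _ _ _ => 0)
    (fun y hy => ?_) (by simp) (fun a b c => by ring) (by simp)
    (by fun_prop) (by fun_prop) (by fun_prop) (by fun_prop) (by fun_prop)
    fun c => (hasDerivAt_const c (0 : ℝ)).congr_deriv ?_).trans ?_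
  · have hs := sphere_relation hy
    have hq := p.sphereInv_sq (y 2)
    simp only [centerJetFlux, energyJet]
    simp [Fin.sum_univ_three, dPertZero, dEllZero, dInvRadius, dHeight, dX, dY, ellZero, pertZero,
      invRadius_slicePoint p hy,
      height_slicePoint, slicePoint_one, slicePoint_two]
    generalize p.sphereInv (y 2) = q at *
    linear_combination (4 * y 1 * y 2 * q ^ 2 * p.β * p.m + 4 * y 1 * y 2 ^ 2 * q ^ 3 * p.m + 2 *
      y 1 * y 2 ^ 2 * q ^ 3 * p.β ^ 2 * p.m + 2 * y 1 * y 2 ^ 2 * q ^ 3 * p.γ ^ 2 * p.m + 2 * y 1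
      ^ 3 * q ^ 3 * p.m + 4 * y 1 ^ 3 * y 2 * q ^ 4 * p.β * p.m + 2 * y 0 ^ 2 * y 1 * q ^ 3 * p.m
      + 4 * y 0 ^ 2 * y 1 * y 2 * q ^ 4 * p.β * p.m) * p.γβ + (4 * y 1 * q ^ 3 * p.m + 4 * y 1 * q
      ^ 3 * p.β ^ 2 * p.m + 4 * y 1 * y 2 * q ^ 4 * p.β ^ 3 * p.m) * hs + (2 * y 1 * q * p.m + 2 *
      y 1 * q * p.β ^ 2 * p.m - 4 * y 1 * y 2 * q ^ 2 * p.β * p.m) * hq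
  · ring
  · simp

/-- Parity is not enough along the boost: the even part is nonzero, but it is the derivative of a
multiple of z(1 − z²)q², which vanishes at both poles. -/
theorem integral_center_zero_z :
    ∫ ν : Metric.sphere (0 : E3) 1, centerJetFlux (p.pertZero (slicePoint (ν : E3))) (p.dPertZero
      (slicePoint (ν : E3))) 2 (ν : E3) ∂sphereMeasure =
      0 := by
  have cq := p.continuous_sphereInv
  refine (integral_sphere_eq
    (F := fun y => centerJetFlux (p.pertZero (slicePoint y)) (p.dPertZero (slicePoint y)) 2 y)
    (A := fun c => 2 * p.sphereInv c ^ 2 * p.β * p.m - 4 * p.sphereInv c ^ 4 * p.β * p.m + 2 * c ^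
      2 * p.sphereInv c ^ 2 * p.β * p.m + 4 * c ^ 2 * p.sphereInv c ^ 4 * p.β * p.m)
    (B := fun _ => 0)
    (G := fun c => (-2 * p.β * p.m) * (c * (1 - c ^ 2) * p.sphereInv c ^ 2))
    (fun _ _ _ => 0)
    (fun _ _ _ => 0)
    (fun a b c => 2 * c * p.sphereInv c * p.m + 2 * c * p.sphereInv c ^ 3 * p.m + 2 * c *
      p.sphereInv c ^ 3 * p.β ^ 2 * p.m)
    (fun y hy => ?_) (by simp) (by simp) (fun a b c => by simp only [sphereInv_neg]; ring)
    (by fun_prop) (by fun_prop) (by fun_prop) (by fun_prop) (by fun_prop)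
    fun c => ((p.hasDerivAt_sphereInv_sq c).const_mul (-2 * p.β * p.m)).congr_deriv ?_).trans ?_
  · have hs := sphere_relation hy
    have hq := p.sphereInv_sq (y 2)
    simp only [centerJetFlux, energyJet]
    simp [Fin.sum_univ_three, dPertZero, dEllZero, dInvRadius, dHeight, dX, dY, ellZero, pertZero,
      invRadius_slicePoint p hy,
      height_slicePoint, slicePoint_one, slicePoint_two]
    generalize p.sphereInv (y 2) = q at *
    linear_combination (4 * y 2 ^ 3 * q ^ 3 * p.m + 4 * y 1 ^ 2 * y 2 ^ 2 * q ^ 4 * p.β * p.m + 4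
      * y 0 ^ 2 * y 2 ^ 2 * q ^ 4 * p.β * p.m) * p.γβ + (-2 * q ^ 2 * p.β * p.m + 4 * y 2 * q ^ 3
      * p.m + 2 * y 2 * q ^ 3 * p.β ^ 2 * p.m + 4 * y 2 ^ 2 * q ^ 4 * p.β ^ 3 * p.m) * hs + (4 * q
      ^ 2 * p.β * p.m + 2 * y 2 * q * p.m - 4 * y 2 ^ 2 * q ^ 2 * p.β * p.m) * hq
  · ring
  · have hγ := p.γ_pos
    rw [sphereInv_neg, sphereInv_one]
    field_simp
    ring

theorem integral_angular_zero_x :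
    ∫ ν : Metric.sphere (0 : E3) 1, angularFlux (fun _ => secondFormZero (p.dPertZero (slicePoint
      (ν : E3)))) 0 (ν : E3) ∂sphereMeasure =
      0 := by
  have cq := p.continuous_sphereInv
  refine (integral_sphere_eq
    (F := fun y => angularFlux (fun _ => secondFormZero (p.dPertZero (slicePoint y))) 0 y)
    (A := fun _ => 0)
    (B := fun _ => 0)
    (G := fun c => 0)
    (fun _ _ _ => 0)
    (fun a b c => -2 * b * p.sphereInv c * p.γ * p.β * p.m + b * p.sphereInv c ^ 3 * p.γ * p.β *
      p.m - 2 * b * c * p.sphereInv c ^ 2 * p.γ * p.β ^ 2 * p.m)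
    (fun _ _ _ => 0)
    (fun y hy => ?_) (by simp) (fun a b c => by ring) (by simp)
    (by fun_prop) (by fun_prop) (by fun_prop) (by fun_prop) (by fun_prop)
    fun c => (hasDerivAt_const c (0 : ℝ)).congr_deriv ?_).trans ?_
  · have hs := sphere_relation hy
    have hq := p.sphereInv_sq (y 2)
    simp only [angularFlux, secondFormZero, koszulJet]
    simp [Fin.sum_univ_three, dPertZero, dEllZero, dInvRadius, dHeight, dX, dY, ellZero,
      invRadius_slicePoint p hy,
      height_slicePoint, slicePoint_one, slicePoint_two, momentumDensity, Matrix.trace,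
        rotationField, crossProduct]
    generalize p.sphereInv (y 2) = q at *
    linear_combination (2 * y 1 * y 2 * q ^ 2 * p.γ * p.m - 4 * y 1 * y 2 ^ 3 * q ^ 4 * p.γ * p.β
      ^ 2 * p.m - 4 * y 1 * y 2 ^ 3 * q ^ 4 * p.γ ^ 3 * p.m - 3 * y 1 * y 2 ^ 4 * q ^ 5 * p.γ *
      p.β ^ 3 * p.m - 3 * y 1 * y 2 ^ 4 * q ^ 5 * p.γ ^ 3 * p.β * p.m - 4 * y 1 ^ 3 * y 2 * q ^ 4
      * p.γ * p.m - 3 * y 1 ^ 3 * y 2 ^ 2 * q ^ 5 * p.γ * p.β * p.m - 4 * y 0 ^ 2 * y 1 * y 2 * q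
      ^ 4 * p.γ * p.m - 3 * y 0 ^ 2 * y 1 * y 2 ^ 2 * q ^ 5 * p.γ * p.β * p.m) * p.γβ + (-y 1 * q
      ^ 3 * p.γ * p.β * p.m - 4 * y 1 * y 2 * q ^ 4 * p.γ * p.β ^ 2 * p.m - 3 * y 1 * y 2 ^ 2 * q
      ^ 5 * p.γ * p.β ^ 3 * p.m) * hs + (-2 * y 1 * q * p.γ * p.β * p.m - 4 * y 1 * y 2 * q ^ 2 *
      p.γ * p.β ^ 2 * p.m - 3 * y 1 * y 2 ^ 2 * q ^ 3 * p.γ * p.β ^ 3 * p.m) * hq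
  · ring
  · simp

theorem integral_angular_zero_y :
    ∫ ν : Metric.sphere (0 : E3) 1, angularFlux (fun _ => secondFormZero (p.dPertZero (slicePoint
      (ν : E3)))) 1 (ν : E3) ∂sphereMeasure =
      0 := by
  have cq := p.continuous_sphereInv
  refine (integral_sphere_eq
    (F := fun y => angularFlux (fun _ => secondFormZero (p.dPertZero (slicePoint y))) 1 y)
    (A := fun _ => 0)
    (B := fun _ => 0)
    (G := fun c => 0)
    (fun a b c => 2 * a * p.sphereInv c * p.γ * p.β * p.m - a * p.sphereInv c ^ 3 * p.γ * p.β *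
      p.m + 2 * a * c * p.sphereInv c ^ 2 * p.γ * p.β ^ 2 * p.m)
    (fun _ _ _ => 0)
    (fun _ _ _ => 0)
    (fun y hy => ?_) (fun a b c => by ring) (by simp) (by simp)
    (by fun_prop) (by fun_prop) (by fun_prop) (by fun_prop) (by fun_prop)
    fun c => (hasDerivAt_const c (0 : ℝ)).congr_deriv ?_).trans ?_
  · have hs := sphere_relation hy
    have hq := p.sphereInv_sq (y 2)
    simp only [angularFlux, secondFormZero, koszulJet]
    simp [Fin.sum_univ_three, dPertZero, dEllZero, dInvRadius, dHeight, dX, dY, ellZero,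
      invRadius_slicePoint p hy,
      height_slicePoint, slicePoint_one, slicePoint_two, momentumDensity, Matrix.trace,
        rotationField, crossProduct]
    generalize p.sphereInv (y 2) = q at *
    linear_combination (-2 * y 0 * y 2 * q ^ 2 * p.γ * p.m + 4 * y 0 * y 2 ^ 3 * q ^ 4 * p.γ * p.β
      ^ 2 * p.m + 4 * y 0 * y 2 ^ 3 * q ^ 4 * p.γ ^ 3 * p.m + 3 * y 0 * y 2 ^ 4 * q ^ 5 * p.γ *
      p.β ^ 3 * p.m + 3 * y 0 * y 2 ^ 4 * q ^ 5 * p.γ ^ 3 * p.β * p.m + 4 * y 0 * y 1 ^ 2 * y 2 *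
      q ^ 4 * p.γ * p.m + 3 * y 0 * y 1 ^ 2 * y 2 ^ 2 * q ^ 5 * p.γ * p.β * p.m + 4 * y 0 ^ 3 * y
      2 * q ^ 4 * p.γ * p.m + 3 * y 0 ^ 3 * y 2 ^ 2 * q ^ 5 * p.γ * p.β * p.m) * p.γβ + (y 0 * q ^
      3 * p.γ * p.β * p.m + 4 * y 0 * y 2 * q ^ 4 * p.γ * p.β ^ 2 * p.m + 3 * y 0 * y 2 ^ 2 * q ^
      5 * p.γ * p.β ^ 3 * p.m) * hs + (2 * y 0 * q * p.γ * p.β * p.m + 4 * y 0 * y 2 * q ^ 2 * p.γ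
      * p.β ^ 2 * p.m + 3 * y 0 * y 2 ^ 2 * q ^ 3 * p.γ * p.β ^ 3 * p.m) * hq
  · ring
  · simp

/-- Here the density vanishes pointwise on the sphere: boosted Schwarzschild has no rotation about
its axis of symmetry. -/
theorem integral_angular_zero_z :
    ∫ ν : Metric.sphere (0 : E3) 1, angularFlux (fun _ => secondFormZero (p.dPertZero (slicePoint
      (ν : E3)))) 2 (ν : E3) ∂sphereMeasure =
      0 := by
  have cq := p.continuous_sphereInv
  refine (integral_sphere_eq
    (F := fun y => angularFlux (fun _ => secondFormZero (p.dPertZero (slicePoint y))) 2 y)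
    (A := fun _ => 0)
    (B := fun _ => 0)
    (G := fun c => 0)
    (fun _ _ _ => 0)
    (fun _ _ _ => 0)
    (fun _ _ _ => 0)
    (fun y hy => ?_) (by simp) (by simp) (by simp)
    (by fun_prop) (by fun_prop) (by fun_prop) (by fun_prop) (by fun_prop)
    fun c => (hasDerivAt_const c (0 : ℝ)).congr_deriv ?_).trans ?_
  · have hs := sphere_relation hy
    have hq := p.sphereInv_sq (y 2)
    simp only [angularFlux, secondFormZero, koszulJet]
    simp [Fin.sum_univ_three, dPertZero, dEllZero, dInvRadius, dHeight, dX, dY, ellZero,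
      invRadius_slicePoint p hy,
      height_slicePoint, slicePoint_one, slicePoint_two, momentumDensity, Matrix.trace,
        rotationField, crossProduct]
    generalize p.sphereInv (y 2) = q at *
    ring
  · ring
  · simp

theorem integral_center_one_x :
    ∫ ν : Metric.sphere (0 : E3) 1, centerJetFlux (p.pertOne (slicePoint (ν : E3))) (p.dPertOne
      (slicePoint (ν : E3))) 0 (ν : E3) ∂sphereMeasure =
      0 := by
  have cq := p.continuous_sphereInv
  refine (integral_sphere_eq
    (F := fun y => centerJetFlux (p.pertOne (slicePoint y)) (p.dPertOne (slicePoint y)) 0 y)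
    (A := fun _ => 0)
    (B := fun _ => 0)
    (G := fun c => 0)
    (fun a b c => 4 * a * b * p.sphereInv c ^ 3 * p.β ^ 2 * p.m * p.ζ - 4 * a * b * p.sphereInv c
      ^ 3 * p.γ * p.β * p.m * (p.a * p.s) + 6 * a * b * p.sphereInv c ^ 5 * p.m * p.ζ + 6 * a * b
      * p.sphereInv c ^ 5 * p.β ^ 2 * p.m * p.ζ - 6 * a * b * p.sphereInv c ^ 5 * p.γ * p.β * p.m
      * (p.a * p.s) + 4 * a * b * c * p.sphereInv c ^ 4 * p.β ^ 3 * p.m * p.ζ - 4 * a * b * c *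
      p.sphereInv c ^ 4 * p.γ * p.β ^ 2 * p.m * (p.a * p.s) + 16 * a * b * c * p.sphereInv c ^ 6 *
      p.β * p.m * p.ζ + 16 * a * b * c * p.sphereInv c ^ 6 * p.β ^ 3 * p.m * p.ζ)
    (fun a b c => -2 * b * p.sphereInv c ^ 2 * p.m * (p.a * p.c) - 2 * b * c * p.sphereInv c ^ 3 *
      p.β * p.m * (p.a * p.c))
    (fun _ _ _ => 0)
    (fun y hy => ?_) (fun a b c => by ring) (fun a b c => by ring) (by simp)
    (by fun_prop) (by fun_prop) (by fun_prop) (by fun_prop) (by fun_prop)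
    fun c => (hasDerivAt_const c (0 : ℝ)).congr_deriv ?_).trans ?_
  · have hs := sphere_relation hy
    have hq := p.sphereInv_sq (y 2)
    simp only [centerJetFlux, energyJet]
    simp [Fin.sum_univ_three, dPertOne, dEllZero, dEllOne, dMulSq, dMulCube, dInvRadius, dHeight,
      dX, dY, ellZero, ellOne, pertOne, invRadius_slicePoint p hy,
      height_slicePoint, slicePoint_one, slicePoint_two]
    generalize p.sphereInv (y 2) = q at *
    linear_combination (-2 * y 1 * y 2 ^ 2 * q ^ 4 * p.m * (p.a * p.c) - 2 * y 0 * y 1 * q ^ 3 *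
      p.m * p.ζ + 4 * y 0 * y 1 * y 2 * q ^ 4 * p.β * p.m * p.ζ + 4 * y 0 * y 1 * y 2 * q ^ 4 *
      p.γ * p.m * (p.a * p.s) + 12 * y 0 * y 1 * y 2 ^ 2 * q ^ 5 * p.m * p.ζ + 6 * y 0 * y 1 * y 2
      ^ 2 * q ^ 5 * p.β ^ 2 * p.m * p.ζ - 6 * y 0 * y 1 * y 2 ^ 2 * q ^ 5 * p.γ * p.β * p.m * (p.a
      * p.s) + 6 * y 0 * y 1 * y 2 ^ 2 * q ^ 5 * p.γ ^ 2 * p.m * p.ζ - 8 * y 0 * y 1 * y 2 ^ 3 * q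
      ^ 6 * p.γ * p.β ^ 2 * p.m * (p.a * p.s) - 8 * y 0 * y 1 * y 2 ^ 3 * q ^ 6 * p.γ ^ 3 * p.m *
      (p.a * p.s) + 6 * y 0 * y 1 ^ 3 * q ^ 5 * p.m * p.ζ + 16 * y 0 * y 1 ^ 3 * y 2 * q ^ 6 * p.β
      * p.m * p.ζ - 8 * y 0 * y 1 ^ 3 * y 2 * q ^ 6 * p.γ * p.m * (p.a * p.s) + 6 * y 0 ^ 3 * y 1
      * q ^ 5 * p.m * p.ζ + 16 * y 0 ^ 3 * y 1 * y 2 * q ^ 6 * p.β * p.m * p.ζ - 8 * y 0 ^ 3 * y 1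
      * y 2 * q ^ 6 * p.γ * p.m * (p.a * p.s)) * p.γβ + (-2 * y 1 * q ^ 4 * p.m * (p.a * p.c) + 12
      * y 0 * y 1 * q ^ 5 * p.m * p.ζ + 12 * y 0 * y 1 * q ^ 5 * p.β ^ 2 * p.m * p.ζ - 12 * y 0 *
      y 1 * q ^ 5 * p.γ * p.β * p.m * (p.a * p.s) + 16 * y 0 * y 1 * y 2 * q ^ 6 * p.β ^ 3 * p.m *
      p.ζ - 8 * y 0 * y 1 * y 2 * q ^ 6 * p.γ * p.β ^ 2 * p.m * (p.a * p.s)) * hs + (-2 * y 1 * q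
      ^ 2 * p.m * (p.a * p.c) + 6 * y 0 * y 1 * q ^ 3 * p.m * p.ζ + 6 * y 0 * y 1 * q ^ 3 * p.β ^
      2 * p.m * p.ζ - 6 * y 0 * y 1 * q ^ 3 * p.γ * p.β * p.m * (p.a * p.s) - 16 * y 0 * y 1 * y 2
      * q ^ 4 * p.β * p.m * p.ζ - 8 * y 0 * y 1 * y 2 * q ^ 4 * p.γ * p.β ^ 2 * p.m * (p.a * p.s))
      * hq
  · ring
  · simp

/-- The only displacement of the center: a direct contribution γζ of the translation and a
contribution −β·as of the boosted transverse spin. It is twice the charge because of the factor 1/2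
in the definition. -/
theorem integral_center_one_y :
    ∫ ν : Metric.sphere (0 : E3) 1, centerJetFlux (p.pertOne (slicePoint (ν : E3))) (p.dPertOne
      (slicePoint (ν : E3))) 1 (ν : E3) ∂sphereMeasure =
      16 * Real.pi * p.m * (p.γ * p.ζ - p.β * (p.a * p.s)) := by
  have cq := p.continuous_sphereInv
  refine (integral_sphere_eq
    (F := fun y => centerJetFlux (p.pertOne (slicePoint y)) (p.dPertOne (slicePoint y)) 1 y)
    (A := fun c => 2 * p.sphereInv c * p.m * p.ζ - 2 * c ^ 2 * p.sphereInv c ^ 3 * p.γ * p.β * p.m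
      * (p.a * p.s))
    (B := fun c => 4 * p.sphereInv c ^ 3 * p.β ^ 2 * p.m * p.ζ - 4 * p.sphereInv c ^ 3 * p.γ * p.β
      * p.m * (p.a * p.s) + 6 * p.sphereInv c ^ 5 * p.m * p.ζ + 6 * p.sphereInv c ^ 5 * p.β ^ 2 *
      p.m * p.ζ - 6 * p.sphereInv c ^ 5 * p.γ * p.β * p.m * (p.a * p.s))
    (G := fun c => (-4 * p.γ * p.β * p.m * (p.a * p.s) + 4 * p.γ ^ 2 * p.m * p.ζ) * (c *
      p.sphereInv c) + (-p.γ * p.β * p.m * (p.a * p.s) + p.γ ^ 2 * p.m * p.ζ) * (c * (1 - c ^ 2) *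
      p.sphereInv c ^ 3))
    (fun a b c => 2 * a * p.sphereInv c ^ 2 * p.m * (p.a * p.c) + 2 * a * c * p.sphereInv c ^ 3 *
      p.β * p.m * (p.a * p.c))
    (fun _ _ _ => 0)
    (fun a b c => 2 * c * p.sphereInv c ^ 2 * p.β * p.m * p.ζ - 2 * c * p.sphereInv c ^ 2 * p.γ *
      p.m * (p.a * p.s) + 4 * b ^ 2 * c * p.sphereInv c ^ 4 * p.β ^ 3 * p.m * p.ζ - 4 * b ^ 2 * c
      * p.sphereInv c ^ 4 * p.γ * p.β ^ 2 * p.m * (p.a * p.s) + 16 * b ^ 2 * c * p.sphereInv c ^ 6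
      * p.β * p.m * p.ζ + 16 * b ^ 2 * c * p.sphereInv c ^ 6 * p.β ^ 3 * p.m * p.ζ)
    (fun y hy => ?_) (fun a b c => by ring) (by simp) (fun a b c =>
      by simp only [sphereInv_neg]; ring)
    (by fun_prop) (by fun_prop) (by fun_prop) (by fun_prop) (by fun_prop)
    fun c => (((p.hasDerivAt_mul_sphereInv c).const_mul (-4 * p.γ * p.β * p.m * (p.a * p.s) + 4 *
      p.γ ^ 2 * p.m * p.ζ)).add ((p.hasDerivAt_sphereInv_cube c).const_mul (-p.γ * p.β * p.m *
      (p.a * p.s) + p.γ ^ 2 * p.m * p.ζ))).congr_deriv ?_).trans ?_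
  · have hs := sphere_relation hy
    have hq := p.sphereInv_sq (y 2)
    simp only [centerJetFlux, energyJet]
    simp [Fin.sum_univ_three, dPertOne, dEllZero, dEllOne, dMulSq, dMulCube, dInvRadius, dHeight,
      dX, dY, ellZero, ellOne, pertOne, invRadius_slicePoint p hy,
      height_slicePoint, slicePoint_one, slicePoint_two]
    generalize p.sphereInv (y 2) = q at *
    linear_combination (2 * y 2 ^ 2 * q ^ 3 * p.m * p.ζ - 2 * y 2 ^ 3 * q ^ 4 * p.γ * p.m * (p.a *
      p.s) - 2 * y 1 ^ 2 * q ^ 3 * p.m * p.ζ + 4 * y 1 ^ 2 * y 2 * q ^ 4 * p.β * p.m * p.ζ + 4 * y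
      1 ^ 2 * y 2 * q ^ 4 * p.γ * p.m * (p.a * p.s) + 12 * y 1 ^ 2 * y 2 ^ 2 * q ^ 5 * p.m * p.ζ +
      6 * y 1 ^ 2 * y 2 ^ 2 * q ^ 5 * p.β ^ 2 * p.m * p.ζ - 6 * y 1 ^ 2 * y 2 ^ 2 * q ^ 5 * p.γ *
      p.β * p.m * (p.a * p.s) + 6 * y 1 ^ 2 * y 2 ^ 2 * q ^ 5 * p.γ ^ 2 * p.m * p.ζ - 8 * y 1 ^ 2
      * y 2 ^ 3 * q ^ 6 * p.γ * p.β ^ 2 * p.m * (p.a * p.s) - 8 * y 1 ^ 2 * y 2 ^ 3 * q ^ 6 * p.γ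
      ^ 3 * p.m * (p.a * p.s) + 6 * y 1 ^ 4 * q ^ 5 * p.m * p.ζ + 16 * y 1 ^ 4 * y 2 * q ^ 6 * p.β
      * p.m * p.ζ - 8 * y 1 ^ 4 * y 2 * q ^ 6 * p.γ * p.m * (p.a * p.s) + 2 * y 0 * y 2 ^ 2 * q ^
      4 * p.m * (p.a * p.c) + 6 * y 0 ^ 2 * y 1 ^ 2 * q ^ 5 * p.m * p.ζ + 16 * y 0 ^ 2 * y 1 ^ 2 *
      y 2 * q ^ 6 * p.β * p.m * p.ζ - 8 * y 0 ^ 2 * y 1 ^ 2 * y 2 * q ^ 6 * p.γ * p.m * (p.a *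
      p.s)) * p.γβ + (2 * q ^ 3 * p.m * p.ζ - 2 * y 2 * q ^ 4 * p.γ * p.m * (p.a * p.s) + 12 * y 1
      ^ 2 * q ^ 5 * p.m * p.ζ + 12 * y 1 ^ 2 * q ^ 5 * p.β ^ 2 * p.m * p.ζ - 12 * y 1 ^ 2 * q ^ 5
      * p.γ * p.β * p.m * (p.a * p.s) + 16 * y 1 ^ 2 * y 2 * q ^ 6 * p.β ^ 3 * p.m * p.ζ - 8 * y 1
      ^ 2 * y 2 * q ^ 6 * p.γ * p.β ^ 2 * p.m * (p.a * p.s) + 2 * y 0 * q ^ 4 * p.m * (p.a * p.c))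
      * hs + (2 * q * p.m * p.ζ - 2 * y 2 * q ^ 2 * p.γ * p.m * (p.a * p.s) + 6 * y 1 ^ 2 * q ^ 3
      * p.m * p.ζ + 6 * y 1 ^ 2 * q ^ 3 * p.β ^ 2 * p.m * p.ζ - 6 * y 1 ^ 2 * q ^ 3 * p.γ * p.β *
      p.m * (p.a * p.s) - 16 * y 1 ^ 2 * y 2 * q ^ 4 * p.β * p.m * p.ζ - 8 * y 1 ^ 2 * y 2 * q ^ 4
      * p.γ * p.β ^ 2 * p.m * (p.a * p.s) + 2 * y 0 * q ^ 2 * p.m * (p.a * p.c)) * hq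
  · linear_combination (2 * p.sphereInv c ^ 3 * p.m * p.ζ + 3 * p.sphereInv c ^ 5 * p.m * p.ζ - 3
    * c ^ 2 * p.sphereInv c ^ 5 * p.m * p.ζ) * p.γβ + (2 * p.sphereInv c * p.m * p.ζ) *
    p.sphereInv_sq c
  · have hγ := p.γ_pos
    rw [sphereInv_neg, sphereInv_one]
    field_simp
    ring

theorem integral_center_one_z :
    ∫ ν : Metric.sphere (0 : E3) 1, centerJetFlux (p.pertOne (slicePoint (ν : E3))) (p.dPertOne
      (slicePoint (ν : E3))) 2 (ν : E3) ∂sphereMeasure =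
      0 := by
  have cq := p.continuous_sphereInv
  refine (integral_sphere_eq
    (F := fun y => centerJetFlux (p.pertOne (slicePoint y)) (p.dPertOne (slicePoint y)) 2 y)
    (A := fun _ => 0)
    (B := fun _ => 0)
    (G := fun c => 0)
    (fun _ _ _ => 0)
    (fun a b c => -2 * b * p.sphereInv c ^ 2 * p.β * p.m * p.ζ - 2 * b * p.sphereInv c ^ 2 * p.γ *
      p.m * (p.a * p.s) + 16 * b * p.sphereInv c ^ 4 * p.β * p.m * p.ζ + 4 * b * p.sphereInv c ^ 4
      * p.γ * p.m * (p.a * p.s) - 16 * b * p.sphereInv c ^ 6 * p.β * p.m * p.ζ - 2 * b * c *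
      p.sphereInv c ^ 3 * p.β ^ 2 * p.m * p.ζ - 2 * b * c * p.sphereInv c ^ 3 * p.γ * p.β * p.m *
      (p.a * p.s) + 6 * b * c * p.sphereInv c ^ 5 * p.m * p.ζ + 6 * b * c * p.sphereInv c ^ 5 *
      p.β ^ 2 * p.m * p.ζ - 6 * b * c * p.sphereInv c ^ 5 * p.γ * p.β * p.m * (p.a * p.s) + 16 * b
      * c ^ 2 * p.sphereInv c ^ 6 * p.β * p.m * p.ζ)
    (fun _ _ _ => 0)
    (fun y hy => ?_) (by simp) (fun a b c => by ring) (by simp)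
    (by fun_prop) (by fun_prop) (by fun_prop) (by fun_prop) (by fun_prop)
    fun c => (hasDerivAt_const c (0 : ℝ)).congr_deriv ?_).trans ?_
  · have hs := sphere_relation hy
    have hq := p.sphereInv_sq (y 2)
    simp only [centerJetFlux, energyJet]
    simp [Fin.sum_univ_three, dPertOne, dEllZero, dEllOne, dMulSq, dMulCube, dInvRadius, dHeight,
      dX, dY, ellZero, ellOne, pertOne, invRadius_slicePoint p hy,
      height_slicePoint, slicePoint_one, slicePoint_two]
    generalize p.sphereInv (y 2) = q at *
    linear_combination (-4 * y 1 * y 2 ^ 2 * q ^ 4 * p.β * p.m * p.ζ + 6 * y 1 * y 2 ^ 2 * q ^ 4 *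
      p.γ * p.m * (p.a * p.s) + 12 * y 1 * y 2 ^ 3 * q ^ 5 * p.m * p.ζ - 6 * y 1 * y 2 ^ 3 * q ^ 5
      * p.γ * p.β * p.m * (p.a * p.s) - 8 * y 1 * y 2 ^ 4 * q ^ 6 * p.γ * p.β ^ 2 * p.m * (p.a *
      p.s) - 8 * y 1 * y 2 ^ 4 * q ^ 6 * p.γ ^ 3 * p.m * (p.a * p.s) + 16 * y 1 ^ 3 * y 2 ^ 2 * q
      ^ 6 * p.β * p.m * p.ζ - 8 * y 1 ^ 3 * y 2 ^ 2 * q ^ 6 * p.γ * p.m * (p.a * p.s) + 16 * y 0 ^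
      2 * y 1 * y 2 ^ 2 * q ^ 6 * p.β * p.m * p.ζ - 8 * y 0 ^ 2 * y 1 * y 2 ^ 2 * q ^ 6 * p.γ *
      p.m * (p.a * p.s)) * p.γβ + (-4 * y 1 * q ^ 4 * p.β * p.m * p.ζ + 2 * y 1 * q ^ 4 * p.γ *
      p.m * (p.a * p.s) + 12 * y 1 * y 2 * q ^ 5 * p.m * p.ζ + 6 * y 1 * y 2 * q ^ 5 * p.β ^ 2 *
      p.m * p.ζ - 12 * y 1 * y 2 * q ^ 5 * p.γ * p.β * p.m * (p.a * p.s) + 16 * y 1 * y 2 ^ 2 * q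
      ^ 6 * p.β ^ 3 * p.m * p.ζ - 8 * y 1 * y 2 ^ 2 * q ^ 6 * p.γ * p.β ^ 2 * p.m * (p.a * p.s)) *
      hs + (-4 * y 1 * q ^ 2 * p.β * p.m * p.ζ - 2 * y 1 * q ^ 2 * p.γ * p.m * (p.a * p.s) + 16 *
      y 1 * q ^ 4 * p.β * p.m * p.ζ + 6 * y 1 * y 2 * q ^ 3 * p.m * p.ζ - 6 * y 1 * y 2 * q ^ 3 *
      p.γ * p.β * p.m * (p.a * p.s) - 16 * y 1 * y 2 ^ 2 * q ^ 4 * p.β * p.m * p.ζ - 8 * y 1 * y 2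
      ^ 2 * q ^ 4 * p.γ * p.β ^ 2 * p.m * (p.a * p.s)) * hq
  · ring
  · simp

/-- The terms in `p.m ^ 2`, which come from the products of two perturbations in `secondFormOne`,
all lie in the part odd in y₁. They integrate to zero, and J is linear in the mass. -/
theorem integral_angular_one_x :
    ∫ ν : Metric.sphere (0 : E3) 1, angularFlux (fun _ => secondFormOne (p.pertZero (slicePoint (ν
      : E3))) (p.dPertZero (slicePoint (ν : E3))) (p.dPertOne (slicePoint (ν : E3)))) 0 (ν : E3)
      ∂sphereMeasure =
      8 * Real.pi * p.m * (p.γ * (p.a * p.s) - p.β * p.ζ) := by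
  have cq := p.continuous_sphereInv
  refine (integral_sphere_eq
    (F := fun y => angularFlux (fun _ => secondFormOne (p.pertZero (slicePoint y)) (p.dPertZero
      (slicePoint y)) (p.dPertOne (slicePoint y))) 0 y)
    (A := fun c => 2 * p.sphereInv c * p.m * (p.a * p.s) + p.sphereInv c ^ 3 * p.m * (p.a * p.s) -
      3 * p.sphereInv c ^ 5 * p.m * (p.a * p.s) - 4 * c ^ 2 * p.sphereInv c ^ 3 * p.γ * p.β * p.m
      * p.ζ + 3 * c ^ 2 * p.sphereInv c ^ 5 * p.m * (p.a * p.s))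
    (B := fun c => 4 * p.sphereInv c ^ 3 * p.β ^ 2 * p.m * (p.a * p.s) - 8 * p.sphereInv c ^ 3 *
      p.γ * p.β * p.m * p.ζ + 3 * p.sphereInv c ^ 5 * p.m * (p.a * p.s) + 6 * p.sphereInv c ^ 5 *
      p.γ * p.β * p.m * p.ζ)
    (G := fun c => (-2 * p.γ * p.β * p.m * p.ζ + 2 * p.γ ^ 2 * p.m * (p.a * p.s)) * (c *
      p.sphereInv c) + (-(1/2) * p.m * (p.a * p.s) + p.γ * p.β * p.m * p.ζ) * (c * (1 - c ^ 2) *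
      p.sphereInv c ^ 3))
    (fun a b c => -3 * a * c * p.sphereInv c ^ 5 * p.γ * p.m * (p.a * p.c))
    (fun a b c => 8 * b * p.sphereInv c ^ 2 * p.γ * p.β ^ 3 * p.m ^ 2 - 2 * b * p.sphereInv c ^ 4
      * p.γ * p.β * p.m ^ 2 - 8 * b * p.sphereInv c ^ 4 * p.γ * p.β ^ 3 * p.m ^ 2 + b *
      p.sphereInv c ^ 6 * p.γ * p.β * p.m ^ 2 + b * p.sphereInv c ^ 6 * p.γ * p.β ^ 3 * p.m ^ 2 +
      8 * b * c * p.sphereInv c ^ 3 * p.γ * p.β ^ 4 * p.m ^ 2 - 2 * b * c * p.sphereInv c ^ 5 *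
      p.γ * p.β ^ 2 * p.m ^ 2 - 4 * b * c * p.sphereInv c ^ 5 * p.γ * p.β ^ 4 * p.m ^ 2)
    (fun a b c => 2 * c * p.sphereInv c ^ 2 * p.β * p.m * (p.a * p.s) - 4 * c * p.sphereInv c ^ 2
      * p.γ * p.m * p.ζ + 4 * b ^ 2 * c * p.sphereInv c ^ 4 * p.β ^ 3 * p.m * (p.a * p.s) - 8 * b
      ^ 2 * c * p.sphereInv c ^ 4 * p.γ * p.β ^ 2 * p.m * p.ζ)
    (fun y hy => ?_) (fun a b c => by ring) (fun a b c => by ring) (fun a b c =>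
      by simp only [sphereInv_neg]; ring)
    (by fun_prop) (by fun_prop) (by fun_prop) (by fun_prop) (by fun_prop)
    fun c => (((p.hasDerivAt_mul_sphereInv c).const_mul (-2 * p.γ * p.β * p.m * p.ζ + 2 * p.γ ^ 2
      * p.m * (p.a * p.s))).add ((p.hasDerivAt_sphereInv_cube c).const_mul (-(1/2) * p.m * (p.a *
      p.s) + p.γ * p.β * p.m * p.ζ))).congr_deriv ?_).trans ?_
  · have hs := sphere_relation hy
    have hq := p.sphereInv_sq (y 2)
    simp only [angularFlux, secondFormOne, koszulJet]
    simp [Fin.sum_univ_three, dPertZero, dPertOne, dEllZero, dEllOne, dMulSq, dMulCube,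
      dInvRadius, dHeight, dX, dY, ellZero, ellOne, pertZero, invRadius_slicePoint p hy,
      height_slicePoint, slicePoint_one, slicePoint_two, momentumDensity, Matrix.trace,
        rotationField, crossProduct]
    generalize p.sphereInv (y 2) = q at *
    linear_combination (2 * y 2 ^ 3 * q ^ 4 * p.β * p.m * (p.a * p.s) - 4 * y 2 ^ 3 * q ^ 4 * p.γ
      * p.m * p.ζ + 3 * y 2 ^ 4 * q ^ 5 * p.m * (p.a * p.s) - 3 * y 2 ^ 4 * q ^ 5 * p.γ * p.β *
      p.m * p.ζ + 3 * y 2 ^ 4 * q ^ 5 * p.γ ^ 2 * p.m * (p.a * p.s) - 2 * y 1 * y 2 * q ^ 3 * p.γ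
      * p.β ^ 2 * p.m ^ 2 + 2 * y 1 * y 2 * q ^ 3 * p.γ ^ 3 * p.m ^ 2 - y 1 * y 2 ^ 2 * q ^ 4 *
      p.γ * p.β * p.m ^ 2 - 5 * y 1 * y 2 ^ 2 * q ^ 4 * p.γ * p.β ^ 3 * p.m ^ 2 - 4 * y 1 * y 2 ^
      2 * q ^ 4 * p.γ ^ 3 * p.β * p.m ^ 2 - 10 * y 1 * y 2 ^ 3 * q ^ 5 * p.γ * p.β ^ 2 * p.m ^ 2 -
      4 * y 1 * y 2 ^ 3 * q ^ 5 * p.γ ^ 3 * p.β ^ 2 * p.m ^ 2 - 8 * y 1 * y 2 ^ 3 * q ^ 5 * p.γ ^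
      5 * p.m ^ 2 - 2 * y 1 * y 2 ^ 4 * q ^ 6 * p.γ * p.β ^ 3 * p.m ^ 2 + 10 * y 1 * y 2 ^ 4 * q ^
      6 * p.γ * p.β ^ 5 * p.m ^ 2 + 9 * y 1 * y 2 ^ 4 * q ^ 6 * p.γ ^ 3 * p.β ^ 3 * p.m ^ 2 - y 1
      * y 2 ^ 4 * q ^ 6 * p.γ ^ 5 * p.β * p.m ^ 2 + 6 * y 1 * y 2 ^ 5 * q ^ 7 * p.γ * p.β ^ 2 *
      p.m ^ 2 + 16 * y 1 * y 2 ^ 5 * q ^ 7 * p.γ * p.β ^ 4 * p.m ^ 2 + 10 * y 1 * y 2 ^ 5 * q ^ 7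
      * p.γ * p.β ^ 6 * p.m ^ 2 + 6 * y 1 * y 2 ^ 5 * q ^ 7 * p.γ ^ 3 * p.β ^ 2 * p.m ^ 2 + 10 * y
      1 * y 2 ^ 5 * q ^ 7 * p.γ ^ 3 * p.β ^ 4 * p.m ^ 2 + 10 * y 1 * y 2 ^ 5 * q ^ 7 * p.γ ^ 5 *
      p.β ^ 2 * p.m ^ 2 + 6 * y 1 * y 2 ^ 5 * q ^ 7 * p.γ ^ 7 * p.m ^ 2 + 6 * y 1 * y 2 ^ 6 * q ^
      8 * p.γ * p.β ^ 3 * p.m ^ 2 + 9 * y 1 * y 2 ^ 6 * q ^ 8 * p.γ * p.β ^ 5 * p.m ^ 2 + 3 * y 1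
      * y 2 ^ 6 * q ^ 8 * p.γ * p.β ^ 7 * p.m ^ 2 + 6 * y 1 * y 2 ^ 6 * q ^ 8 * p.γ ^ 3 * p.β ^ 3
      * p.m ^ 2 + 3 * y 1 * y 2 ^ 6 * q ^ 8 * p.γ ^ 3 * p.β ^ 5 * p.m ^ 2 + 3 * y 1 * y 2 ^ 6 * q
      ^ 8 * p.γ ^ 5 * p.β ^ 3 * p.m ^ 2 + 6 * y 1 * y 2 ^ 6 * q ^ 8 * p.γ ^ 7 * p.β * p.m ^ 2 - 4
      * y 1 ^ 2 * y 2 * q ^ 4 * p.β * p.m * (p.a * p.s) + 8 * y 1 ^ 2 * y 2 * q ^ 4 * p.γ * p.m *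
      p.ζ + 6 * y 1 ^ 2 * y 2 ^ 2 * q ^ 5 * p.m * (p.a * p.s) + 6 * y 1 ^ 2 * y 2 ^ 2 * q ^ 5 *
      p.β ^ 2 * p.m * (p.a * p.s) + 3 * y 1 ^ 2 * y 2 ^ 2 * q ^ 5 * p.γ * p.β * p.m * p.ζ + 3 * y
      1 ^ 2 * y 2 ^ 2 * q ^ 5 * p.γ ^ 2 * p.m * (p.a * p.s) + 8 * y 1 ^ 2 * y 2 ^ 3 * q ^ 6 * p.β
      ^ 3 * p.m * (p.a * p.s) - 16 * y 1 ^ 2 * y 2 ^ 3 * q ^ 6 * p.γ * p.β ^ 2 * p.m * p.ζ + 8 * y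
      1 ^ 2 * y 2 ^ 3 * q ^ 6 * p.γ ^ 2 * p.β * p.m * (p.a * p.s) - 16 * y 1 ^ 2 * y 2 ^ 3 * q ^ 6
      * p.γ ^ 3 * p.m * p.ζ - 15 * y 1 ^ 2 * y 2 ^ 4 * q ^ 7 * p.γ * p.β ^ 3 * p.m * p.ζ - 15 * y
      1 ^ 2 * y 2 ^ 4 * q ^ 7 * p.γ ^ 3 * p.β * p.m * p.ζ - y 1 ^ 3 * q ^ 4 * p.γ * p.β * p.m ^ 2
      - 4 * y 1 ^ 3 * y 2 * q ^ 5 * p.γ * p.m ^ 2 + 4 * y 1 ^ 3 * y 2 * q ^ 5 * p.γ * p.β ^ 2 *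
      p.m ^ 2 - 4 * y 1 ^ 3 * y 2 * q ^ 5 * p.γ ^ 3 * p.m ^ 2 - 4 * y 1 ^ 3 * y 2 ^ 2 * q ^ 6 *
      p.γ * p.β * p.m ^ 2 + 12 * y 1 ^ 3 * y 2 ^ 2 * q ^ 6 * p.γ * p.β ^ 3 * p.m ^ 2 + 3 * y 1 ^ 3
      * y 2 ^ 2 * q ^ 6 * p.γ ^ 3 * p.β * p.m ^ 2 + 12 * y 1 ^ 3 * y 2 ^ 3 * q ^ 7 * p.γ * p.β ^ 2
      * p.m ^ 2 + 10 * y 1 ^ 3 * y 2 ^ 3 * q ^ 7 * p.γ * p.β ^ 4 * p.m ^ 2 + 6 * y 1 ^ 3 * y 2 ^ 3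
      * q ^ 7 * p.γ ^ 3 * p.m ^ 2 + 10 * y 1 ^ 3 * y 2 ^ 3 * q ^ 7 * p.γ ^ 3 * p.β ^ 2 * p.m ^ 2 +
      6 * y 1 ^ 3 * y 2 ^ 3 * q ^ 7 * p.γ ^ 5 * p.m ^ 2 + 12 * y 1 ^ 3 * y 2 ^ 4 * q ^ 8 * p.γ *
      p.β ^ 3 * p.m ^ 2 + 3 * y 1 ^ 3 * y 2 ^ 4 * q ^ 8 * p.γ * p.β ^ 5 * p.m ^ 2 + 6 * y 1 ^ 3 *
      y 2 ^ 4 * q ^ 8 * p.γ ^ 3 * p.β * p.m ^ 2 + 3 * y 1 ^ 3 * y 2 ^ 4 * q ^ 8 * p.γ ^ 3 * p.β ^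
      3 * p.m ^ 2 + 6 * y 1 ^ 3 * y 2 ^ 4 * q ^ 8 * p.γ ^ 5 * p.β * p.m ^ 2 + 3 * y 1 ^ 4 * q ^ 5
      * p.m * (p.a * p.s) + 8 * y 1 ^ 4 * y 2 * q ^ 6 * p.β * p.m * (p.a * p.s) - 16 * y 1 ^ 4 * y
      2 * q ^ 6 * p.γ * p.m * p.ζ - 15 * y 1 ^ 4 * y 2 ^ 2 * q ^ 7 * p.γ * p.β * p.m * p.ζ + 6 * y
      1 ^ 5 * y 2 * q ^ 7 * p.γ * p.m ^ 2 + 6 * y 1 ^ 5 * y 2 ^ 2 * q ^ 8 * p.γ * p.β * p.m ^ 2 -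
      3 * y 0 * y 2 ^ 3 * q ^ 5 * p.γ * p.m * (p.a * p.c) + 3 * y 0 ^ 2 * y 2 ^ 2 * q ^ 5 * p.m *
      (p.a * p.s) - y 0 ^ 2 * y 1 * q ^ 4 * p.γ * p.β * p.m ^ 2 - 4 * y 0 ^ 2 * y 1 * y 2 * q ^ 5
      * p.γ * p.m ^ 2 + 4 * y 0 ^ 2 * y 1 * y 2 * q ^ 5 * p.γ * p.β ^ 2 * p.m ^ 2 - 4 * y 0 ^ 2 *
      y 1 * y 2 * q ^ 5 * p.γ ^ 3 * p.m ^ 2 - 4 * y 0 ^ 2 * y 1 * y 2 ^ 2 * q ^ 6 * p.γ * p.β *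
      p.m ^ 2 + 12 * y 0 ^ 2 * y 1 * y 2 ^ 2 * q ^ 6 * p.γ * p.β ^ 3 * p.m ^ 2 + 3 * y 0 ^ 2 * y 1
      * y 2 ^ 2 * q ^ 6 * p.γ ^ 3 * p.β * p.m ^ 2 + 12 * y 0 ^ 2 * y 1 * y 2 ^ 3 * q ^ 7 * p.γ *
      p.β ^ 2 * p.m ^ 2 + 10 * y 0 ^ 2 * y 1 * y 2 ^ 3 * q ^ 7 * p.γ * p.β ^ 4 * p.m ^ 2 + 6 * y 0
      ^ 2 * y 1 * y 2 ^ 3 * q ^ 7 * p.γ ^ 3 * p.m ^ 2 + 10 * y 0 ^ 2 * y 1 * y 2 ^ 3 * q ^ 7 * p.γ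
      ^ 3 * p.β ^ 2 * p.m ^ 2 + 6 * y 0 ^ 2 * y 1 * y 2 ^ 3 * q ^ 7 * p.γ ^ 5 * p.m ^ 2 + 12 * y 0
      ^ 2 * y 1 * y 2 ^ 4 * q ^ 8 * p.γ * p.β ^ 3 * p.m ^ 2 + 3 * y 0 ^ 2 * y 1 * y 2 ^ 4 * q ^ 8
      * p.γ * p.β ^ 5 * p.m ^ 2 + 6 * y 0 ^ 2 * y 1 * y 2 ^ 4 * q ^ 8 * p.γ ^ 3 * p.β * p.m ^ 2 +
      3 * y 0 ^ 2 * y 1 * y 2 ^ 4 * q ^ 8 * p.γ ^ 3 * p.β ^ 3 * p.m ^ 2 + 6 * y 0 ^ 2 * y 1 * y 2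
      ^ 4 * q ^ 8 * p.γ ^ 5 * p.β * p.m ^ 2 + 3 * y 0 ^ 2 * y 1 ^ 2 * q ^ 5 * p.m * (p.a * p.s) +
      8 * y 0 ^ 2 * y 1 ^ 2 * y 2 * q ^ 6 * p.β * p.m * (p.a * p.s) - 16 * y 0 ^ 2 * y 1 ^ 2 * y 2
      * q ^ 6 * p.γ * p.m * p.ζ - 15 * y 0 ^ 2 * y 1 ^ 2 * y 2 ^ 2 * q ^ 7 * p.γ * p.β * p.m * p.ζ
      + 12 * y 0 ^ 2 * y 1 ^ 3 * y 2 * q ^ 7 * p.γ * p.m ^ 2 + 12 * y 0 ^ 2 * y 1 ^ 3 * y 2 ^ 2 *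
      q ^ 8 * p.γ * p.β * p.m ^ 2 + 6 * y 0 ^ 4 * y 1 * y 2 * q ^ 7 * p.γ * p.m ^ 2 + 6 * y 0 ^ 4
      * y 1 * y 2 ^ 2 * q ^ 8 * p.γ * p.β * p.m ^ 2) * p.γβ + (2 * y 2 * q ^ 4 * p.β * p.m * (p.a
      * p.s) - 4 * y 2 * q ^ 4 * p.γ * p.m * p.ζ + 3 * y 2 ^ 2 * q ^ 5 * p.m * (p.a * p.s) + 3 * y
      2 ^ 2 * q ^ 5 * p.β ^ 2 * p.m * (p.a * p.s) - 3 * y 2 ^ 2 * q ^ 5 * p.γ * p.β * p.m * p.ζ -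
      y 1 * q ^ 4 * p.γ * p.β * p.m ^ 2 + y 1 * q ^ 4 * p.γ * p.β ^ 3 * p.m ^ 2 - 10 * y 1 * y 2 *
      q ^ 5 * p.γ * p.β ^ 2 * p.m ^ 2 + 6 * y 1 * y 2 * q ^ 5 * p.γ * p.β ^ 4 * p.m ^ 2 + 6 * y 1
      * y 2 * q ^ 7 * p.γ * p.β ^ 2 * p.m ^ 2 - 2 * y 1 * y 2 ^ 2 * q ^ 6 * p.γ * p.β ^ 3 * p.m ^
      2 + 12 * y 1 * y 2 ^ 2 * q ^ 6 * p.γ * p.β ^ 5 * p.m ^ 2 + 6 * y 1 * y 2 ^ 2 * q ^ 8 * p.γ *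
      p.β ^ 3 * p.m ^ 2 + 6 * y 1 * y 2 ^ 3 * q ^ 7 * p.γ * p.β ^ 2 * p.m ^ 2 + 22 * y 1 * y 2 ^ 3
      * q ^ 7 * p.γ * p.β ^ 4 * p.m ^ 2 + 10 * y 1 * y 2 ^ 3 * q ^ 7 * p.γ * p.β ^ 6 * p.m ^ 2 + 6
      * y 1 * y 2 ^ 4 * q ^ 8 * p.γ * p.β ^ 3 * p.m ^ 2 + 15 * y 1 * y 2 ^ 4 * q ^ 8 * p.γ * p.β ^
      5 * p.m ^ 2 + 3 * y 1 * y 2 ^ 4 * q ^ 8 * p.γ * p.β ^ 7 * p.m ^ 2 + 3 * y 1 ^ 2 * q ^ 5 *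
      p.m * (p.a * p.s) + 6 * y 1 ^ 2 * q ^ 5 * p.β ^ 2 * p.m * (p.a * p.s) - 3 * y 1 ^ 2 * q ^ 5
      * p.γ * p.β * p.m * p.ζ + 8 * y 1 ^ 2 * y 2 * q ^ 6 * p.β ^ 3 * p.m * (p.a * p.s) - 16 * y 1
      ^ 2 * y 2 * q ^ 6 * p.γ * p.β ^ 2 * p.m * p.ζ - 15 * y 1 ^ 2 * y 2 ^ 2 * q ^ 7 * p.γ * p.β ^
      3 * p.m * p.ζ + 6 * y 1 ^ 3 * y 2 * q ^ 7 * p.γ * p.β ^ 2 * p.m ^ 2 + 6 * y 1 ^ 3 * y 2 ^ 2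
      * q ^ 8 * p.γ * p.β ^ 3 * p.m ^ 2 - 3 * y 0 * y 2 * q ^ 5 * p.γ * p.m * (p.a * p.c) + 6 * y
      0 ^ 2 * y 1 * y 2 * q ^ 7 * p.γ * p.β ^ 2 * p.m ^ 2 + 6 * y 0 ^ 2 * y 1 * y 2 ^ 2 * q ^ 8 *
      p.γ * p.β ^ 3 * p.m ^ 2) * hs + (2 * q * p.m * (p.a * p.s) + 3 * q ^ 3 * p.m * (p.a * p.s) +
      2 * y 2 * q ^ 2 * p.β * p.m * (p.a * p.s) - 4 * y 2 * q ^ 2 * p.γ * p.m * p.ζ - 3 * y 2 ^ 2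
      * q ^ 3 * p.γ * p.β * p.m * p.ζ + 8 * y 1 * q ^ 2 * p.γ * p.β ^ 3 * p.m ^ 2 - y 1 * q ^ 4 *
      p.γ * p.β * p.m ^ 2 - y 1 * q ^ 4 * p.γ * p.β ^ 3 * p.m ^ 2 - 2 * y 1 * y 2 * q ^ 3 * p.γ *
      p.β ^ 2 * p.m ^ 2 + 10 * y 1 * y 2 * q ^ 3 * p.γ * p.β ^ 4 * p.m ^ 2 + 6 * y 1 * y 2 * q ^ 5
      * p.γ * p.β ^ 2 * p.m ^ 2 + 5 * y 1 * y 2 ^ 2 * q ^ 4 * p.γ * p.β ^ 3 * p.m ^ 2 + 13 * y 1 *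
      y 2 ^ 2 * q ^ 4 * p.γ * p.β ^ 5 * p.m ^ 2 + 6 * y 1 * y 2 ^ 2 * q ^ 6 * p.γ * p.β ^ 3 * p.m
      ^ 2 + 16 * y 1 * y 2 ^ 3 * q ^ 5 * p.γ * p.β ^ 4 * p.m ^ 2 + 10 * y 1 * y 2 ^ 3 * q ^ 5 *
      p.γ * p.β ^ 6 * p.m ^ 2 + 9 * y 1 * y 2 ^ 4 * q ^ 6 * p.γ * p.β ^ 5 * p.m ^ 2 + 3 * y 1 * y
      2 ^ 4 * q ^ 6 * p.γ * p.β ^ 7 * p.m ^ 2 + 6 * y 1 ^ 2 * q ^ 3 * p.β ^ 2 * p.m * (p.a * p.s)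
      - 9 * y 1 ^ 2 * q ^ 3 * p.γ * p.β * p.m * p.ζ + 8 * y 1 ^ 2 * y 2 * q ^ 4 * p.β ^ 3 * p.m *
      (p.a * p.s) - 16 * y 1 ^ 2 * y 2 * q ^ 4 * p.γ * p.β ^ 2 * p.m * p.ζ - 15 * y 1 ^ 2 * y 2 ^
      2 * q ^ 5 * p.γ * p.β ^ 3 * p.m * p.ζ) * hq
  · linear_combination (2 * p.sphereInv c ^ 3 * p.m * (p.a * p.s)) * p.γβ + (2 * p.sphereInv c *
    p.m * (p.a * p.s)) * p.sphereInv_sq c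
  · have hγ := p.γ_pos
    rw [sphereInv_neg, sphereInv_one]
    field_simp
    ring

/-- Here the quadratic terms are odd in y₀, and so is everything else except the term in ac, which
is odd in y₁. -/
theorem integral_angular_one_y :
    ∫ ν : Metric.sphere (0 : E3) 1, angularFlux (fun _ => secondFormOne (p.pertZero (slicePoint (ν
      : E3))) (p.dPertZero (slicePoint (ν : E3))) (p.dPertOne (slicePoint (ν : E3)))) 1 (ν : E3)
      ∂sphereMeasure =
      0 := by
  have cq := p.continuous_sphereInv
  refine (integral_sphere_eq
    (F := fun y => angularFlux (fun _ => secondFormOne (p.pertZero (slicePoint y)) (p.dPertZero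
      (slicePoint y)) (p.dPertOne (slicePoint y))) 1 y)
    (A := fun _ => 0)
    (B := fun _ => 0)
    (G := fun c => 0)
    (fun a b c => -8 * a * p.sphereInv c ^ 2 * p.γ * p.β ^ 3 * p.m ^ 2 + 2 * a * p.sphereInv c ^ 4
      * p.γ * p.β * p.m ^ 2 + 8 * a * p.sphereInv c ^ 4 * p.γ * p.β ^ 3 * p.m ^ 2 - a *
      p.sphereInv c ^ 6 * p.γ * p.β * p.m ^ 2 - a * p.sphereInv c ^ 6 * p.γ * p.β ^ 3 * p.m ^ 2 -
      8 * a * c * p.sphereInv c ^ 3 * p.γ * p.β ^ 4 * p.m ^ 2 + 2 * a * c * p.sphereInv c ^ 5 *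
      p.γ * p.β ^ 2 * p.m ^ 2 + 4 * a * c * p.sphereInv c ^ 5 * p.γ * p.β ^ 4 * p.m ^ 2 - 4 * a *
      b * p.sphereInv c ^ 3 * p.β ^ 2 * p.m * (p.a * p.s) + 8 * a * b * p.sphereInv c ^ 3 * p.γ *
      p.β * p.m * p.ζ - 3 * a * b * p.sphereInv c ^ 5 * p.m * (p.a * p.s) - 6 * a * b *
      p.sphereInv c ^ 5 * p.γ * p.β * p.m * p.ζ - 4 * a * b * c * p.sphereInv c ^ 4 * p.β ^ 3 *
      p.m * (p.a * p.s) + 8 * a * b * c * p.sphereInv c ^ 4 * p.γ * p.β ^ 2 * p.m * p.ζ)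
    (fun a b c => -3 * b * c * p.sphereInv c ^ 5 * p.γ * p.m * (p.a * p.c))
    (fun _ _ _ => 0)
    (fun y hy => ?_) (fun a b c => by ring) (fun a b c => by ring) (by simp)
    (by fun_prop) (by fun_prop) (by fun_prop) (by fun_prop) (by fun_prop)
    fun c => (hasDerivAt_const c (0 : ℝ)).congr_deriv ?_).trans ?_
  · have hs := sphere_relation hy
    have hq := p.sphereInv_sq (y 2)
    simp only [angularFlux, secondFormOne, koszulJet]
    simp [Fin.sum_univ_three, dPertZero, dPertOne, dEllZero, dEllOne, dMulSq, dMulCube,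
      dInvRadius, dHeight, dX, dY, ellZero, ellOne, pertZero, invRadius_slicePoint p hy,
      height_slicePoint, slicePoint_one, slicePoint_two, momentumDensity, Matrix.trace,
        rotationField, crossProduct]
    generalize p.sphereInv (y 2) = q at *
    linear_combination (-3 * y 1 * y 2 ^ 3 * q ^ 5 * p.γ * p.m * (p.a * p.c) + 2 * y 0 * y 2 * q ^
      3 * p.γ * p.β ^ 2 * p.m ^ 2 - 2 * y 0 * y 2 * q ^ 3 * p.γ ^ 3 * p.m ^ 2 + y 0 * y 2 ^ 2 * q
      ^ 4 * p.γ * p.β * p.m ^ 2 + 5 * y 0 * y 2 ^ 2 * q ^ 4 * p.γ * p.β ^ 3 * p.m ^ 2 + 4 * y 0 *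
      y 2 ^ 2 * q ^ 4 * p.γ ^ 3 * p.β * p.m ^ 2 + 10 * y 0 * y 2 ^ 3 * q ^ 5 * p.γ * p.β ^ 2 * p.m
      ^ 2 + 4 * y 0 * y 2 ^ 3 * q ^ 5 * p.γ ^ 3 * p.β ^ 2 * p.m ^ 2 + 8 * y 0 * y 2 ^ 3 * q ^ 5 *
      p.γ ^ 5 * p.m ^ 2 + 2 * y 0 * y 2 ^ 4 * q ^ 6 * p.γ * p.β ^ 3 * p.m ^ 2 - 10 * y 0 * y 2 ^ 4
      * q ^ 6 * p.γ * p.β ^ 5 * p.m ^ 2 - 9 * y 0 * y 2 ^ 4 * q ^ 6 * p.γ ^ 3 * p.β ^ 3 * p.m ^ 2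
      + y 0 * y 2 ^ 4 * q ^ 6 * p.γ ^ 5 * p.β * p.m ^ 2 - 6 * y 0 * y 2 ^ 5 * q ^ 7 * p.γ * p.β ^
      2 * p.m ^ 2 - 16 * y 0 * y 2 ^ 5 * q ^ 7 * p.γ * p.β ^ 4 * p.m ^ 2 - 10 * y 0 * y 2 ^ 5 * q
      ^ 7 * p.γ * p.β ^ 6 * p.m ^ 2 - 6 * y 0 * y 2 ^ 5 * q ^ 7 * p.γ ^ 3 * p.β ^ 2 * p.m ^ 2 - 10
      * y 0 * y 2 ^ 5 * q ^ 7 * p.γ ^ 3 * p.β ^ 4 * p.m ^ 2 - 10 * y 0 * y 2 ^ 5 * q ^ 7 * p.γ ^ 5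
      * p.β ^ 2 * p.m ^ 2 - 6 * y 0 * y 2 ^ 5 * q ^ 7 * p.γ ^ 7 * p.m ^ 2 - 6 * y 0 * y 2 ^ 6 * q
      ^ 8 * p.γ * p.β ^ 3 * p.m ^ 2 - 9 * y 0 * y 2 ^ 6 * q ^ 8 * p.γ * p.β ^ 5 * p.m ^ 2 - 3 * y
      0 * y 2 ^ 6 * q ^ 8 * p.γ * p.β ^ 7 * p.m ^ 2 - 6 * y 0 * y 2 ^ 6 * q ^ 8 * p.γ ^ 3 * p.β ^
      3 * p.m ^ 2 - 3 * y 0 * y 2 ^ 6 * q ^ 8 * p.γ ^ 3 * p.β ^ 5 * p.m ^ 2 - 3 * y 0 * y 2 ^ 6 *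
      q ^ 8 * p.γ ^ 5 * p.β ^ 3 * p.m ^ 2 - 6 * y 0 * y 2 ^ 6 * q ^ 8 * p.γ ^ 7 * p.β * p.m ^ 2 +
      4 * y 0 * y 1 * y 2 * q ^ 4 * p.β * p.m * (p.a * p.s) - 8 * y 0 * y 1 * y 2 * q ^ 4 * p.γ *
      p.m * p.ζ - 3 * y 0 * y 1 * y 2 ^ 2 * q ^ 5 * p.m * (p.a * p.s) - 6 * y 0 * y 1 * y 2 ^ 2 *
      q ^ 5 * p.β ^ 2 * p.m * (p.a * p.s) - 3 * y 0 * y 1 * y 2 ^ 2 * q ^ 5 * p.γ * p.β * p.m *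
      p.ζ - 3 * y 0 * y 1 * y 2 ^ 2 * q ^ 5 * p.γ ^ 2 * p.m * (p.a * p.s) - 8 * y 0 * y 1 * y 2 ^
      3 * q ^ 6 * p.β ^ 3 * p.m * (p.a * p.s) + 16 * y 0 * y 1 * y 2 ^ 3 * q ^ 6 * p.γ * p.β ^ 2 *
      p.m * p.ζ - 8 * y 0 * y 1 * y 2 ^ 3 * q ^ 6 * p.γ ^ 2 * p.β * p.m * (p.a * p.s) + 16 * y 0 *
      y 1 * y 2 ^ 3 * q ^ 6 * p.γ ^ 3 * p.m * p.ζ + 15 * y 0 * y 1 * y 2 ^ 4 * q ^ 7 * p.γ * p.β ^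
      3 * p.m * p.ζ + 15 * y 0 * y 1 * y 2 ^ 4 * q ^ 7 * p.γ ^ 3 * p.β * p.m * p.ζ + y 0 * y 1 ^ 2
      * q ^ 4 * p.γ * p.β * p.m ^ 2 + 4 * y 0 * y 1 ^ 2 * y 2 * q ^ 5 * p.γ * p.m ^ 2 - 4 * y 0 *
      y 1 ^ 2 * y 2 * q ^ 5 * p.γ * p.β ^ 2 * p.m ^ 2 + 4 * y 0 * y 1 ^ 2 * y 2 * q ^ 5 * p.γ ^ 3
      * p.m ^ 2 + 4 * y 0 * y 1 ^ 2 * y 2 ^ 2 * q ^ 6 * p.γ * p.β * p.m ^ 2 - 12 * y 0 * y 1 ^ 2 *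
      y 2 ^ 2 * q ^ 6 * p.γ * p.β ^ 3 * p.m ^ 2 - 3 * y 0 * y 1 ^ 2 * y 2 ^ 2 * q ^ 6 * p.γ ^ 3 *
      p.β * p.m ^ 2 - 12 * y 0 * y 1 ^ 2 * y 2 ^ 3 * q ^ 7 * p.γ * p.β ^ 2 * p.m ^ 2 - 10 * y 0 *
      y 1 ^ 2 * y 2 ^ 3 * q ^ 7 * p.γ * p.β ^ 4 * p.m ^ 2 - 6 * y 0 * y 1 ^ 2 * y 2 ^ 3 * q ^ 7 *
      p.γ ^ 3 * p.m ^ 2 - 10 * y 0 * y 1 ^ 2 * y 2 ^ 3 * q ^ 7 * p.γ ^ 3 * p.β ^ 2 * p.m ^ 2 - 6 *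
      y 0 * y 1 ^ 2 * y 2 ^ 3 * q ^ 7 * p.γ ^ 5 * p.m ^ 2 - 12 * y 0 * y 1 ^ 2 * y 2 ^ 4 * q ^ 8 *
      p.γ * p.β ^ 3 * p.m ^ 2 - 3 * y 0 * y 1 ^ 2 * y 2 ^ 4 * q ^ 8 * p.γ * p.β ^ 5 * p.m ^ 2 - 6
      * y 0 * y 1 ^ 2 * y 2 ^ 4 * q ^ 8 * p.γ ^ 3 * p.β * p.m ^ 2 - 3 * y 0 * y 1 ^ 2 * y 2 ^ 4 *
      q ^ 8 * p.γ ^ 3 * p.β ^ 3 * p.m ^ 2 - 6 * y 0 * y 1 ^ 2 * y 2 ^ 4 * q ^ 8 * p.γ ^ 5 * p.β *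
      p.m ^ 2 - 3 * y 0 * y 1 ^ 3 * q ^ 5 * p.m * (p.a * p.s) - 8 * y 0 * y 1 ^ 3 * y 2 * q ^ 6 *
      p.β * p.m * (p.a * p.s) + 16 * y 0 * y 1 ^ 3 * y 2 * q ^ 6 * p.γ * p.m * p.ζ + 15 * y 0 * y
      1 ^ 3 * y 2 ^ 2 * q ^ 7 * p.γ * p.β * p.m * p.ζ - 6 * y 0 * y 1 ^ 4 * y 2 * q ^ 7 * p.γ *
      p.m ^ 2 - 6 * y 0 * y 1 ^ 4 * y 2 ^ 2 * q ^ 8 * p.γ * p.β * p.m ^ 2 + y 0 ^ 3 * q ^ 4 * p.γ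
      * p.β * p.m ^ 2 + 4 * y 0 ^ 3 * y 2 * q ^ 5 * p.γ * p.m ^ 2 - 4 * y 0 ^ 3 * y 2 * q ^ 5 *
      p.γ * p.β ^ 2 * p.m ^ 2 + 4 * y 0 ^ 3 * y 2 * q ^ 5 * p.γ ^ 3 * p.m ^ 2 + 4 * y 0 ^ 3 * y 2
      ^ 2 * q ^ 6 * p.γ * p.β * p.m ^ 2 - 12 * y 0 ^ 3 * y 2 ^ 2 * q ^ 6 * p.γ * p.β ^ 3 * p.m ^ 2
      - 3 * y 0 ^ 3 * y 2 ^ 2 * q ^ 6 * p.γ ^ 3 * p.β * p.m ^ 2 - 12 * y 0 ^ 3 * y 2 ^ 3 * q ^ 7 *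
      p.γ * p.β ^ 2 * p.m ^ 2 - 10 * y 0 ^ 3 * y 2 ^ 3 * q ^ 7 * p.γ * p.β ^ 4 * p.m ^ 2 - 6 * y 0
      ^ 3 * y 2 ^ 3 * q ^ 7 * p.γ ^ 3 * p.m ^ 2 - 10 * y 0 ^ 3 * y 2 ^ 3 * q ^ 7 * p.γ ^ 3 * p.β ^
      2 * p.m ^ 2 - 6 * y 0 ^ 3 * y 2 ^ 3 * q ^ 7 * p.γ ^ 5 * p.m ^ 2 - 12 * y 0 ^ 3 * y 2 ^ 4 * q
      ^ 8 * p.γ * p.β ^ 3 * p.m ^ 2 - 3 * y 0 ^ 3 * y 2 ^ 4 * q ^ 8 * p.γ * p.β ^ 5 * p.m ^ 2 - 6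
      * y 0 ^ 3 * y 2 ^ 4 * q ^ 8 * p.γ ^ 3 * p.β * p.m ^ 2 - 3 * y 0 ^ 3 * y 2 ^ 4 * q ^ 8 * p.γ
      ^ 3 * p.β ^ 3 * p.m ^ 2 - 6 * y 0 ^ 3 * y 2 ^ 4 * q ^ 8 * p.γ ^ 5 * p.β * p.m ^ 2 - 3 * y 0
      ^ 3 * y 1 * q ^ 5 * p.m * (p.a * p.s) - 8 * y 0 ^ 3 * y 1 * y 2 * q ^ 6 * p.β * p.m * (p.a *
      p.s) + 16 * y 0 ^ 3 * y 1 * y 2 * q ^ 6 * p.γ * p.m * p.ζ + 15 * y 0 ^ 3 * y 1 * y 2 ^ 2 * q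
      ^ 7 * p.γ * p.β * p.m * p.ζ - 12 * y 0 ^ 3 * y 1 ^ 2 * y 2 * q ^ 7 * p.γ * p.m ^ 2 - 12 * y
      0 ^ 3 * y 1 ^ 2 * y 2 ^ 2 * q ^ 8 * p.γ * p.β * p.m ^ 2 - 6 * y 0 ^ 5 * y 2 * q ^ 7 * p.γ *
      p.m ^ 2 - 6 * y 0 ^ 5 * y 2 ^ 2 * q ^ 8 * p.γ * p.β * p.m ^ 2) * p.γβ + (-3 * y 1 * y 2 * q
      ^ 5 * p.γ * p.m * (p.a * p.c) + y 0 * q ^ 4 * p.γ * p.β * p.m ^ 2 - y 0 * q ^ 4 * p.γ * p.β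
      ^ 3 * p.m ^ 2 + 10 * y 0 * y 2 * q ^ 5 * p.γ * p.β ^ 2 * p.m ^ 2 - 6 * y 0 * y 2 * q ^ 5 *
      p.γ * p.β ^ 4 * p.m ^ 2 - 6 * y 0 * y 2 * q ^ 7 * p.γ * p.β ^ 2 * p.m ^ 2 + 2 * y 0 * y 2 ^
      2 * q ^ 6 * p.γ * p.β ^ 3 * p.m ^ 2 - 12 * y 0 * y 2 ^ 2 * q ^ 6 * p.γ * p.β ^ 5 * p.m ^ 2 -
      6 * y 0 * y 2 ^ 2 * q ^ 8 * p.γ * p.β ^ 3 * p.m ^ 2 - 6 * y 0 * y 2 ^ 3 * q ^ 7 * p.γ * p.β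
      ^ 2 * p.m ^ 2 - 22 * y 0 * y 2 ^ 3 * q ^ 7 * p.γ * p.β ^ 4 * p.m ^ 2 - 10 * y 0 * y 2 ^ 3 *
      q ^ 7 * p.γ * p.β ^ 6 * p.m ^ 2 - 6 * y 0 * y 2 ^ 4 * q ^ 8 * p.γ * p.β ^ 3 * p.m ^ 2 - 15 *
      y 0 * y 2 ^ 4 * q ^ 8 * p.γ * p.β ^ 5 * p.m ^ 2 - 3 * y 0 * y 2 ^ 4 * q ^ 8 * p.γ * p.β ^ 7
      * p.m ^ 2 - 3 * y 0 * y 1 * q ^ 5 * p.m * (p.a * p.s) - 6 * y 0 * y 1 * q ^ 5 * p.β ^ 2 *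
      p.m * (p.a * p.s) + 3 * y 0 * y 1 * q ^ 5 * p.γ * p.β * p.m * p.ζ - 8 * y 0 * y 1 * y 2 * q
      ^ 6 * p.β ^ 3 * p.m * (p.a * p.s) + 16 * y 0 * y 1 * y 2 * q ^ 6 * p.γ * p.β ^ 2 * p.m * p.ζ
      + 15 * y 0 * y 1 * y 2 ^ 2 * q ^ 7 * p.γ * p.β ^ 3 * p.m * p.ζ - 6 * y 0 * y 1 ^ 2 * y 2 * q
      ^ 7 * p.γ * p.β ^ 2 * p.m ^ 2 - 6 * y 0 * y 1 ^ 2 * y 2 ^ 2 * q ^ 8 * p.γ * p.β ^ 3 * p.m ^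
      2 - 6 * y 0 ^ 3 * y 2 * q ^ 7 * p.γ * p.β ^ 2 * p.m ^ 2 - 6 * y 0 ^ 3 * y 2 ^ 2 * q ^ 8 *
      p.γ * p.β ^ 3 * p.m ^ 2) * hs + (-8 * y 0 * q ^ 2 * p.γ * p.β ^ 3 * p.m ^ 2 + y 0 * q ^ 4 *
      p.γ * p.β * p.m ^ 2 + y 0 * q ^ 4 * p.γ * p.β ^ 3 * p.m ^ 2 + 2 * y 0 * y 2 * q ^ 3 * p.γ *
      p.β ^ 2 * p.m ^ 2 - 10 * y 0 * y 2 * q ^ 3 * p.γ * p.β ^ 4 * p.m ^ 2 - 6 * y 0 * y 2 * q ^ 5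
      * p.γ * p.β ^ 2 * p.m ^ 2 - 5 * y 0 * y 2 ^ 2 * q ^ 4 * p.γ * p.β ^ 3 * p.m ^ 2 - 13 * y 0 *
      y 2 ^ 2 * q ^ 4 * p.γ * p.β ^ 5 * p.m ^ 2 - 6 * y 0 * y 2 ^ 2 * q ^ 6 * p.γ * p.β ^ 3 * p.m
      ^ 2 - 16 * y 0 * y 2 ^ 3 * q ^ 5 * p.γ * p.β ^ 4 * p.m ^ 2 - 10 * y 0 * y 2 ^ 3 * q ^ 5 *
      p.γ * p.β ^ 6 * p.m ^ 2 - 9 * y 0 * y 2 ^ 4 * q ^ 6 * p.γ * p.β ^ 5 * p.m ^ 2 - 3 * y 0 * y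
      2 ^ 4 * q ^ 6 * p.γ * p.β ^ 7 * p.m ^ 2 - 6 * y 0 * y 1 * q ^ 3 * p.β ^ 2 * p.m * (p.a *
      p.s) + 9 * y 0 * y 1 * q ^ 3 * p.γ * p.β * p.m * p.ζ - 8 * y 0 * y 1 * y 2 * q ^ 4 * p.β ^ 3
      * p.m * (p.a * p.s) + 16 * y 0 * y 1 * y 2 * q ^ 4 * p.γ * p.β ^ 2 * p.m * p.ζ + 15 * y 0 *
      y 1 * y 2 ^ 2 * q ^ 5 * p.γ * p.β ^ 3 * p.m * p.ζ) * hq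
  · ring
  · simp

/-- The spin component along the boost is unchanged by it: the γ in the antiderivative cancels the
pole value 1/γ of q. -/
theorem integral_angular_one_z :
    ∫ ν : Metric.sphere (0 : E3) 1, angularFlux (fun _ => secondFormOne (p.pertZero (slicePoint (ν
      : E3))) (p.dPertZero (slicePoint (ν : E3))) (p.dPertOne (slicePoint (ν : E3)))) 2 (ν : E3)
      ∂sphereMeasure =
      8 * Real.pi * p.m * (p.a * p.c) := by
  have cq := p.continuous_sphereInv
  refine (integral_sphere_eq
    (F := fun y => angularFlux (fun _ => secondFormOne (p.pertZero (slicePoint y)) (p.dPertZero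
      (slicePoint y)) (p.dPertOne (slicePoint y))) 2 y)
    (A := fun c => 3 * p.sphereInv c ^ 5 * p.γ * p.m * (p.a * p.c) - 3 * c ^ 2 * p.sphereInv c ^ 5
      * p.γ * p.m * (p.a * p.c))
    (B := fun _ => 0)
    (G := fun c => (2 * p.γ * p.m * (p.a * p.c)) * (c * p.sphereInv c) + (p.γ * p.m * (p.a * p.c))
      * (c * (1 - c ^ 2) * p.sphereInv c ^ 3))
    (fun a b c => -2 * a * p.sphereInv c ^ 2 * p.β * p.m * (p.a * p.s) + 4 * a * p.sphereInv c ^ 2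
      * p.γ * p.m * p.ζ - 2 * a * c * p.sphereInv c ^ 3 * p.β ^ 2 * p.m * (p.a * p.s) + 4 * a * c
      * p.sphereInv c ^ 3 * p.γ * p.β * p.m * p.ζ - 3 * a * c * p.sphereInv c ^ 5 * p.m * (p.a *
      p.s) - 3 * a * c * p.sphereInv c ^ 5 * p.β ^ 2 * p.m * (p.a * p.s))
    (fun _ _ _ => 0)
    (fun _ _ _ => 0)
    (fun y hy => ?_) (fun a b c => by ring) (by simp) (by simp)
    (by fun_prop) (by fun_prop) (by fun_prop) (by fun_prop) (by fun_prop)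
    fun c => (((p.hasDerivAt_mul_sphereInv c).const_mul (2 * p.γ * p.m * (p.a * p.c))).add
      ((p.hasDerivAt_sphereInv_cube c).const_mul (p.γ * p.m * (p.a * p.c)))).congr_deriv ?_).trans
      ?_
  · have hs := sphere_relation hy
    have hq := p.sphereInv_sq (y 2)
    simp only [angularFlux, secondFormOne, koszulJet]
    simp [Fin.sum_univ_three, dPertZero, dPertOne, dEllZero, dEllOne, dMulSq, dMulCube,
      dInvRadius, dHeight, dX, dY, ellZero, ellOne, pertZero, invRadius_slicePoint p hy,
      height_slicePoint, slicePoint_one, slicePoint_two, momentumDensity, Matrix.trace,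
        rotationField, crossProduct]
    generalize p.sphereInv (y 2) = q at *
    linear_combination (3 * y 1 ^ 2 * y 2 ^ 2 * q ^ 5 * p.γ * p.m * (p.a * p.c) - 2 * y 0 * y 2 ^
      2 * q ^ 4 * p.β * p.m * (p.a * p.s) + 4 * y 0 * y 2 ^ 2 * q ^ 4 * p.γ * p.m * p.ζ - 3 * y 0
      * y 2 ^ 3 * q ^ 5 * p.m * (p.a * p.s) + 3 * y 0 * y 2 ^ 3 * q ^ 5 * p.γ * p.β * p.m * p.ζ -
      3 * y 0 * y 2 ^ 3 * q ^ 5 * p.γ ^ 2 * p.m * (p.a * p.s) - 3 * y 0 * y 1 ^ 2 * y 2 * q ^ 5 *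
      p.m * (p.a * p.s) + 3 * y 0 ^ 2 * y 2 ^ 2 * q ^ 5 * p.γ * p.m * (p.a * p.c) - 3 * y 0 ^ 3 *
      y 2 * q ^ 5 * p.m * (p.a * p.s)) * p.γβ + (3 * q ^ 5 * p.γ * p.m * (p.a * p.c) + 3 * y 1 ^ 2
      * q ^ 5 * p.γ * p.m * (p.a * p.c) - 2 * y 0 * q ^ 4 * p.β * p.m * (p.a * p.s) + 4 * y 0 * q
      ^ 4 * p.γ * p.m * p.ζ - 3 * y 0 * y 2 * q ^ 5 * p.m * (p.a * p.s) - 3 * y 0 * y 2 * q ^ 5 *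
      p.β ^ 2 * p.m * (p.a * p.s) + 3 * y 0 * y 2 * q ^ 5 * p.γ * p.β * p.m * p.ζ + 3 * y 0 ^ 2 *
      q ^ 5 * p.γ * p.m * (p.a * p.c)) * hs + (-2 * y 0 * q ^ 2 * p.β * p.m * (p.a * p.s) + 4 * y
      0 * q ^ 2 * p.γ * p.m * p.ζ + 3 * y 0 * y 2 * q ^ 3 * p.γ * p.β * p.m * p.ζ) * hq
  · ring
  · have hγ := p.γ_pos
    rw [sphereInv_neg, sphereInv_one]
    field_simp
    ring

end Integrals

end BoostedKerr

/-! ### Asymptotics of sphere integrals -/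

section Asymptotics

variable {F : ℝ → E3 → ℝ} {F₀ F₁ : E3 → ℝ} {c : ℝ}

/-- For charges without prefactor the linear Taylor term is itself part of the O(ε) error, so the
value of its integral is irrelevant. -/
theorem eventually_sphereIntegral_sub_le
    (h : ∀ v : E3, ‖v‖ = 1 → ContDiffAt ℝ ∞ (Function.uncurry F) (0, v))
    (h1 : ∀ v : E3, ‖v‖ = 1 → HasDerivAt (fun ε => F ε v) (F₁ v) 0)
    (h0 : ∀ v : E3, ‖v‖ = 1 → F 0 v = F₀ v)
    (hc : ∫ ν : Metric.sphere (0 : E3) 1, F₀ ν ∂sphereMeasure = c) :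
    ∃ C, ∀ᶠ ε in 𝓝[>] (0 : ℝ),
      |∫ ν : Metric.sphere (0 : E3) 1, F ε ν ∂sphereMeasure - c| ≤ C * ε := by
  obtain ⟨δ, hδ, C, hC, H⟩ := exists_integral_taylor h h1
  have hF0 : ∀ ν : Metric.sphere (0 : E3) 1, F 0 ν = F₀ ν := fun ν => h0 ν (by simp)
  simp only [hF0, hc] at H
  set I := ∫ ν : Metric.sphere (0 : E3) 1, F₁ ν ∂sphereMeasure
  refine ⟨C + |I|, ?_⟩
  filter_upwards [Ioo_mem_nhdsGT (lt_min hδ one_pos)] with ε hε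
  have hε0 : 0 < ε := hε.1
  have h2 := H ε (by rw [abs_of_pos hε0]; exact hε.2.trans_le (min_le_left _ _))
  have hε1 : ε < 1 := hε.2.trans_le (min_le_right _ _)
  calc |∫ ν : Metric.sphere (0 : E3) 1, F ε ν ∂sphereMeasure - c|
      = |(∫ ν : Metric.sphere (0 : E3) 1, F ε ν ∂sphereMeasure - c - ε * I) + ε * I| := by
        ring_nf
    _ ≤ C * ε ^ 2 + |ε * I| := (abs_add_le _ _).trans (by gcongr)
    _ ≤ C * ε + ε * |I| := by
        rw [abs_mul, abs_of_pos hε0]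
        have : ε ^ 2 ≤ ε := by nlinarith
        gcongr
    _ = (C + |I|) * ε := by ring

/-- With zero constant term, dividing by ε turns the linear coefficient into the limit and the
quadratic remainder into an O(ε) error. -/
theorem eventually_inv_mul_sphereIntegral_sub_le
    (h : ∀ v : E3, ‖v‖ = 1 → ContDiffAt ℝ ∞ (Function.uncurry F) (0, v))
    (h1 : ∀ v : E3, ‖v‖ = 1 → HasDerivAt (fun ε => F ε v) (F₁ v) 0)
    (h0 : ∀ v : E3, ‖v‖ = 1 → F 0 v = F₀ v)
    (h00 : ∫ ν : Metric.sphere (0 : E3) 1, F₀ ν ∂sphereMeasure = 0)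
    (hc : ∫ ν : Metric.sphere (0 : E3) 1, F₁ ν ∂sphereMeasure = c) :
    ∃ C, ∀ᶠ ε in 𝓝[>] (0 : ℝ),
      |ε⁻¹ * ∫ ν : Metric.sphere (0 : E3) 1, F ε ν ∂sphereMeasure - c| ≤ C * ε := by
  obtain ⟨δ, hδ, C, hC, H⟩ := exists_integral_taylor h h1
  have hF0 : ∀ ν : Metric.sphere (0 : E3) 1, F 0 ν = F₀ ν := fun ν => h0 ν (by simp)
  simp only [hF0, h00, hc, sub_zero] at H
  refine ⟨C, ?_⟩
  filter_upwards [Ioo_mem_nhdsGT hδ] with ε hε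
  have hε0 : 0 < ε := hε.1
  have h2 := H ε (by rw [abs_of_pos hε0]; exact hε.2)
  calc |ε⁻¹ * ∫ ν : Metric.sphere (0 : E3) 1, F ε ν ∂sphereMeasure - c|
      = |ε⁻¹ * (∫ ν : Metric.sphere (0 : E3) 1, F ε ν ∂sphereMeasure - ε * c)| := by
        congr 1; field_simp
    _ = ε⁻¹ * |∫ ν : Metric.sphere (0 : E3) 1, F ε ν ∂sphereMeasure - ε * c| := by
        rw [abs_mul, abs_of_pos (inv_pos.2 hε0)]
    _ ≤ ε⁻¹ * (C * ε ^ 2) := by gcongr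
    _ = C * ε := by field_simp

theorem exists_common_bound {ι : Type*} [Fintype ι] {P : ι → ℝ → ℝ → Prop}
    (hmono : ∀ i C C' ε, 0 < ε → C ≤ C' → P i C ε → P i C' ε)
    (h : ∀ i, ∃ C, ∀ᶠ ε in 𝓝[>] (0 : ℝ), P i C ε) :
    ∃ C, ∀ᶠ ε in 𝓝[>] (0 : ℝ), ∀ i, P i C ε := by
  choose C hC using h
  refine ⟨∑ i, |C i|, eventually_all.2 fun i => ?_⟩
  filter_upwards [hC i, self_mem_nhdsWithin] with ε hε h0
  exact hmono i _ _ ε h0 ((le_abs_self _).trans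
    (Finset.single_le_sum (f := fun i => |C i|) (fun _ _ => abs_nonneg _) (Finset.mem_univ i))) hε

end Asymptotics

/-! ### Dependence of the flux densities on the scaling parameter -/

theorem momentumDensity_apply (K : Tensor3) (y : E3) (i j : Fin 3) :
    momentumDensity K y i j = K y i j - (∑ a, K y a a) * (1 : Matrix (Fin 3) (Fin 3) ℝ) i j := by
  simp [momentumDensity, Matrix.trace]

section FluxRegularity

variable {K : ℝ → Tensor3} {K₁ : Matrix (Fin 3) (Fin 3) ℝ} {y : E3}

theorem contDiff_rotationField (l i : Fin 3) : ContDiff ℝ ∞ fun y => rotationField l y i := by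
  fin_cases l <;> fin_cases i <;> simp [rotationField, crossProduct] <;> fun_prop

theorem contDiffAt_coord (j : Fin 3) (q : ℝ × E3) : ContDiffAt ℝ ∞ (fun q : ℝ × E3 => q.2 j) q := by
  fun_prop

theorem contDiffAt_momentumDensity
    (h : ∀ i j, ContDiffAt ℝ ∞ (Function.uncurry fun ε y => K ε y i j) (0, y)) (i j : Fin 3) :
    ContDiffAt ℝ ∞ (Function.uncurry fun ε y => momentumDensity (K ε) y i j) (0, y) := by
  simp only [momentumDensity_apply]
  exact (h i j).sub ((ContDiffAt.sum fun a _ => h a a).mul contDiffAt_const)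

theorem contDiffAt_momentumFlux
    (h : ∀ i j, ContDiffAt ℝ ∞ (Function.uncurry fun ε y => K ε y i j) (0, y)) (i : Fin 3) :
    ContDiffAt ℝ ∞ (Function.uncurry fun ε y => momentumFlux (K ε) i y) (0, y) := by
  change ContDiffAt ℝ ∞ (fun q : ℝ × E3 => ∑ j, momentumDensity (K q.1) q.2 i j * q.2 j) _
  exact ContDiffAt.sum fun j _ => (contDiffAt_momentumDensity h i j).mul (contDiffAt_coord j _)

theorem contDiffAt_angularFlux
    (h : ∀ i j, ContDiffAt ℝ ∞ (Function.uncurry fun ε y => K ε y i j) (0, y)) (l : Fin 3) :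
    ContDiffAt ℝ ∞ (Function.uncurry fun ε y => angularFlux (K ε) l y) (0, y) := by
  change ContDiffAt ℝ ∞ (fun q : ℝ × E3 => ∑ i, ∑ j,
    momentumDensity (K q.1) q.2 i j * rotationField l q.2 i * q.2 j) _
  exact ContDiffAt.sum fun i _ => ContDiffAt.sum fun j _ => ((contDiffAt_momentumDensity h i j).mul
    ((contDiff_rotationField l i).contDiffAt.comp _ contDiffAt_snd)).mul (contDiffAt_coord j _)

theorem hasDerivAt_momentumDensity (h : ∀ i j, HasDerivAt (fun ε => K ε y i j) (K₁ i j) 0)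
    (i j : Fin 3) :
    HasDerivAt (fun ε => momentumDensity (K ε) y i j) (momentumDensity (fun _ => K₁) y i j) 0 := by
  simp only [momentumDensity_apply]
  exact (h i j).sub ((HasDerivAt.fun_sum fun a _ => h a a).mul_const _)

theorem hasDerivAt_momentumFlux (h : ∀ i j, HasDerivAt (fun ε => K ε y i j) (K₁ i j) 0)
    (i : Fin 3) :
    HasDerivAt (fun ε => momentumFlux (K ε) i y) (momentumFlux (fun _ => K₁) i y) 0 :=
  HasDerivAt.fun_sum fun j _ => (hasDerivAt_momentumDensity h i j).mul_const _

theorem hasDerivAt_angularFlux (h : ∀ i j, HasDerivAt (fun ε => K ε y i j) (K₁ i j) 0)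
    (l : Fin 3) :
    HasDerivAt (fun ε => angularFlux (K ε) l y) (angularFlux (fun _ => K₁) l y) 0 :=
  HasDerivAt.fun_sum fun i _ => HasDerivAt.fun_sum fun j _ =>
    ((hasDerivAt_momentumDensity h i j).mul_const _).mul_const _

theorem momentumFlux_congr {K K' : Tensor3} (h : K y = K' y) (i : Fin 3) :
    momentumFlux K i y = momentumFlux K' i y := by
  simp only [momentumFlux, momentumDensity, h]

theorem angularFlux_congr {K K' : Tensor3} (h : K y = K' y) (l : Fin 3) :
    angularFlux K l y = angularFlux K' l y := by
  simp only [angularFlux, momentumDensity, h]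

end FluxRegularity

/-! ### Jets of the rescaled perturbation and the charges of the unrotated metric -/

namespace BoostedKerr

variable (p : BoostedKerr)

/-- The first derivatives of the perturbation at a point of the slice. -/
noncomputable def jet (ε : ℝ) (y : E3) (α μ ν : Fin 4) : ℝ :=
  pd4 α (fun u => p.perturbation ε u μ ν) (slicePoint y)

variable {p} {y : E3}

theorem regular_unit (hy : ‖y‖ = 1) : p.Regular 0 (slicePoint y) :=
  p.regular_of_norm (by rw [abs_zero]; exact p.regularityBound_pos.le) hy

theorem contDiffAt_value (hy : ‖y‖ = 1) (μ ν : Fin 4) :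
    ContDiffAt ℝ ∞ (Function.uncurry fun ε y => p.perturbation ε (slicePoint y) μ ν) (0, y) :=
  contDiffAt_comp_slicePoint
    (p.contDiffAt_perturbation (q := (0, slicePoint y)) (regular_unit hy) μ ν)

theorem contDiffAt_jet (hy : ‖y‖ = 1) (α μ ν : Fin 4) :
    ContDiffAt ℝ ∞ (Function.uncurry fun ε y => p.jet ε y α μ ν) (0, y) :=
  contDiffAt_comp_slicePoint (contDiffAt_fderiv_curry
    (p.contDiffAt_perturbation (q := (0, slicePoint y)) (regular_unit hy) μ ν) _)

theorem jet_zero (hy : ‖y‖ = 1) : p.jet 0 y = p.dPertZero (slicePoint y) := by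
  ext α μ ν
  exact pd4_perturbation_zero (regular_unit hy) α μ ν

theorem hasDerivAt_jet (hy : ‖y‖ = 1) (α μ ν : Fin 4) :
    HasDerivAt (fun ε => p.jet ε y α μ ν) (p.dPertOne (slicePoint y) α μ ν) 0 :=
  hasDerivAt_pd4_perturbation (regular_unit hy) α μ ν

theorem hasDerivAt_value (hy : ‖y‖ = 1) (μ ν : Fin 4) :
    HasDerivAt (fun ε => p.perturbation ε (slicePoint y) μ ν) (p.pertOne (slicePoint y) μ ν) 0 :=
  hasDerivAt_perturbation (regular_unit hy) μ ν

theorem value_zero (hy : ‖y‖ = 1) :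
    p.perturbation 0 (slicePoint y) = p.pertZero (slicePoint y) := by
  ext μ ν
  exact perturbation_zero (regular_unit hy) μ ν

/-! ### Energy and center of mass -/

theorem energyDensity_perturbation {ε : ℝ} (h : p.Regular ε (slicePoint y)) (j : Fin 3) :
    energyDensity (inducedMetric (p.perturbation ε)) y j = energyJet (p.jet ε y) j := by
  have hpd : ∀ i a b : Fin 3, pd3 i (fun y => inducedMetric (p.perturbation ε) y a b) y =
      p.jet ε y i.succ a.succ b.succ := fun i a b =>
    pd3_comp_slicePoint (differentiableAt_perturbation h a.succ b.succ) i
  simp only [energyDensity, hpd, energyJet]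

theorem contDiffAt_energyJet (hy : ‖y‖ = 1) (j : Fin 3) :
    ContDiffAt ℝ ∞ (Function.uncurry fun ε y => energyJet (p.jet ε y) j) (0, y) := by
  change ContDiffAt ℝ ∞ (fun q : ℝ × E3 => ∑ i : Fin 3,
    (p.jet q.1 q.2 i.succ i.succ j.succ - p.jet q.1 q.2 j.succ i.succ i.succ)) _
  exact ContDiffAt.sum fun _ _ => (contDiffAt_jet hy _ _ _).sub (contDiffAt_jet hy _ _ _)

theorem hasDerivAt_energyJet (hy : ‖y‖ = 1) (j : Fin 3) :
    HasDerivAt (fun ε => energyJet (p.jet ε y) j) (energyJet (p.dPertOne (slicePoint y)) j) 0 :=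
  HasDerivAt.fun_sum fun _ _ => (hasDerivAt_jet hy _ _ _).sub (hasDerivAt_jet hy _ _ _)

theorem contDiffAt_centerJetFlux (hy : ‖y‖ = 1) (l : Fin 3) :
    ContDiffAt ℝ ∞ (Function.uncurry fun ε y =>
      centerJetFlux (p.perturbation ε (slicePoint y)) (p.jet ε y) l y) (0, y) := by
  change ContDiffAt ℝ ∞ (fun q : ℝ × E3 => ∑ j : Fin 3, (q.2 l * energyJet (p.jet q.1 q.2) j -
    p.perturbation q.1 (slicePoint q.2) l.succ j.succ +
    (if j = l then ∑ i : Fin 3, p.perturbation q.1 (slicePoint q.2) i.succ i.succ else 0)) *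
    q.2 j) _
  refine ContDiffAt.sum fun j _ => (((((contDiffAt_coord l _).mul
    (contDiffAt_energyJet hy j)).sub (contDiffAt_value hy l.succ j.succ)).add ?_).mul
    (contDiffAt_coord j _))
  by_cases h : j = l
  · simp only [h, if_true]
    exact ContDiffAt.sum fun i _ => contDiffAt_value hy i.succ i.succ
  · simp only [h, if_false]
    exact contDiffAt_const

theorem hasDerivAt_centerJetFlux (hy : ‖y‖ = 1) (l : Fin 3) :
    HasDerivAt (fun ε => centerJetFlux (p.perturbation ε (slicePoint y)) (p.jet ε y) l y)
      (centerJetFlux (p.pertOne (slicePoint y)) (p.dPertOne (slicePoint y)) l y) 0 := by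
  refine HasDerivAt.fun_sum fun j _ => (((((hasDerivAt_energyJet hy j).const_mul _).sub
    (hasDerivAt_value hy l.succ j.succ)).add ?_).mul_const _)
  by_cases h : j = l
  · simp only [h, if_true]
    exact HasDerivAt.fun_sum fun i _ => hasDerivAt_value hy i.succ i.succ
  · simp only [h, if_false]
    exact hasDerivAt_const _ _

theorem inducedMetric_scaled {ε : ℝ} (hε : 0 < ε) (y : E3) :
    inducedMetric p.metric y = 1 + ε • inducedMetric (p.perturbation ε) (ε • y) := by
  ext i j
  simp only [inducedMetric, Matrix.of_apply, p.metric_scaled hε, slicePoint_smul,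
    Matrix.add_apply, Matrix.smul_apply]
  congr 1
  fin_cases i <;> fin_cases j <;> simp [minkowski]

theorem eventually_regular :
    ∀ᶠ ε in 𝓝[>] (0 : ℝ), 0 < ε ∧ ∀ y : E3, ‖y‖ = 1 → p.Regular ε (slicePoint y) := by
  filter_upwards [Ioo_mem_nhdsGT p.regularityBound_pos] with ε hε
  exact ⟨hε.1, fun y hy => p.regular_of_norm (by rw [abs_of_pos hε.1]; exact hε.2.le) hy⟩

theorem energyCharge_asymptotics :
    ∃ C, ∀ᶠ ε in 𝓝[>] (0 : ℝ),
      |energyCharge (inducedMetric p.metric) ε⁻¹ - 8 * Real.pi * p.m * p.γ| ≤ C * ε := by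
  obtain ⟨C, hC⟩ := eventually_sphereIntegral_sub_le
    (F := fun ε y => energyJetFlux (p.jet ε y) y)
    (fun v hv => by
      change ContDiffAt ℝ ∞ (fun q : ℝ × E3 => ∑ j, energyJet (p.jet q.1 q.2) j * q.2 j) _
      exact ContDiffAt.sum fun j _ => (contDiffAt_energyJet hv j).mul (contDiffAt_coord j _))
    (F₁ := fun y => energyJetFlux (p.dPertOne (slicePoint y)) y)
    (fun v hv => HasDerivAt.fun_sum fun j _ => (hasDerivAt_energyJet hv j).mul_const _)
    (fun v hv => by rw [jet_zero hv]) p.integral_energy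
  -- The factor 1/2 in the definition of the charge halves both the flux and its error.
  refine ⟨C / 2, ?_⟩
  filter_upwards [hC, p.eventually_regular] with ε hε hr
  have e : ∀ ν : Metric.sphere (0 : E3) 1,
      ∑ j, energyDensity (inducedMetric (p.perturbation ε)) ν j * (ν : E3) j =
      energyJetFlux (p.jet ε ν) ν := fun ν => by
    simp only [energyDensity_perturbation (hr.2 ν (by simp)), energyJetFlux]
  rw [energyCharge_scaled hr.1 (inducedMetric_scaled hr.1)]
  simp only [e]
  rw [abs_le] at hε ⊢
  constructor <;> linarith [hε.1, hε.2]

theorem centerCharge_asymptotics (l : Fin 3) :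
    ∃ C, ∀ᶠ ε in 𝓝[>] (0 : ℝ), |centerCharge (inducedMetric p.metric) ε⁻¹ l -
      ![0, 8 * Real.pi * p.m * (p.γ * p.ζ - p.β * (p.a * p.s)), 0] l| ≤ C * ε := by
  have h0 : ∫ ν : Metric.sphere (0 : E3) 1, centerJetFlux (p.pertZero (slicePoint ν))
      (p.dPertZero (slicePoint ν)) l ν ∂sphereMeasure = 0 := by
    fin_cases l
    exacts [p.integral_center_zero_x, p.integral_center_zero_y, p.integral_center_zero_z]
  -- The factor 2 undoes the 1/2 in the definition of the charge.
  have h1 : ∫ ν : Metric.sphere (0 : E3) 1, centerJetFlux (p.pertOne (slicePoint ν))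
      (p.dPertOne (slicePoint ν)) l ν ∂sphereMeasure =
      2 * ![0, 8 * Real.pi * p.m * (p.γ * p.ζ - p.β * (p.a * p.s)), 0] l := by
    fin_cases l
    · exact p.integral_center_one_x.trans (by simp)
    · exact p.integral_center_one_y.trans (by simp; ring)
    · exact p.integral_center_one_z.trans (by simp)
  obtain ⟨C, hC⟩ := eventually_inv_mul_sphereIntegral_sub_le
    (fun v hv => contDiffAt_centerJetFlux hv l) (fun v hv => hasDerivAt_centerJetFlux hv l)
    (fun v hv => by rw [jet_zero hv, value_zero hv]) h0 h1
  refine ⟨C / 2, ?_⟩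
  filter_upwards [hC, p.eventually_regular] with ε hε hr
  have e : ∀ ν : Metric.sphere (0 : E3) 1,
      centerFlux (inducedMetric (p.perturbation ε)) l ν =
      centerJetFlux (p.perturbation ε (slicePoint ν)) (p.jet ε ν) l ν := fun ν => by
    simp only [centerFlux, centerJetFlux, energyDensity_perturbation (hr.2 ν (by simp))]
    rfl
  rw [centerCharge_scaled hr.1 (inducedMetric_scaled hr.1)]
  simp only [e]
  rw [mul_left_comm]
  rw [abs_le] at hε ⊢
  constructor <;> linarith [hε.1, hε.2]

/-! ### Linear and angular momentum -/

theorem scaledSecondForm_apply (ε : ℝ) (y : E3) (i j : Fin 3) :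
    scaledSecondForm ε (p.perturbation ε) y i j =
      (1 / 2) * (√(1 + ε * p.perturbation ε (slicePoint y) 0 0) * koszulJet (p.jet ε y) 0 i j -
        ε / √(1 + ε * p.perturbation ε (slicePoint y) 0 0) *
          ∑ l : Fin 3, p.perturbation ε (slicePoint y) 0 l.succ *
            koszulJet (p.jet ε y) l.succ i j) := rfl

theorem contDiffAt_koszulJet (hy : ‖y‖ = 1) (ρ : Fin 4) (i j : Fin 3) :
    ContDiffAt ℝ ∞ (Function.uncurry fun ε y => koszulJet (p.jet ε y) ρ i j) (0, y) :=
  ((contDiffAt_jet hy _ _ _).add (contDiffAt_jet hy _ _ _)).sub (contDiffAt_jet hy _ _ _)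

theorem hasDerivAt_koszulJet (hy : ‖y‖ = 1) (ρ : Fin 4) (i j : Fin 3) :
    HasDerivAt (fun ε => koszulJet (p.jet ε y) ρ i j)
      (koszulJet (p.dPertOne (slicePoint y)) ρ i j) 0 :=
  ((hasDerivAt_jet hy _ _ _).add (hasDerivAt_jet hy _ _ _)).sub (hasDerivAt_jet hy _ _ _)

theorem contDiffAt_scaledSecondForm (hy : ‖y‖ = 1) (i j : Fin 3) :
    ContDiffAt ℝ ∞
      (Function.uncurry fun ε y => scaledSecondForm ε (p.perturbation ε) y i j) (0, y) := by
  have hf : ContDiffAt ℝ ∞ (fun q : ℝ × E3 => q.1) (0, y) := contDiffAt_fst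
  have hs : ContDiffAt ℝ ∞ (fun q : ℝ × E3 =>
      √(1 + q.1 * p.perturbation q.1 (slicePoint q.2) 0 0)) (0, y) :=
    (contDiffAt_const.add (hf.mul (contDiffAt_value hy 0 0))).sqrt (by simp)
  exact contDiffAt_const.mul ((hs.mul (contDiffAt_koszulJet hy 0 i j)).sub
    ((hf.div hs (by simp)).mul (ContDiffAt.sum fun l _ =>
      (contDiffAt_value hy 0 l.succ).mul (contDiffAt_koszulJet hy l.succ i j))))

theorem scaledSecondForm_zero (hy : ‖y‖ = 1) :
    scaledSecondForm 0 (p.perturbation 0) y = secondFormZero (p.dPertZero (slicePoint y)) := by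
  ext i j
  rw [scaledSecondForm_apply, jet_zero hy, secondFormZero]
  simp

/-- At ε = 0 the root √(1 + εA₀₀) equals 1 with derivative A₀₀/2, while ε/√(1 + εA₀₀) equals 0 with
derivative 1. So the shift terms enter with undifferentiated jets. -/
theorem hasDerivAt_scaledSecondForm (hy : ‖y‖ = 1) (i j : Fin 3) :
    HasDerivAt (fun ε => scaledSecondForm ε (p.perturbation ε) y i j)
      (secondFormOne (p.pertZero (slicePoint y)) (p.dPertZero (slicePoint y))
        (p.dPertOne (slicePoint y)) i j) 0 := by
  have hs := (((hasDerivAt_id (0 : ℝ)).mul (hasDerivAt_value (p := p) hy 0 0)).const_add 1).sqrt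
    (by simp)
  have hsum := HasDerivAt.fun_sum (u := Finset.univ) fun (l : Fin 3) _ =>
    (hasDerivAt_value (p := p) hy 0 l.succ).mul (hasDerivAt_koszulJet (p := p) hy l.succ i j)
  have := ((hs.mul (hasDerivAt_koszulJet (p := p) hy 0 i j)).sub
    (((hasDerivAt_id (0 : ℝ)).div hs (by simp)).mul hsum)).const_mul (1 / 2)
  refine this.congr_deriv ?_
  simp only [secondFormOne, Matrix.of_apply, Pi.mul_apply, jet_zero hy, value_zero hy]
  simp
  ring_nf
  simp

theorem secondFundamentalForm_metric {ε : ℝ} (hε : 0 < ε)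
    (hr : ∀ y : E3, ‖y‖ = 1 → p.Regular ε (slicePoint y)) {y : E3} (hy : ‖y‖ = ε⁻¹) :
    secondFundamentalForm p.metric y =
      ε ^ 2 • scaledSecondForm ε (p.perturbation ε) (ε • y) := by
  have hy1 : ‖ε • y‖ = 1 := by
    rw [norm_smul, hy, Real.norm_eq_abs, abs_of_pos hε, mul_inv_cancel₀ hε.ne']
  have h := hr _ hy1
  rw [slicePoint_smul] at h
  have hinv := p.inv_metric hε h
  rw [← slicePoint_smul] at hinv
  exact secondFundamentalForm_scaled (p.metric_scaled hε) hinv.1 hinv.2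

theorem momentumCharge_asymptotics (i : Fin 3) :
    ∃ C, ∀ᶠ ε in 𝓝[>] (0 : ℝ), |momentumCharge (secondFundamentalForm p.metric) ε⁻¹ i -
      ![0, 0, -(8 * Real.pi * p.m * p.β)] i| ≤ C * ε := by
  have h0 : ∫ ν : Metric.sphere (0 : E3) 1, momentumFlux
      (fun _ => secondFormZero (p.dPertZero (slicePoint ν))) i ν ∂sphereMeasure =
      ![0, 0, -(8 * Real.pi * p.m * p.β)] i := by
    fin_cases i
    exacts [p.integral_momentum_x, p.integral_momentum_y, p.integral_momentum_z]
  obtain ⟨C, hC⟩ := eventually_sphereIntegral_sub_le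
    (fun v hv => contDiffAt_momentumFlux (contDiffAt_scaledSecondForm (p := p) hv) i)
    (fun v hv => hasDerivAt_momentumFlux (hasDerivAt_scaledSecondForm hv) i)
    (F₀ := fun y => momentumFlux (fun _ => secondFormZero (p.dPertZero (slicePoint y))) i y)
    (fun v hv => momentumFlux_congr (scaledSecondForm_zero hv) i) h0
  refine ⟨C, ?_⟩
  filter_upwards [hC, p.eventually_regular] with ε hε hr
  rwa [momentumCharge_scaled hr.1 fun y hy => secondFundamentalForm_metric hr.1 hr.2 hy]

theorem angularCharge_asymptotics (l : Fin 3) :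
    ∃ C, ∀ᶠ ε in 𝓝[>] (0 : ℝ), |angularCharge (secondFundamentalForm p.metric) ε⁻¹ l -
      ![8 * Real.pi * p.m * (p.γ * (p.a * p.s) - p.β * p.ζ), 0,
        8 * Real.pi * p.m * (p.a * p.c)] l| ≤ C * ε := by
  have h0 : ∫ ν : Metric.sphere (0 : E3) 1, angularFlux
      (fun _ => secondFormZero (p.dPertZero (slicePoint ν))) l ν ∂sphereMeasure = 0 := by
    fin_cases l
    exacts [p.integral_angular_zero_x, p.integral_angular_zero_y, p.integral_angular_zero_z]
  have h1 : ∫ ν : Metric.sphere (0 : E3) 1, angularFlux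
      (fun _ => secondFormOne (p.pertZero (slicePoint ν)) (p.dPertZero (slicePoint ν))
        (p.dPertOne (slicePoint ν))) l ν ∂sphereMeasure =
      ![8 * Real.pi * p.m * (p.γ * (p.a * p.s) - p.β * p.ζ), 0,
        8 * Real.pi * p.m * (p.a * p.c)] l := by
    fin_cases l
    exacts [p.integral_angular_one_x, p.integral_angular_one_y, p.integral_angular_one_z]
  obtain ⟨C, hC⟩ := eventually_inv_mul_sphereIntegral_sub_le
    (F := fun ε y => angularFlux (scaledSecondForm ε (p.perturbation ε)) l y)
    (F₀ := fun y => angularFlux (fun _ => secondFormZero (p.dPertZero (slicePoint y))) l y)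
    (F₁ := fun y => angularFlux (fun _ => secondFormOne (p.pertZero (slicePoint y))
      (p.dPertZero (slicePoint y)) (p.dPertOne (slicePoint y))) l y)
    (fun v hv => contDiffAt_angularFlux (contDiffAt_scaledSecondForm (p := p) hv) l)
    (fun v hv => hasDerivAt_angularFlux (hasDerivAt_scaledSecondForm hv) l)
    (fun v hv => angularFlux_congr (scaledSecondForm_zero hv) l) h0 h1
  refine ⟨C, ?_⟩
  filter_upwards [hC, p.eventually_regular] with ε hε hr
  rwa [angularCharge_scaled hr.1 fun y hy => secondFundamentalForm_metric hr.1 hr.2 hy]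

/-! ### Decay, regularity and positivity -/

/-- The rescaled perturbation is bounded on the unit sphere for small ε, and the amplitude supplies
the factor ε. -/
theorem metric_decay (i j : Fin 3) :
    ∃ C, ∀ᶠ ε in 𝓝[>] (0 : ℝ), ∀ y : E3, ‖y‖ = ε⁻¹ →
      |(inducedMetric p.metric y - 1) i j| ≤ C * ε := by
  obtain ⟨δ, hδ, C, hC, H⟩ := exists_uniform_bound (isCompact_sphere (0 : E3) 1)
    (F := fun ε y => p.perturbation ε (slicePoint y) i.succ j.succ)
    (fun v hv => (contDiffAt_value (by simpa using hv) i.succ j.succ).continuousAt)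
  refine ⟨C, ?_⟩
  filter_upwards [Ioo_mem_nhdsGT hδ] with ε hε y hy
  have hε0 : 0 < ε := hε.1
  have hy1 : ‖ε • y‖ = 1 := by
    rw [norm_smul, hy, Real.norm_eq_abs, abs_of_pos hε0, mul_inv_cancel₀ hε0.ne']
  have h := H ε (by rw [abs_of_pos hε0]; exact hε.2) (ε • y) (by simpa using hy1)
  rw [inducedMetric_scaled hε0, add_sub_cancel_left, Matrix.smul_apply, smul_eq_mul, abs_mul,
    abs_of_pos hε0, mul_comm]
  exact mul_le_mul_of_nonneg_right h hε0.le

theorem secondForm_decay (i j : Fin 3) :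
    ∃ C, ∀ᶠ ε in 𝓝[>] (0 : ℝ), ∀ y : E3, ‖y‖ = ε⁻¹ →
      |secondFundamentalForm p.metric y i j| ≤ C * ε ^ 2 := by
  obtain ⟨δ, hδ, C, hC, H⟩ := exists_uniform_bound (isCompact_sphere (0 : E3) 1)
    (F := fun ε y => scaledSecondForm ε (p.perturbation ε) y i j)
    (fun v hv => (contDiffAt_scaledSecondForm (by simpa using hv) i j).continuousAt)
  refine ⟨C, ?_⟩
  filter_upwards [Ioo_mem_nhdsGT hδ, p.eventually_regular] with ε hε hr y hy
  have hε0 : 0 < ε := hε.1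
  have hy1 : ‖ε • y‖ = 1 := by
    rw [norm_smul, hy, Real.norm_eq_abs, abs_of_pos hε0, mul_inv_cancel₀ hε0.ne']
  have h := H ε (by rw [abs_of_pos hε0]; exact hε.2) (ε • y) (by simpa using hy1)
  rw [secondFundamentalForm_metric hε0 hr.2 hy, Matrix.smul_apply, smul_eq_mul, abs_mul,
    abs_of_pos (by positivity : 0 < ε ^ 2), mul_comm]
  exact mul_le_mul_of_nonneg_right h (by positivity)

theorem contDiffAt_metric {ε : ℝ} (hε : 0 < ε)
    (hr : ∀ y : E3, ‖y‖ = 1 → p.Regular ε (slicePoint y)) {y : E3} (hy : ‖y‖ = ε⁻¹)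
    (μ ν : Fin 4) : ContDiffAt ℝ ∞ (fun x => p.metric x μ ν) (slicePoint y) := by
  have hy1 : ‖ε • y‖ = 1 := by
    rw [norm_smul, hy, Real.norm_eq_abs, abs_of_pos hε, mul_inv_cancel₀ hε.ne']
  have h := hr _ hy1
  rw [slicePoint_smul] at h
  have e : (fun x => p.metric x μ ν) = fun x =>
      minkowski μ ν + ε * (Function.uncurry fun ε u => p.perturbation ε u μ ν) (ε, ε • x) := by
    ext x; rw [p.metric_scaled hε]; rfl
  rw [e]
  exact contDiffAt_const.add (contDiffAt_const.mul (ContDiffAt.comp (slicePoint y)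
    (f := fun x => (ε, ε • x)) (p.contDiffAt_perturbation (q := (ε, ε • slicePoint y)) h μ ν)
    (contDiffAt_const.prodMk (contDiff_const_smul ε).contDiffAt)))

/-- The induced metric is 1 + 2H v ⊗ v with H ≥ 0. By the conventions for square root and division
this sign holds at every point, so no restriction on y is needed. -/
theorem posDef_inducedMetric (hm : 0 < p.m) (y : E3) : (inducedMetric p.metric y).PosDef := by
  set H := 2 * kerrH p.m (1 * p.a) (p.restPoint 1 (slicePoint y)) with hH
  set v : Fin 3 → ℝ := fun i => p.ell 1 (slicePoint y) i.succ with hv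
  have e : inducedMetric p.metric y = 1 + H • Matrix.vecMulVec v (star v) := by
    ext i j
    simp only [inducedMetric, Matrix.of_apply, metric, perturbation, Matrix.add_apply,
      Matrix.smul_apply, Matrix.vecMulVec_apply, hv, star_trivial]
    congr 1
    fin_cases i <;> fin_cases j <;> simp [minkowski]
  have hH0 : 0 ≤ H := by
    have : 0 ≤ kerrRadius (1 * p.a) (p.restPoint 1 (slicePoint y)) := Real.sqrt_nonneg _
    rw [hH, kerrH]; positivity
  rw [e]
  exact Matrix.PosDef.one.add_posSemidef
    ((Matrix.posSemidef_vecMulVec_self_star v).smul hH0)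

end BoostedKerr

/-! ### Spatial rotations -/

section Rotation

variable {R : Matrix (Fin 3) (Fin 3) ℝ} (hR : Rᵀ * R = 1)

/-- The linear isometry given by an orthogonal matrix. -/
noncomputable def rotation (R : Matrix (Fin 3) (Fin 3) ℝ) (hR : Rᵀ * R = 1) : E3 ≃ₗᵢ[ℝ] E3 :=
  LinearIsometry.toLinearIsometryEquiv
    { toLinearMap := Matrix.toEuclideanLin R
      norm_map' := fun y => by
        rw [← sq_eq_sq₀ (norm_nonneg _) (norm_nonneg _), EuclideanSpace.real_norm_sq_eq,
          EuclideanSpace.real_norm_sq_eq]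
        have h : (R *ᵥ y.ofLp) ⬝ᵥ (R *ᵥ y.ofLp) = y.ofLp ⬝ᵥ y.ofLp := by
          rw [Matrix.dotProduct_mulVec, Matrix.vecMul_mulVec, hR, Matrix.vecMul_one]
        simpa [dotProduct, sq] using h } rfl

theorem rotation_apply (y : E3) : (rotation R hR y).ofLp = R *ᵥ y.ofLp := rfl

theorem dotProduct_rotation (u v : Fin 3 → ℝ) (hR : Rᵀ * R = 1) :
    (R *ᵥ u) ⬝ᵥ (R *ᵥ v) = u ⬝ᵥ v := by
  rw [Matrix.dotProduct_mulVec, Matrix.vecMul_mulVec, hR, Matrix.vecMul_one]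

/-- For an orthogonal matrix of determinant 1 the adjugate is the transpose, so its 2×2 minors are
its own entries; these minors are the coefficients of the cross product. -/
theorem crossProduct_rotation (hR : Rᵀ * R = 1) (hdet : R.det = 1) (u v : Fin 3 → ℝ) :
    crossProduct (R *ᵥ u) (R *ᵥ v) = R *ᵥ crossProduct u v := by
  have h : R.adjugate = Rᵀ := by
    have h1 : Rᵀ * (R * R.adjugate) = Rᵀ := by rw [Matrix.mul_adjugate, hdet, one_smul, mul_one]
    rwa [← Matrix.mul_assoc, hR, one_mul] at h1
  rw [Matrix.adjugate_fin_three] at h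
  have e : ∀ i j, _ = Rᵀ i j := fun i j => congrFun (congrFun h i) j
  have e00 := e 0 0
  have e01 := e 0 1
  have e02 := e 0 2
  have e10 := e 1 0
  have e11 := e 1 1
  have e12 := e 1 2
  have e20 := e 2 0
  have e21 := e 2 1
  have e22 := e 2 2
  simp [Matrix.transpose_apply] at e00 e01 e02 e10 e11 e12 e20 e21 e22
  ext i
  fin_cases i <;> simp [crossProduct, Matrix.mulVec, dotProduct, Fin.sum_univ_three]
  · linear_combination (u 1 * v 2 - u 2 * v 1) * e00 + (u 2 * v 0 - u 0 * v 2) * e10 +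
      (u 0 * v 1 - u 1 * v 0) * e20
  · linear_combination (u 1 * v 2 - u 2 * v 1) * e01 + (u 2 * v 0 - u 0 * v 2) * e11 +
      (u 0 * v 1 - u 1 * v 0) * e21
  · linear_combination (u 1 * v 2 - u 2 * v 1) * e02 + (u 2 * v 0 - u 0 * v 2) * e12 +
      (u 0 * v 1 - u 1 * v 0) * e22

/-- The rotation of spacetime about the time axis. -/
def spacetimeRotation (R : Matrix (Fin 3) (Fin 3) ℝ) : Matrix (Fin 4) (Fin 4) ℝ :=
  Matrix.of (Fin.cons (Pi.single 0 1) fun i => Fin.cons 0 (R i))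

@[simp] theorem spacetimeRotation_zero_zero : spacetimeRotation R 0 0 = 1 := rfl

@[simp] theorem spacetimeRotation_zero_succ (i : Fin 3) : spacetimeRotation R 0 i.succ = 0 := rfl

@[simp] theorem spacetimeRotation_succ_zero (i : Fin 3) : spacetimeRotation R i.succ 0 = 0 := rfl

@[simp] theorem spacetimeRotation_succ_succ (i j : Fin 3) :
    spacetimeRotation R i.succ j.succ = R i j := rfl

theorem spacetimeRotation_zero : spacetimeRotation R 0 = Pi.single 0 1 := rfl

theorem spacetimeRotation_transpose : (spacetimeRotation R)ᵀ = spacetimeRotation Rᵀ := by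
  ext i j
  refine Fin.cases ?_ (fun i => ?_) i <;> refine Fin.cases ?_ (fun j => ?_) j <;>
    simp [Matrix.transpose_apply]

theorem spacetimeRotation_mul (A B : Matrix (Fin 3) (Fin 3) ℝ) :
    spacetimeRotation A * spacetimeRotation B = spacetimeRotation (A * B) := by
  ext i j
  refine Fin.cases ?_ (fun i => ?_) i <;> refine Fin.cases ?_ (fun j => ?_) j <;>
    simp [Matrix.mul_apply, Fin.sum_univ_succ (n := 3)]

theorem spacetimeRotation_one : spacetimeRotation 1 = 1 := by
  ext i j
  refine Fin.cases ?_ (fun i => ?_) i <;> refine Fin.cases ?_ (fun j => ?_) j <;>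
    simp [Matrix.one_apply, Fin.succ_ne_zero, (Fin.succ_ne_zero _).symm]

theorem spacetimeRotation_transpose_mul (hR : Rᵀ * R = 1) :
    (spacetimeRotation R)ᵀ * spacetimeRotation R = 1 := by
  rw [spacetimeRotation_transpose, spacetimeRotation_mul, hR, spacetimeRotation_one]

theorem spacetimeRotation_minkowski (hR : Rᵀ * R = 1) :
    (spacetimeRotation R)ᵀ * minkowski * spacetimeRotation R = minkowski := by
  have h : minkowski * spacetimeRotation R = spacetimeRotation R * minkowski := by
    ext i j
    rw [minkowski, Matrix.diagonal_mul, Matrix.mul_diagonal]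
    refine Fin.cases ?_ (fun i => ?_) i <;> refine Fin.cases ?_ (fun j => ?_) j
    · simp
    · simp
    · simp
    · fin_cases i <;> fin_cases j <;> simp
  rw [Matrix.mul_assoc, h, ← Matrix.mul_assoc, spacetimeRotation_transpose_mul hR, one_mul]

theorem spacetimeRotation_det : (spacetimeRotation R).det = R.det := by
  rw [Matrix.det_succ_row_zero, Fin.sum_univ_succ]
  simp only [spacetimeRotation_zero_zero, spacetimeRotation_zero_succ]
  simp
  congr 1

theorem slicePoint_rotation (y : E3) :
    slicePoint (rotation R hR y) = spacetimeRotation R *ᵥ slicePoint y := by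
  ext i
  refine Fin.cases ?_ (fun i => ?_) i
  · simp [slicePoint, Matrix.mulVec, dotProduct, Fin.sum_univ_succ (n := 3)]
  · simp [slicePoint, Matrix.mulVec, dotProduct, Fin.sum_univ_succ (n := 3), rotation_apply]

theorem spacetimeRotation_conj_succ (X : Matrix (Fin 4) (Fin 4) ℝ) :
    (spacetimeRotation R * X * (spacetimeRotation R)ᵀ).submatrix Fin.succ Fin.succ =
      R * X.submatrix Fin.succ Fin.succ * Rᵀ := by
  ext i j
  simp [Matrix.mul_apply, Fin.sum_univ_succ (n := 3), Matrix.transpose_apply]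

/-- The metric `G` in the rotated coordinates. -/
def rotatedMetric (R : Matrix (Fin 3) (Fin 3) ℝ) (G : Tensor4) : Tensor4 := fun x =>
  spacetimeRotation R * G ((spacetimeRotation R)ᵀ *ᵥ x) * (spacetimeRotation R)ᵀ

theorem rotatedMetric_mulVec (hR : Rᵀ * R = 1) (G : Tensor4) (x : Fin 4 → ℝ) :
    rotatedMetric R G (spacetimeRotation R *ᵥ x) =
      spacetimeRotation R * G x * (spacetimeRotation R)ᵀ := by
  rw [rotatedMetric, Matrix.mulVec_mulVec, spacetimeRotation_transpose_mul hR, Matrix.one_mulVec]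

theorem inducedMetric_eq_submatrix (G : Tensor4) (y : E3) :
    inducedMetric G y = (G (slicePoint y)).submatrix Fin.succ Fin.succ := rfl

theorem inducedMetric_rotatedMetric (G : Tensor4) (y : E3) :
    inducedMetric (rotatedMetric R G) (rotation R hR y) = R * inducedMetric G y * Rᵀ := by
  rw [inducedMetric_eq_submatrix, slicePoint_rotation, rotatedMetric_mulVec hR,
    spacetimeRotation_conj_succ, inducedMetric_eq_submatrix]

theorem inducedMetric_rotatedMetric_eq (G : Tensor4) :
    inducedMetric (rotatedMetric R G) =
      fun y => R * inducedMetric G ((rotation R hR).symm y) * Rᵀ := by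
  ext1 y
  rw [← inducedMetric_rotatedMetric hR, LinearIsometryEquiv.apply_symm_apply]

end Rotation

/-! ### Derivatives in rotated coordinates -/

section Derivatives

theorem fderiv_conj_apply {V : Type*} [NormedAddCommGroup V] [NormedSpace ℝ V] {n : ℕ}
    (S : Matrix (Fin n) (Fin n) ℝ) (L : V →L[ℝ] V) {G : V → Matrix (Fin n) (Fin n) ℝ} {x : V}
    (h : ∀ a b, DifferentiableAt ℝ (fun u => G u a b) (L x)) (w : V) (i j : Fin n) :
    fderiv ℝ (fun u => (S * G (L u) * Sᵀ) i j) x w =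
      ∑ a, ∑ b, S i a * S j b * fderiv ℝ (fun u => G u a b) (L x) (L w) := by
  have e : (fun u => (S * G (L u) * Sᵀ) i j) =
      fun u => ∑ a, ∑ b, S i a * S j b * (fun u => G u a b) (L u) := by
    ext u
    simp only [Matrix.mul_apply, Matrix.transpose_apply, Finset.sum_mul]
    rw [Finset.sum_comm]
    exact Finset.sum_congr rfl fun a _ => Finset.sum_congr rfl fun b _ => by ring
  have H : HasFDerivAt (fun u => ∑ a, ∑ b, S i a * S j b * (fun u => G u a b) (L u))
      (∑ a, ∑ b, (S i a * S j b) • (fderiv ℝ (fun u => G u a b) (L x)).comp L) x :=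
    HasFDerivAt.fun_sum fun a _ => HasFDerivAt.fun_sum fun b _ =>
      ((h a b).hasFDerivAt.comp x L.hasFDerivAt).const_mul _
  rw [e, H.fderiv]
  simp

variable {R : Matrix (Fin 3) (Fin 3) ℝ} (hR : Rᵀ * R = 1)

theorem pd4_rotatedMetric (hR : Rᵀ * R = 1) {G : Tensor4} {x : Fin 4 → ℝ}
    (h : ∀ a b, DifferentiableAt ℝ (fun u => G u a b) x) (α μ ν : Fin 4) :
    pd4 α (fun u => rotatedMetric R G u μ ν) (spacetimeRotation R *ᵥ x) =
      ∑ a, ∑ b, ∑ c, spacetimeRotation R μ a * spacetimeRotation R ν b *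
        (spacetimeRotation R α c * pd4 c (fun u => G u a b) x) := by
  set S := spacetimeRotation R with hS
  have hx : Sᵀ *ᵥ (S *ᵥ x) = x := by
    rw [Matrix.mulVec_mulVec, spacetimeRotation_transpose_mul hR, Matrix.one_mulVec]
  set L : (Fin 4 → ℝ) →L[ℝ] (Fin 4 → ℝ) := LinearMap.toContinuousLinearMap (Matrix.mulVecLin Sᵀ)
  have hL : ∀ u, L u = Sᵀ *ᵥ u := fun u => rfl
  have hw : L (Pi.single α 1) = ∑ c, S α c • (Pi.single c 1 : Fin 4 → ℝ) := by
    rw [hL, Matrix.mulVec_single_one, ← pi_eq_sum_univ' (S α)]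
    rfl
  have := fderiv_conj_apply S L (G := G) (x := S *ᵥ x) (by rw [hL, hx]; exact h)
    (Pi.single α 1) μ ν
  refine this.trans ?_
  rw [hw]
  simp only [hL, hx, map_sum, map_smul, smul_eq_mul, Finset.mul_sum]
  rfl

theorem pd3_rotated {g : Tensor3} {y : E3}
    (h : ∀ a b, DifferentiableAt ℝ (fun u => g u a b) y) (k i j : Fin 3) :
    pd3 k (fun u => (R * g ((rotation R hR).symm u) * Rᵀ) i j) (rotation R hR y) =
      ∑ a, ∑ b, ∑ c, R i a * R j b * (R k c * pd3 c (fun u => g u a b) y) := by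
  set L : E3 →L[ℝ] E3 := ((rotation R hR).symm.toContinuousLinearEquiv : E3 →L[ℝ] E3)
  have hL : ∀ u, L u = (rotation R hR).symm u := fun u => rfl
  have hw : L (EuclideanSpace.single k 1) = ∑ c, R k c • (EuclideanSpace.single c 1 : E3) := by
    rw [hL, LinearIsometryEquiv.symm_apply_eq]
    have hRR := mul_eq_one_comm.1 hR
    ext l
    have := congrFun (congrFun hRR l) k
    simp [Matrix.mul_apply, Matrix.one_apply, Matrix.transpose_apply] at this
    simp only [mul_comm (R l _)] at this
    simp [rotation_apply, Finset.sum_apply, this]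
  have := fderiv_conj_apply R L (G := g) (x := rotation R hR y)
    (by rw [hL, LinearIsometryEquiv.symm_apply_apply]; exact h) (EuclideanSpace.single k 1) i j
  refine this.trans ?_
  rw [hw]
  simp only [hL, LinearIsometryEquiv.symm_apply_apply, map_sum, map_smul, smul_eq_mul,
    Finset.mul_sum]
  rfl

/-- Invariance of the trace, in the index form met when contracting derivatives of a rotated tensor.
-/
theorem sum_mul_orthogonal (hR : Rᵀ * R = 1) (X : Fin 3 → Fin 3 → ℝ) :
    ∑ i, ∑ a, ∑ b, R i a * R i b * X a b = ∑ a, X a a := by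
  rw [Finset.sum_comm]
  refine Finset.sum_congr rfl fun a _ => ?_
  rw [Finset.sum_comm]
  have : ∀ b, ∑ i, R i a * R i b * X a b = (1 : Matrix (Fin 3) (Fin 3) ℝ) a b * X a b :=
    fun b => by rw [← hR, Matrix.mul_apply, Finset.sum_mul]; rfl
  simp [this, Matrix.one_apply]

/-- Both terms are contractions of the gradient of g over a pair of indices; the contracted pair
absorbs two rotation factors and one remains. -/
theorem energyDensity_rotated {g : Tensor3} {y : E3}
    (h : ∀ a b, DifferentiableAt ℝ (fun u => g u a b) y) :
    energyDensity (fun u => R * g ((rotation R hR).symm u) * Rᵀ) (rotation R hR y) =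
      R *ᵥ energyDensity g y := by
  ext j
  set D : Fin 3 → Fin 3 → Fin 3 → ℝ := fun c a b => pd3 c (fun u => g u a b) y with hD
  have h1 := sum_mul_orthogonal hR fun a c => ∑ b, R j b * D c a b
  have h2 := sum_mul_orthogonal hR fun a b => ∑ c, R j c * D c a b
  simp only [energyDensity, pd3_rotated hR h, Matrix.mulVec, dotProduct]
  calc _ = ∑ i, ∑ a, ∑ c, R i a * R i c * ∑ b, R j b * D c a b -
      ∑ i, ∑ a, ∑ b, R i a * R i b * ∑ c, R j c * D c a b := by
        rw [← Finset.sum_sub_distrib]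
        refine Finset.sum_congr rfl fun i _ => ?_
        simp only [hD, Fin.sum_univ_three]
        ring
    _ = _ := by
        rw [h1, h2]
        simp only [hD, Fin.sum_univ_three]
        ring

/-! ### The second fundamental form in rotated coordinates -/

/-- The combination of first derivatives in the Christoffel symbols with lowered index `ρ`. -/
noncomputable def loweredChristoffel (G : Tensor4) (x : Fin 4 → ℝ) (ρ : Fin 4) :
    Matrix (Fin 4) (Fin 4) ℝ :=
  Matrix.of fun α β => pd4 α (fun y => G y ρ β) x + pd4 β (fun y => G y ρ α) x -
    pd4 ρ (fun y => G y α β) x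

/-- The contraction of a family of matrices with the first row of a matrix. -/
noncomputable def rowContraction (A : Matrix (Fin 4) (Fin 4) ℝ)
    (K : Fin 4 → Matrix (Fin 4) (Fin 4) ℝ) : Matrix (Fin 4) (Fin 4) ℝ := ∑ ρ, A 0 ρ • K ρ

/-- Matrix form suited to rotations: these fix the time direction, so the lapse stays put and the
contraction with the first row of the inverse can be transformed as a whole. -/
theorem secondFundamentalForm_eq (G : Tensor4) (y : E3) :
    secondFundamentalForm G y = (-(1 / (2 * √(-((G (slicePoint y))⁻¹ 0 0))))) •
      (rowContraction (G (slicePoint y))⁻¹ (loweredChristoffel G (slicePoint y))).submatrix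
        Fin.succ Fin.succ := by
  ext i j
  have hc : (fun x => conormal G x j.succ) = fun _ => 0 := by
    ext x; simp [conormal]
  have hc' : ∀ l : Fin 3, conormal G (slicePoint y) l.succ = 0 := fun l => by simp [conormal]
  have hpd : pd4 i.succ (fun _ : Fin 4 → ℝ => (0 : ℝ)) (slicePoint y) = 0 := by simp [pd4]
  have hn0 : conormal G (slicePoint y) 0 = -(1 / √(-((G (slicePoint y))⁻¹ 0 0))) := by
    simp [conormal]
  have hs : rowContraction (G (slicePoint y))⁻¹ (loweredChristoffel G (slicePoint y)) i.succ j.succ =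
      ∑ ρ, (G (slicePoint y))⁻¹ 0 ρ * loweredChristoffel G (slicePoint y) ρ i.succ j.succ := by
    rw [rowContraction, Matrix.sum_apply]; rfl
  rw [Matrix.smul_apply, Matrix.submatrix_apply, hs]
  have hμ : ∑ μ, christoffel G (slicePoint y) μ i.succ j.succ * conormal G (slicePoint y) μ =
      christoffel G (slicePoint y) 0 i.succ j.succ * conormal G (slicePoint y) 0 := by
    simp only [Fin.sum_univ_succ (n := 3), hc', mul_zero, Finset.sum_const_zero, add_zero]
  simp only [secondFundamentalForm, Matrix.of_apply, hc, hpd, hμ, hn0]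
  simp only [christoffel, loweredChristoffel, smul_eq_mul, Matrix.of_apply]
  ring

/-- The coordinate change is linear, so the inhomogeneous term in the transformation law is absent
and these symbols behave as a tensor. -/
theorem loweredChristoffel_rotatedMetric (hR : Rᵀ * R = 1) {G : Tensor4} {x : Fin 4 → ℝ}
    (h : ∀ a b, DifferentiableAt ℝ (fun u => G u a b) x) (ρ : Fin 4) :
    loweredChristoffel (rotatedMetric R G) (spacetimeRotation R *ᵥ x) ρ =
      ∑ d, spacetimeRotation R ρ d •
        (spacetimeRotation R * loweredChristoffel G x d * (spacetimeRotation R)ᵀ) := by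
  ext α β
  set S := spacetimeRotation R
  set D : Fin 4 → Fin 4 → Fin 4 → ℝ := fun c a b => pd4 c (fun u => G u a b) x with hD
  have e1 : (∑ d, S ρ d • (S * loweredChristoffel G x d * Sᵀ)) α β =
      ∑ d, ∑ a, ∑ b, S ρ d * S α a * S β b * (D a d b + D b d a - D d a b) := by
    rw [Matrix.sum_apply]
    refine Finset.sum_congr rfl fun d _ => ?_
    rw [Matrix.smul_apply, Matrix.mul_apply, smul_eq_mul, Finset.mul_sum, Finset.sum_comm]
    refine Finset.sum_congr rfl fun b _ => ?_
    rw [Matrix.mul_apply, Finset.sum_mul, Finset.mul_sum]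
    refine Finset.sum_congr rfl fun a _ => ?_
    simp only [loweredChristoffel, Matrix.of_apply, Matrix.transpose_apply, hD]
    ring
  rw [e1]
  refine (congrArg₂ (· - ·) (congrArg₂ (· + ·) (pd4_rotatedMetric hR h α ρ β)
    (pd4_rotatedMetric hR h β ρ α)) (pd4_rotatedMetric hR h ρ α β)).trans ?_
  have s1 : ∑ a, ∑ b, ∑ c, S ρ a * S β b * (S α c * D c a b) =
      ∑ d, ∑ a, ∑ b, S ρ d * S α a * S β b * D a d b := by
    refine Finset.sum_congr rfl fun d _ => ?_
    rw [Finset.sum_comm]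
    exact Finset.sum_congr rfl fun a _ => Finset.sum_congr rfl fun b _ => by ring
  have s2 : ∑ a, ∑ b, ∑ c, S ρ a * S α b * (S β c * D c a b) =
      ∑ d, ∑ a, ∑ b, S ρ d * S α a * S β b * D b d a :=
    Finset.sum_congr rfl fun d _ => Finset.sum_congr rfl fun a _ =>
      Finset.sum_congr rfl fun b _ => by ring
  have s3 : ∑ a, ∑ b, ∑ c, S α a * S β b * (S ρ c * D c a b) =
      ∑ d, ∑ a, ∑ b, S ρ d * S α a * S β b * D d a b := by
    rw [Finset.sum_comm (γ := Fin 4) (f := fun d a => ∑ b, S ρ d * S α a * S β b * D d a b)]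
    refine Finset.sum_congr rfl fun a _ => ?_
    rw [Finset.sum_comm]
    exact Finset.sum_congr rfl fun d _ => Finset.sum_congr rfl fun b _ => by ring
  refine (congrArg₂ (· - ·) (congrArg₂ (· + ·) s1 s2) s3).trans ?_
  simp only [mul_sub, mul_add, Finset.sum_sub_distrib, Finset.sum_add_distrib]

theorem secondFundamentalForm_rotatedMetric {G : Tensor4} {y : E3}
    (h : ∀ a b, DifferentiableAt ℝ (fun u => G u a b) (slicePoint y)) :
    secondFundamentalForm (rotatedMetric R G) (rotation R hR y) =
      R * secondFundamentalForm G y * Rᵀ := by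
  set S := spacetimeRotation R
  have hS : Sᵀ * S = 1 := spacetimeRotation_transpose_mul hR
  have hS' : S * Sᵀ = 1 := mul_eq_one_comm.1 hS
  set x := slicePoint y
  have hinv : (S * G x * Sᵀ)⁻¹ = S * (G x)⁻¹ * Sᵀ := by
    rw [Matrix.mul_inv_rev, Matrix.mul_inv_rev, Matrix.inv_eq_right_inv hS,
      Matrix.inv_eq_right_inv hS', Matrix.mul_assoc]
  have h0 : ∀ d, (S * (G x)⁻¹) 0 d = (G x)⁻¹ 0 d := fun d => by
    simp [S, Matrix.mul_apply, Fin.sum_univ_succ (n := 3)]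
  have h00 : (S * (G x)⁻¹ * Sᵀ) 0 0 = (G x)⁻¹ 0 0 := by
    rw [Matrix.mul_apply]
    simp only [h0]
    simp [S, Fin.sum_univ_succ (n := 3), Matrix.transpose_apply]
  have hsum : rowContraction (S * (G x)⁻¹ * Sᵀ)
      (fun ρ => ∑ d, S ρ d • (S * loweredChristoffel G x d * Sᵀ)) =
      S * rowContraction (G x)⁻¹ (loweredChristoffel G x) * Sᵀ := by
    simp only [rowContraction, Finset.smul_sum, smul_smul]
    rw [Finset.sum_comm]
    simp only [← Finset.sum_smul]
    have : ∀ d, ∑ ρ, (S * (G x)⁻¹ * Sᵀ) 0 ρ * S ρ d = (G x)⁻¹ 0 d := fun d => by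
      rw [← Matrix.mul_apply, Matrix.mul_assoc, hS, Matrix.mul_one, h0]
    simp only [this, Matrix.mul_sum, Matrix.sum_mul, Matrix.mul_smul, Matrix.smul_mul]
  rw [secondFundamentalForm_eq, slicePoint_rotation, rotatedMetric_mulVec hR, hinv, h00]
  rw [funext (loweredChristoffel_rotatedMetric hR h), hsum, spacetimeRotation_conj_succ, secondFundamentalForm_eq, Matrix.mul_smul,
    Matrix.smul_mul]

end Derivatives

/-! ### Charges of rotated data -/

section RotatedCharges

variable {R : Matrix (Fin 3) (Fin 3) ℝ} (hR : Rᵀ * R = 1)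

theorem sphereIntegral_rotation {f : E3 → E3 → ℝ} (r : ℝ) :
    sphereIntegral r f = sphereIntegral r fun x ν => f (rotation R hR x) (rotation R hR ν) := by
  rw [sphereIntegral, sphereIntegral,
    ← integral_sphere_comp_isometry (rotation R hR) fun ν => f (r • ν) ν]
  simp

/-- A flux whose density rotates as a vector rotates as a vector. Continuity serves only to
integrate the matrix product term by term. -/
theorem sphereIntegral_rotation_vector {f' : E3 → E3 → ℝ} {f : E3 → E3 → Fin 3 → ℝ} {r : ℝ}
    (hr : 0 ≤ r) (i : Fin 3)
    (h : ∀ x ν : E3, ‖x‖ = r → f' (rotation R hR x) (rotation R hR ν) = (R *ᵥ f x ν) i)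
    (hf : ∀ j, Continuous fun ν : Metric.sphere (0 : E3) 1 => f (r • (ν : E3)) ν j) :
    sphereIntegral r f' = (R *ᵥ fun j => sphereIntegral r fun x ν => f x ν j) i := by
  have hi : ∀ j ∈ Finset.univ, Integrable (fun ν : Metric.sphere (0 : E3) 1 =>
      R i j * f (r • (ν : E3)) ν j) sphereMeasure := fun j _ =>
    ((hf j).integrable_of_hasCompactSupport (HasCompactSupport.of_compactSpace _)).const_mul _
  have e : ∀ ν : Metric.sphere (0 : E3) 1,
      f' (rotation R hR (r • (ν : E3))) (rotation R hR ν) =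
        ∑ j, R i j * f (r • (ν : E3)) ν j := fun ν =>
    h _ _ (by rw [norm_smul, Real.norm_eq_abs, abs_of_nonneg hr]; simp)
  rw [sphereIntegral_rotation hR]
  simp only [sphereIntegral, e]
  rw [integral_finsetSum _ hi]
  simp only [integral_const_mul, Matrix.mulVec, dotProduct, Finset.mul_sum]
  exact Finset.sum_congr rfl fun j _ => by ring

theorem mulVec_conj (hR : Rᵀ * R = 1) (X : Matrix (Fin 3) (Fin 3) ℝ) (v : Fin 3 → ℝ) :
    (R * X * Rᵀ) *ᵥ (R *ᵥ v) = R *ᵥ (X *ᵥ v) := by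
  rw [Matrix.mulVec_mulVec, Matrix.mul_assoc, hR, Matrix.mul_one, Matrix.mulVec_mulVec]

theorem trace_conj (hR : Rᵀ * R = 1) (X : Matrix (Fin 3) (Fin 3) ℝ) :
    (R * X * Rᵀ).trace = X.trace := by
  rw [Matrix.trace_mul_comm, ← Matrix.mul_assoc, hR, Matrix.one_mul]

theorem continuous_coord (j : Fin 3) :
    Continuous fun ν : Metric.sphere (0 : E3) 1 => (ν : E3) j :=
  (by fun_prop : Continuous fun y : E3 => y j).comp continuous_subtype_val

theorem continuous_mulVec_coord {X : Metric.sphere (0 : E3) 1 → Matrix (Fin 3) (Fin 3) ℝ}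
    (h : ∀ i j, Continuous fun ν => X ν i j) (i : Fin 3) :
    Continuous fun ν => (X ν *ᵥ (ν : E3).ofLp) i := by
  simp only [Matrix.mulVec, dotProduct]
  exact continuous_finsetSum _ fun j _ => (h i j).mul (continuous_coord j)

section Momentum

variable {k k' : Tensor3} {r : ℝ}

theorem momentumDensity_rotated (hR : Rᵀ * R = 1) {y y' : E3} (h : k' y' = R * k y * Rᵀ) :
    momentumDensity k' y' = R * momentumDensity k y * Rᵀ := by
  rw [momentumDensity, momentumDensity, h, trace_conj hR, Matrix.mul_sub, Matrix.sub_mul,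
    Matrix.mul_smul, Matrix.smul_mul, Matrix.mul_one, mul_eq_one_comm.1 hR]

theorem continuous_momentumDensity
    (hc : ∀ i j, Continuous fun ν : Metric.sphere (0 : E3) 1 => k (r • (ν : E3)) i j)
    (i j : Fin 3) :
    Continuous fun ν : Metric.sphere (0 : E3) 1 => momentumDensity k (r • (ν : E3)) i j := by
  simp only [momentumDensity_apply]
  exact (hc i j).sub ((continuous_finsetSum _ fun a _ => hc a a).mul continuous_const)

theorem momentumCharge_rotated (hr : 0 ≤ r)
    (h : ∀ y : E3, ‖y‖ = r → k' (rotation R hR y) = R * k y * Rᵀ)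
    (hc : ∀ i j, Continuous fun ν : Metric.sphere (0 : E3) 1 => k (r • (ν : E3)) i j) :
    momentumCharge k' r = R *ᵥ momentumCharge k r := by
  ext i
  refine sphereIntegral_rotation_vector hR (f := fun x ν => momentumDensity k x *ᵥ ν) hr i
    (fun x ν hx => ?_) fun j => ?_
  · change (momentumDensity k' (rotation R hR x) *ᵥ (R *ᵥ ν.ofLp)) i = _
    rw [momentumDensity_rotated hR (h x hx), mulVec_conj hR]
  · exact continuous_mulVec_coord (continuous_momentumDensity hc) j

/-- By (e_l × x) · w = (x × w)_l the three fluxes are the components of one vector density. -/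
theorem angularCharge_eq (k : Tensor3) (r : ℝ) (l : Fin 3) :
    angularCharge k r l = sphereIntegral r fun x ν =>
      crossProduct x.ofLp (momentumDensity k x *ᵥ ν.ofLp) l := by
  rw [angularCharge]
  congr 1
  ext x ν
  have : ∑ i, ∑ j, momentumDensity k x i j * rotationField l x i * ν j =
      rotationField l x ⬝ᵥ (momentumDensity k x *ᵥ ν.ofLp) := by
    simp only [dotProduct, Matrix.mulVec, Finset.mul_sum]
    exact Finset.sum_congr rfl fun i _ => Finset.sum_congr rfl fun j _ => by ring
  rw [this]
  generalize momentumDensity k x *ᵥ ν.ofLp = w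
  fin_cases l <;> simp [rotationField, crossProduct, dotProduct, Fin.sum_univ_three] <;> ring

/-- Unlike the other charges, this one needs determinant 1, since a cross product changes sign under
reflections. -/
theorem angularCharge_rotated (hdet : R.det = 1) (hr : 0 ≤ r)
    (h : ∀ y : E3, ‖y‖ = r → k' (rotation R hR y) = R * k y * Rᵀ)
    (hc : ∀ i j, Continuous fun ν : Metric.sphere (0 : E3) 1 => k (r • (ν : E3)) i j) :
    angularCharge k' r = R *ᵥ angularCharge k r := by
  ext i
  rw [angularCharge_eq, funext (angularCharge_eq k r)]
  refine sphereIntegral_rotation_vector hR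
    (f := fun x ν => crossProduct x.ofLp (momentumDensity k x *ᵥ ν.ofLp)) hr i
    (fun x ν hx => ?_) fun j => ?_
  · simp only [rotation_apply]
    rw [momentumDensity_rotated hR (h x hx), mulVec_conj hR, crossProduct_rotation hR hdet]
  · have hw : ∀ j, Continuous fun ν : Metric.sphere (0 : E3) 1 =>
        (momentumDensity k (r • (ν : E3)) *ᵥ (ν : E3).ofLp) j :=
      continuous_mulVec_coord (continuous_momentumDensity hc)
    have hx : ∀ j, Continuous fun ν : Metric.sphere (0 : E3) 1 => r * (ν : E3) j := fun j =>
      continuous_const.mul (continuous_coord j)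
    fin_cases j <;> simp only [crossProduct]
    · exact ((hx 1).mul (hw 2)).sub ((hx 2).mul (hw 1))
    · exact ((hx 2).mul (hw 0)).sub ((hx 0).mul (hw 2))
    · exact ((hx 0).mul (hw 1)).sub ((hx 1).mul (hw 0))

end Momentum

section Energy

variable {g : Tensor3} {r : ℝ}

theorem energyCharge_rotated (hr : 0 ≤ r)
    (h : ∀ y : E3, ‖y‖ = r → ∀ a b, DifferentiableAt ℝ (fun u => g u a b) y) :
    energyCharge (fun y => R * g ((rotation R hR).symm y) * Rᵀ) r = energyCharge g r := by
  rw [energyCharge, energyCharge, sphereIntegral_rotation hR, sphereIntegral, sphereIntegral]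
  congr 2
  refine integral_congr_ae (Eventually.of_forall fun ν => ?_)
  have hx : ‖r • (ν : E3)‖ = r := by
    rw [norm_smul, Real.norm_eq_abs, abs_of_nonneg hr]; simp
  change energyDensity _ _ ⬝ᵥ (R *ᵥ (ν : E3).ofLp) = energyDensity _ _ ⬝ᵥ (ν : E3).ofLp
  rw [energyDensity_rotated hR (h _ hx), dotProduct_rotation _ _ hR]

/-- The center of mass flux density as a vector. -/
noncomputable def centerVector (x u : Fin 3 → ℝ) (X : Matrix (Fin 3) (Fin 3) ℝ) (ν : Fin 3 → ℝ) :
    Fin 3 → ℝ :=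
  (u ⬝ᵥ ν) • x - X *ᵥ ν + X.trace • ν

theorem centerVector_rotated (hR : Rᵀ * R = 1) (x u : Fin 3 → ℝ) (X : Matrix (Fin 3) (Fin 3) ℝ)
    (ν : Fin 3 → ℝ) :
    centerVector (R *ᵥ x) (R *ᵥ u) (R * X * Rᵀ) (R *ᵥ ν) = R *ᵥ centerVector x u X ν := by
  rw [centerVector, centerVector, dotProduct_rotation _ _ hR, mulVec_conj hR, trace_conj hR,
    Matrix.mulVec_add, Matrix.mulVec_sub, Matrix.mulVec_smul, Matrix.mulVec_smul]

theorem centerCharge_eq (g : Tensor3) (r : ℝ) (l : Fin 3) :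
    centerCharge g r l = (1 / 2) * sphereIntegral r fun x ν =>
      centerVector x.ofLp (energyDensity g x) (g x - 1) ν.ofLp l := by
  rw [centerCharge]
  congr 2
  ext x ν
  simp only [centerVector, Pi.add_apply, Pi.sub_apply, Pi.smul_apply, smul_eq_mul, dotProduct,
    Matrix.mulVec, add_mul, sub_mul, Finset.sum_add_distrib, Finset.sum_sub_distrib, ite_mul,
    zero_mul, Finset.sum_ite_eq', Finset.mem_univ, if_true, Finset.sum_mul]
  congr 2
  exact Finset.sum_congr rfl fun j _ => by ring

theorem centerCharge_rotated (hr : 0 ≤ r)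
    (h : ∀ y : E3, ‖y‖ = r → ∀ a b, ContDiffAt ℝ ∞ (fun u => g u a b) y) :
    centerCharge (fun y => R * g ((rotation R hR).symm y) * Rᵀ) r = R *ᵥ centerCharge g r := by
  have hx : ∀ ν : Metric.sphere (0 : E3) 1, ‖r • (ν : E3)‖ = r := fun ν => by
    rw [norm_smul, Real.norm_eq_abs, abs_of_nonneg hr]; simp
  have hval : ∀ a b, Continuous fun ν : Metric.sphere (0 : E3) 1 => (g (r • (ν : E3)) - 1) a b :=
    fun a b => continuous_iff_continuousAt.2 fun ν =>
      ((h _ (hx ν) a b).continuousAt.comp (f := fun ν : Metric.sphere (0 : E3) 1 => r • (ν : E3))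
        (by fun_prop)).sub continuousAt_const
  have hpd : ∀ i a b, Continuous fun ν : Metric.sphere (0 : E3) 1 =>
      pd3 i (fun u => g u a b) (r • (ν : E3)) := fun i a b =>
    continuous_iff_continuousAt.2 fun ν =>
      ContinuousAt.comp (f := fun ν : Metric.sphere (0 : E3) 1 => r • (ν : E3))
        (g := pd3 i fun u => g u a b)
        (((h _ (hx ν) a b).fderiv_right (m := ∞) (by simp)).clm_apply
          contDiffAt_const).continuousAt (by fun_prop)
  have hed : ∀ j, Continuous fun ν : Metric.sphere (0 : E3) 1 =>
      energyDensity g (r • (ν : E3)) j := fun j =>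
    continuous_finsetSum _ fun i _ => (hpd i i j).sub (hpd j i i)
  ext l
  have H := sphereIntegral_rotation_vector hR
    (f' := fun x ν => centerVector x.ofLp
      (energyDensity (fun y => R * g ((rotation R hR).symm y) * Rᵀ) x)
      (R * g ((rotation R hR).symm x) * Rᵀ - 1) ν.ofLp l)
    (f := fun x ν => centerVector x.ofLp (energyDensity g x) (g x - 1) ν.ofLp) hr l
    (fun x ν hx => ?_) fun j => ?_
  · rw [centerCharge_eq, H, funext (centerCharge_eq g r)]
    simp only [Matrix.mulVec, dotProduct, Finset.mul_sum]
    exact Finset.sum_congr rfl fun j _ => by ring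
  · have e : R * g x * Rᵀ - 1 = R * (g x - 1) * Rᵀ := by
      rw [Matrix.mul_sub, Matrix.sub_mul, Matrix.mul_one, mul_eq_one_comm.1 hR]
    simp only [rotation_apply, LinearIsometryEquiv.symm_apply_apply]
    rw [energyDensity_rotated hR fun a b => (h x hx a b).differentiableAt (by simp), e,
      centerVector_rotated hR]
  · have hr' : Continuous fun ν : Metric.sphere (0 : E3) 1 => r * (ν : E3) j :=
      continuous_const.mul (continuous_coord j)
    have h1 : Continuous fun ν : Metric.sphere (0 : E3) 1 =>
        energyDensity g (r • (ν : E3)) ⬝ᵥ (ν : E3).ofLp :=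
      continuous_finsetSum _ fun a _ => (hed a).mul (continuous_coord a)
    have h2 : Continuous fun ν : Metric.sphere (0 : E3) 1 => (g (r • (ν : E3)) - 1).trace :=
      continuous_finsetSum _ fun a _ => hval a a
    exact ((h1.mul hr').sub (continuous_mulVec_coord hval j)).add (h2.mul (continuous_coord j))

end Energy

end RotatedCharges

/-! ### Adapted orthonormal frames -/

section Frames

theorem exists_unit_smul {q : Fin 3 → ℝ} (hq : q ≠ 0) :
    ∃ (u : Fin 3 → ℝ) (t : ℝ), u ⬝ᵥ u = 1 ∧ t ≠ 0 ∧ q = t • u := by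
  have h0 : 0 < q ⬝ᵥ q := by
    have : 0 ≤ q ⬝ᵥ q := Finset.sum_nonneg fun i _ => mul_self_nonneg (q i)
    exact lt_of_le_of_ne this fun h => hq (dotProduct_self_eq_zero.1 h.symm)
  have hs : √(q ⬝ᵥ q) ≠ 0 := (Real.sqrt_pos.2 h0).ne'
  refine ⟨(√(q ⬝ᵥ q))⁻¹ • q, √(q ⬝ᵥ q), ?_, hs, ?_⟩
  · rw [smul_dotProduct, dotProduct_smul, smul_smul, smul_eq_mul, ← mul_inv,
      Real.mul_self_sqrt h0.le, inv_mul_cancel₀ h0.ne']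
  · rw [smul_smul, mul_inv_cancel₀ hs, one_smul]

theorem exists_orthogonal_unit {w q : Fin 3 → ℝ} (hq : q ⬝ᵥ w = 0) :
    ∃ (u : Fin 3 → ℝ) (t : ℝ), u ⬝ᵥ u = 1 ∧ u ⬝ᵥ w = 0 ∧ q = t • u := by
  by_cases h : q = 0
  · obtain ⟨q', hq', hne⟩ : ∃ q' : Fin 3 → ℝ, q' ⬝ᵥ w = 0 ∧ q' ≠ 0 := by
      by_cases h0 : w 0 = 0 ∧ w 1 = 0
      · refine ⟨![1, 0, 0], by simp [dotProduct, Fin.sum_univ_three, h0.1], fun h => ?_⟩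
        simpa using congrFun h 0
      · refine ⟨![-w 1, w 0, 0], by simp [dotProduct, Fin.sum_univ_three]; ring,
          fun h => h0 ⟨?_, ?_⟩⟩
        · simpa using congrFun h 1
        · simpa using congrFun h 0
    obtain ⟨u, t, hu, ht, rfl⟩ := exists_unit_smul hne
    rw [smul_dotProduct, smul_eq_mul, mul_eq_zero] at hq'
    exact ⟨u, 0, hu, hq'.resolve_left ht, by simp [h]⟩
  · obtain ⟨u, t, hu, ht, rfl⟩ := exists_unit_smul h
    rw [smul_dotProduct, smul_eq_mul, mul_eq_zero] at hq
    exact ⟨u, t, hu, hq.resolve_left ht, rfl⟩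

/-- Two vectors lie in the plane of the first and third axis of a rotated frame, the first of them
along the third axis. -/
theorem exists_adapted_rotation (P J : Fin 3 → ℝ) :
    ∃ (R : Matrix (Fin 3) (Fin 3) ℝ) (ρ j₁ j₃ : ℝ), Rᵀ * R = 1 ∧ R.det = 1 ∧
      P = R *ᵥ ![0, 0, ρ] ∧ J = R *ᵥ ![j₁, 0, j₃] := by
  obtain ⟨w, ρ, hw, rfl⟩ : ∃ (w : Fin 3 → ℝ) (ρ : ℝ), w ⬝ᵥ w = 1 ∧ P = ρ • w := by
    by_cases h : P = 0
    · exact ⟨Pi.single 0 1, 0, by simp, by simp [h]⟩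
    · obtain ⟨u, t, hu, -, ht⟩ := exists_unit_smul h
      exact ⟨u, t, hu, ht⟩
  -- The first axis is along the part of J orthogonal to P, and arbitrary in that plane when this
  -- part vanishes.
  obtain ⟨u, t, hu, huw, ht⟩ := exists_orthogonal_unit (w := w) (q := J - (J ⬝ᵥ w) • w)
    (by rw [sub_dotProduct, smul_dotProduct, hw]; simp)
  set v := crossProduct w u with hv
  -- This orients the frame u, v, w: the determinant is the triple product u · (v × w) = u · u = 1.
  have hvw : crossProduct v w = u := by
    rw [hv, cross_cross_eq_smul_sub_smul, hw, huw]
    simp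
  have hvv : v ⬝ᵥ v = 1 := by
    rw [hv, cross_dot_cross, hw, hu, huw]; simp
  have huv : u ⬝ᵥ v = 0 := dot_cross_self w u
  have hwv : w ⬝ᵥ v = 0 := dot_self_cross w u
  have hA : Matrix.of ![u, v, w] * (Matrix.of ![u, v, w])ᵀ = 1 := by
    ext i j
    change (![u, v, w] i) ⬝ᵥ (![u, v, w] j) = _
    fin_cases i <;> fin_cases j <;>
      simp [hu, hw, hvv, huv, hwv, huw, dotProduct_comm v u, dotProduct_comm v w,
        dotProduct_comm w u]
  have hmul : ∀ a b : ℝ, (Matrix.of ![u, v, w])ᵀ *ᵥ ![a, 0, b] = a • u + b • w := fun a b => by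
    ext i
    simp [Matrix.mulVec, dotProduct, Fin.sum_univ_three, Matrix.transpose_apply]
    ring
  refine ⟨(Matrix.of ![u, v, w])ᵀ, ρ, t, J ⬝ᵥ w, by rwa [Matrix.transpose_transpose], ?_, ?_, ?_⟩
  · rw [Matrix.det_transpose]
    exact (triple_product_eq_det u v w).symm.trans (by rw [hvw, hu])
  · rw [hmul]; simp
  · rw [hmul, ← ht]; simp

end Frames

/-! ### The asymptotics of the rotated boosted Kerr metric -/

/-- A tube argument: continuity holds near each point (0, v), and compactness of the sphere gives a
common interval of parameters. It supplies the integrability needed to rotate the fluxes of k. -/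
theorem eventually_continuousAt {F : ℝ → E3 → ℝ}
    (h : ∀ v : E3, ‖v‖ = 1 → ContDiffAt ℝ ∞ (Function.uncurry F) (0, v)) :
    ∀ᶠ ε in 𝓝 (0 : ℝ), ∀ v : E3, ‖v‖ = 1 → ContinuousAt (F ε) v := by
  have := (isCompact_sphere (0 : E3) 1).eventually_forall_of_forall_eventually
    (x₀ := (0 : ℝ)) (P := fun ε v => ContinuousAt (F ε) v) fun v hv => by
      have h1 := ((h v (by simpa using hv)).of_le (m := 1)
        (one_le_two.trans two_le_infty)).eventually (by simp)
      filter_upwards [h1] with q hq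
      exact ContinuousAt.comp (f := fun u : E3 => (q.1, u)) (g := Function.uncurry F)
        (x := q.2) hq.continuousAt (by fun_prop)
  filter_upwards [this] with ε hε v hv
  exact hε v (by simpa using hv)

theorem contDiffAt_rotatedMetric {R : Matrix (Fin 3) (Fin 3) ℝ} {hR : Rᵀ * R = 1} {G : Tensor4}
    {y : E3} (h : ∀ μ ν, ContDiffAt ℝ ∞ (fun x => G x μ ν) (slicePoint y)) (μ ν : Fin 4) :
    ContDiffAt ℝ ∞ (fun x => rotatedMetric R G x μ ν) (slicePoint (rotation R hR y)) := by
  set S := spacetimeRotation R with hS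
  have e : (fun x => rotatedMetric R G x μ ν) =
      fun x => ∑ a, ∑ b, S μ a * S ν b * (fun u => G u a b) (Sᵀ *ᵥ x) := by
    ext x
    simp only [rotatedMetric, Matrix.mul_apply, Matrix.transpose_apply, Finset.sum_mul]
    rw [Finset.sum_comm]
    exact Finset.sum_congr rfl fun a _ => Finset.sum_congr rfl fun b _ => by ring
  have hL : ContDiff ℝ ∞ fun x : Fin 4 → ℝ => Sᵀ *ᵥ x :=
    (LinearMap.toContinuousLinearMap (Matrix.mulVecLin Sᵀ)).contDiff
  rw [e]
  refine ContDiffAt.sum fun a _ => ContDiffAt.sum fun b _ => contDiffAt_const.mul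
    (ContDiffAt.comp (slicePoint (rotation R hR y)) (f := fun x => Sᵀ *ᵥ x)
      (g := fun u => G u a b) ?_ hL.contDiffAt)
  rw [slicePoint_rotation, Matrix.mulVec_mulVec, spacetimeRotation_transpose_mul hR,
    Matrix.one_mulVec]
  exact h a b

theorem posDef_conj {R : Matrix (Fin 3) (Fin 3) ℝ} (hR : Rᵀ * R = 1)
    {X : Matrix (Fin 3) (Fin 3) ℝ} (hX : X.PosDef) : (R * X * Rᵀ).PosDef := by
  have := hX.mul_mul_conjTranspose_same (B := R) (Function.LeftInverse.injective
    (g := Rᵀ.vecMul) fun v => by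
      change (v ᵥ* R) ᵥ* Rᵀ = v
      rw [Matrix.vecMul_vecMul, mul_eq_one_comm.1 hR, Matrix.vecMul_one])
  rwa [Matrix.conjTranspose_eq_transpose_of_trivial] at this

theorem abs_mulVec_sub_le {R : Matrix (Fin 3) (Fin 3) ℝ} {u v : Fin 3 → ℝ} {B : ℝ}
    (h : ∀ j, |u j - v j| ≤ B) (i : Fin 3) :
    |(R *ᵥ u) i - (R *ᵥ v) i| ≤ (∑ j, |R i j|) * B := by
  have e : (R *ᵥ u) i - (R *ᵥ v) i = ∑ j, R i j * (u j - v j) := by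
    simp only [Matrix.mulVec, dotProduct, mul_sub, Finset.sum_sub_distrib]
  rw [e, Finset.sum_mul]
  refine (Finset.abs_sum_le_sum_abs _ _).trans (Finset.sum_le_sum fun j _ => ?_)
  rw [abs_mul]
  exact mul_le_mul_of_nonneg_left (h j) (abs_nonneg _)

theorem abs_conj_le {R X : Matrix (Fin 3) (Fin 3) ℝ} {B : ℝ} (h : ∀ a b, |X a b| ≤ B)
    (i j : Fin 3) : |(R * X * Rᵀ) i j| ≤ (∑ b, ∑ a, |R i a| * |R j b|) * B := by
  have e : (R * X * Rᵀ) i j = ∑ b, ∑ a, R i a * R j b * X a b := by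
    simp only [Matrix.mul_apply, Matrix.transpose_apply, Finset.sum_mul]
    exact Finset.sum_congr rfl fun b _ => Finset.sum_congr rfl fun a _ => by ring
  rw [e, Finset.sum_mul]
  refine (Finset.abs_sum_le_sum_abs _ _).trans (Finset.sum_le_sum fun b _ => ?_)
  rw [Finset.sum_mul]
  refine (Finset.abs_sum_le_sum_abs _ _).trans (Finset.sum_le_sum fun a _ => ?_)
  rw [abs_mul, abs_mul]
  exact mul_le_mul_of_nonneg_left (h a b) (by positivity)

theorem eventually_mulVec_sub_le {R : Matrix (Fin 3) (Fin 3) ℝ} {u : ℝ → Fin 3 → ℝ}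
    {v : Fin 3 → ℝ} (h : ∀ j, ∃ C, ∀ᶠ ε in 𝓝[>] (0 : ℝ), |u ε⁻¹ j - v j| ≤ C * ε) (i : Fin 3) :
    ∃ C, ∀ᶠ ε in 𝓝[>] (0 : ℝ), |(R *ᵥ u ε⁻¹) i - (R *ᵥ v) i| ≤ C * ε := by
  obtain ⟨C, hC⟩ := exists_common_bound (P := fun j C ε => |u ε⁻¹ j - v j| ≤ C * ε)
    (fun j C C' ε hε hC h => h.trans (by gcongr)) h
  refine ⟨(∑ j, |R i j|) * C, hC.mono fun ε hε => ?_⟩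
  rw [mul_assoc]
  exact abs_mulVec_sub_le hε i

namespace BoostedKerr

variable {p : BoostedKerr} {R : Matrix (Fin 3) (Fin 3) ℝ}

theorem transform_eq_rotatedMetric (hR : Rᵀ * R = 1) (hdet : R.det = 1) :
    (p.transformation (spacetimeRotation R) (spacetimeRotation_minkowski hR)
      (spacetimeRotation_det.trans hdet) spacetimeRotation_zero).transform (kerrMetric p.m p.a) =
      rotatedMetric R p.metric :=
  funext fun x => p.transform_kerrMetric _ _ _ _ (spacetimeRotation_transpose_mul hR) x

theorem eventually_contDiffAt_metric :
    ∀ᶠ ε in 𝓝[>] (0 : ℝ), ∀ y : E3, ‖y‖ = ε⁻¹ → ∀ μ ν,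
      ContDiffAt ℝ ∞ (fun x => p.metric x μ ν) (slicePoint y) := by
  filter_upwards [p.eventually_regular] with ε hr y hy μ ν
  exact contDiffAt_metric hr.1 hr.2 hy μ ν

theorem eventually_secondForm_rotated (hR : Rᵀ * R = 1) :
    ∀ᶠ ε in 𝓝[>] (0 : ℝ), ∀ y : E3, ‖y‖ = ε⁻¹ →
      secondFundamentalForm (rotatedMetric R p.metric) (rotation R hR y) =
        R * secondFundamentalForm p.metric y * Rᵀ := by
  filter_upwards [p.eventually_contDiffAt_metric] with ε h y hy
  exact secondFundamentalForm_rotatedMetric hR fun a b =>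
    (h y hy a b).differentiableAt (by simp)

theorem eventually_continuous_secondForm :
    ∀ᶠ ε in 𝓝[>] (0 : ℝ), ∀ i j, Continuous fun ν : Metric.sphere (0 : E3) 1 =>
      secondFundamentalForm p.metric (ε⁻¹ • (ν : E3)) i j := by
  have h : ∀ᶠ ε in 𝓝 (0 : ℝ), ∀ i j, ∀ v : E3, ‖v‖ = 1 →
      ContinuousAt (fun y => scaledSecondForm ε (p.perturbation ε) y i j) v :=
    eventually_all.2 fun i => eventually_all.2 fun j => eventually_continuousAt
      fun v hv => contDiffAt_scaledSecondForm hv i j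
  filter_upwards [h.filter_mono nhdsWithin_le_nhds, p.eventually_regular] with ε hc hr i j
  have hε := hr.1
  have e : (fun ν : Metric.sphere (0 : E3) 1 =>
      secondFundamentalForm p.metric (ε⁻¹ • (ν : E3)) i j) =
      fun ν : Metric.sphere (0 : E3) 1 =>
        ε ^ 2 * scaledSecondForm ε (p.perturbation ε) ν i j := by
    ext ν
    rw [secondFundamentalForm_metric hε hr.2
      (by rw [norm_smul, Real.norm_eq_abs, abs_of_pos (inv_pos.2 hε)]; simp), smul_smul,
      mul_inv_cancel₀ hε.ne', one_smul]
    rfl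
  rw [e]
  exact continuous_const.mul (continuous_iff_continuousAt.2 fun ν =>
    (hc i j ν (by simp)).comp continuous_subtype_val.continuousAt)

theorem contDiffAt_inducedMetric {y : E3}
    (h : ∀ μ ν, ContDiffAt ℝ ∞ (fun x => p.metric x μ ν) (slicePoint y)) (a b : Fin 3) :
    ContDiffAt ℝ ∞ (fun u => inducedMetric p.metric u a b) y :=
  ContDiffAt.comp y (f := slicePoint) (h a.succ b.succ) contDiff_slicePoint.contDiffAt

theorem rotated_energyCharge_asymptotics (hR : Rᵀ * R = 1) :
    ∃ C, ∀ᶠ ε in 𝓝[>] (0 : ℝ),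
      |energyCharge (inducedMetric (rotatedMetric R p.metric)) ε⁻¹ - 8 * Real.pi * p.m * p.γ| ≤
        C * ε := by
  obtain ⟨C, hC⟩ := p.energyCharge_asymptotics
  refine ⟨C, ?_⟩
  filter_upwards [hC, p.eventually_contDiffAt_metric, p.eventually_regular] with ε hε h hr
  rwa [inducedMetric_rotatedMetric_eq hR, energyCharge_rotated hR (inv_pos.2 hr.1).le
    fun y hy a b => (contDiffAt_inducedMetric (h y hy) a b).differentiableAt (by simp)]

theorem rotated_centerCharge_asymptotics (hR : Rᵀ * R = 1) (i : Fin 3) :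
    ∃ C, ∀ᶠ ε in 𝓝[>] (0 : ℝ),
      |centerCharge (inducedMetric (rotatedMetric R p.metric)) ε⁻¹ i -
        (R *ᵥ ![0, 8 * Real.pi * p.m * (p.γ * p.ζ - p.β * (p.a * p.s)), 0]) i| ≤ C * ε := by
  obtain ⟨C, hC⟩ := eventually_mulVec_sub_le (R := R) p.centerCharge_asymptotics i
  refine ⟨C, ?_⟩
  filter_upwards [hC, p.eventually_contDiffAt_metric, p.eventually_regular] with ε hε h hr
  rwa [inducedMetric_rotatedMetric_eq hR, centerCharge_rotated hR (inv_pos.2 hr.1).le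
    fun y hy => contDiffAt_inducedMetric (h y hy)]

theorem rotated_momentumCharge_asymptotics (hR : Rᵀ * R = 1) (i : Fin 3) :
    ∃ C, ∀ᶠ ε in 𝓝[>] (0 : ℝ),
      |momentumCharge (secondFundamentalForm (rotatedMetric R p.metric)) ε⁻¹ i -
        (R *ᵥ ![0, 0, -(8 * Real.pi * p.m * p.β)]) i| ≤ C * ε := by
  obtain ⟨C, hC⟩ := eventually_mulVec_sub_le (R := R) p.momentumCharge_asymptotics i
  refine ⟨C, ?_⟩
  filter_upwards [hC, p.eventually_secondForm_rotated hR, p.eventually_continuous_secondForm,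
    p.eventually_regular] with ε hε h hc hr
  rwa [momentumCharge_rotated hR (inv_pos.2 hr.1).le h hc]

theorem rotated_angularCharge_asymptotics (hR : Rᵀ * R = 1) (hdet : R.det = 1) (i : Fin 3) :
    ∃ C, ∀ᶠ ε in 𝓝[>] (0 : ℝ),
      |angularCharge (secondFundamentalForm (rotatedMetric R p.metric)) ε⁻¹ i -
        (R *ᵥ ![8 * Real.pi * p.m * (p.γ * (p.a * p.s) - p.β * p.ζ), 0,
          8 * Real.pi * p.m * (p.a * p.c)]) i| ≤ C * ε := by
  obtain ⟨C, hC⟩ := eventually_mulVec_sub_le (R := R) p.angularCharge_asymptotics i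
  refine ⟨C, ?_⟩
  filter_upwards [hC, p.eventually_secondForm_rotated hR, p.eventually_continuous_secondForm,
    p.eventually_regular] with ε hε h hc hr
  rwa [angularCharge_rotated hR hdet (inv_pos.2 hr.1).le h hc]

theorem rotated_metric_decay (hR : Rᵀ * R = 1) (i j : Fin 3) :
    ∃ C, ∀ᶠ ε in 𝓝[>] (0 : ℝ), ∀ y : E3, ‖y‖ = ε⁻¹ →
      |(inducedMetric (rotatedMetric R p.metric) y - 1) i j| ≤ C * ε := by
  obtain ⟨C, hC⟩ := exists_common_bound (P := fun (q : Fin 3 × Fin 3) C ε => ∀ y : E3, ‖y‖ = ε⁻¹ →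
      |(inducedMetric p.metric y - 1) q.1 q.2| ≤ C * ε)
    (fun j C C' ε hε hC h y hy => (h y hy).trans (by gcongr)) fun q => p.metric_decay q.1 q.2
  refine ⟨(∑ b, ∑ a, |R i a| * |R j b|) * C, hC.mono fun ε hε y hy => ?_⟩
  have e : inducedMetric (rotatedMetric R p.metric) y - 1 =
      R * (inducedMetric p.metric ((rotation R hR).symm y) - 1) * Rᵀ := by
    rw [inducedMetric_rotatedMetric_eq hR, Matrix.mul_sub, Matrix.sub_mul, Matrix.mul_one,
      mul_eq_one_comm.1 hR]
  have hy' : ‖(rotation R hR).symm y‖ = ε⁻¹ := by rw [LinearIsometryEquiv.norm_map, hy]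
  rw [e, mul_assoc (∑ b, _) C]
  exact abs_conj_le (X := inducedMetric p.metric ((rotation R hR).symm y) - 1)
    (fun a b => hε (a, b) _ hy') i j

theorem rotated_secondForm_decay (hR : Rᵀ * R = 1) (i j : Fin 3) :
    ∃ C, ∀ᶠ ε in 𝓝[>] (0 : ℝ), ∀ y : E3, ‖y‖ = ε⁻¹ →
      |secondFundamentalForm (rotatedMetric R p.metric) y i j| ≤ C * ε ^ 2 := by
  obtain ⟨C, hC⟩ := exists_common_bound (P := fun (q : Fin 3 × Fin 3) C ε => ∀ y : E3, ‖y‖ = ε⁻¹ →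
      |secondFundamentalForm p.metric y q.1 q.2| ≤ C * ε ^ 2)
    (fun j C C' ε hε hC h y hy => (h y hy).trans (by gcongr)) fun q => p.secondForm_decay q.1 q.2
  refine ⟨(∑ b, ∑ a, |R i a| * |R j b|) * C, ?_⟩
  filter_upwards [hC, p.eventually_secondForm_rotated hR] with ε hε h y hy
  have hy' : ‖(rotation R hR).symm y‖ = ε⁻¹ := by rw [LinearIsometryEquiv.norm_map, hy]
  have e := h _ hy'
  rw [LinearIsometryEquiv.apply_symm_apply] at e
  rw [e, mul_assoc (∑ b, _) C]
  exact abs_conj_le (X := secondFundamentalForm p.metric ((rotation R hR).symm y))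
    (fun a b => hε (a, b) _ hy') i j

theorem rotated_regular (hR : Rᵀ * R = 1) (hm : 0 < p.m) :
    ∀ᶠ ε in 𝓝[>] (0 : ℝ), ∀ y : E3, ‖y‖ = ε⁻¹ →
      (∀ μ ν, ContDiffAt ℝ ∞ (fun x => rotatedMetric R p.metric x μ ν) (slicePoint y)) ∧
        (inducedMetric (rotatedMetric R p.metric) y).PosDef := by
  filter_upwards [p.eventually_contDiffAt_metric] with ε h y hy
  obtain ⟨u, rfl⟩ := (rotation R hR).surjective y
  refine ⟨contDiffAt_rotatedMetric (h u (by rwa [LinearIsometryEquiv.norm_map] at hy)), ?_⟩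
  rw [inducedMetric_rotatedMetric hR]
  exact posDef_conj hR (posDef_inducedMetric hm u)

/-! ### Solving for the parameters -/

theorem exists_polar (x y : ℝ) : ∃ a c s : ℝ, c ^ 2 + s ^ 2 = 1 ∧ a * s = x ∧ a * c = y := by
  by_cases h : x ^ 2 + y ^ 2 = 0
  · have h1 : x = 0 := by nlinarith [sq_nonneg x, sq_nonneg y]
    have h3 : y = 0 := by nlinarith [sq_nonneg x, sq_nonneg y]
    exact ⟨0, 1, 0, by norm_num, by rw [h1]; simp, by rw [h3]; simp⟩
  · have h0 : 0 < x ^ 2 + y ^ 2 := lt_of_le_of_ne (by positivity) (Ne.symm h)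
    have hq := (Real.sqrt_pos.2 h0).ne'
    refine ⟨√(x ^ 2 + y ^ 2), y / √(x ^ 2 + y ^ 2), x / √(x ^ 2 + y ^ 2), ?_,
      mul_div_cancel₀ _ hq, mul_div_cancel₀ _ hq⟩
    rw [div_pow, div_pow, ← add_div, Real.sq_sqrt h0.le, add_comm, div_self h0.ne']

/-- The values of the parameters for given charges, in the adapted frame. -/
theorem exists_parameters {E ρ : ℝ} (hE : |ρ| < E) (j₁ j₃ : ℝ) :
    ∃ p : BoostedKerr, 0 < p.m ∧ 8 * Real.pi * p.m * p.γ = E ∧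
      -(8 * Real.pi * p.m * p.β) = ρ ∧ p.γ * p.ζ - p.β * (p.a * p.s) = 0 ∧
      8 * Real.pi * p.m * (p.γ * (p.a * p.s) - p.β * p.ζ) = j₁ ∧
      8 * Real.pi * p.m * (p.a * p.c) = j₃ := by
  have hE0 : 0 < E := (abs_nonneg ρ).trans_lt hE
  have hsq : 0 < E ^ 2 - ρ ^ 2 := by
    have := sq_lt_sq' (by linarith [abs_nonneg ρ]) hE
    rw [sq_abs] at this
    linarith
  set M := √(E ^ 2 - ρ ^ 2) with hM
  have hM0 : 0 < M := Real.sqrt_pos.2 hsq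
  have hM2 : M ^ 2 = E ^ 2 - ρ ^ 2 := Real.sq_sqrt hsq.le
  have hπ := Real.pi_pos
  -- E and P force 8πm = M, γ = E/M and β = −ρ/M. A centered solution has ζ = β·as/γ, and then γ² −
  -- β² = 1 turns the first component of J into M·as/γ, so as = Ej₁/M² and ζ = −ρj₁/M².
  obtain ⟨a, c, s, hcs, hs, hc⟩ := exists_polar (E * j₁ / M ^ 2) (j₃ / M)
  refine ⟨⟨M / (8 * Real.pi), a, c, s, E / M, -ρ / M, -ρ * j₁ / M ^ 2, hcs, ?_, by positivity⟩,
    by positivity, ?_, ?_, ?_, ?_, ?_⟩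
  · field_simp
    linarith
  · field_simp
  · field_simp
  · simp only [hs]
    field_simp
    ring
  · simp only [hs]
    field_simp
    rw [hM2]
    ring
  · simp only [hc]
    field_simp

end BoostedKerr

/-! ### From uniform error bounds to limits, and the conclusion -/

theorem tendsto_of_eventually_abs_sub_le {f : ℝ → ℝ} {c C R : ℝ}
    (h : ∀ r, R ≤ r → |f r - c| ≤ C / r) : Tendsto f atTop (𝓝 c) := by
  rw [tendsto_iff_norm_sub_tendsto_zero]
  exact squeeze_zero' (g := fun r => C / r) (Eventually.of_forall fun r => norm_nonneg _)
    ((eventually_ge_atTop R).mono h) (tendsto_const_nhds.div_atTop tendsto_id)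

end KerrData

theorem proposition4p4 (E : ℝ) (P J : E3) (hE : 0 < E) (hP : ‖P‖ < E) :
    ∃ (m a : ℝ) (T : PoincareTransformation), 0 < m ∧
      ∃ g k : Tensor3,
        g = inducedMetric (T.transform (kerrMetric m a)) ∧
        k = secondFundamentalForm (T.transform (kerrMetric m a)) ∧
        (∃ R C : ℝ, 0 < R ∧
          -- the metric is smooth along the slice and the slice is spacelike outside a ball
          (∀ y : E3, R ≤ ‖y‖ →
            (∀ μ ν, ContDiffAt ℝ ∞ (fun x => T.transform (kerrMetric m a) x μ ν) (slicePoint y)) ∧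
            (g y).PosDef) ∧
          -- decay of the data
          (∀ y : E3, R ≤ ‖y‖ → ∀ i j,
            |(g y - 1) i j| ≤ C / ‖y‖ ∧ |k y i j| ≤ C / ‖y‖ ^ 2) ∧
          -- charges on the coordinate spheres
          (∀ r : ℝ, R ≤ r →
            |energyCharge g r - E| ≤ C / r ∧
            ∀ i, |momentumCharge k r i - P i| ≤ C / r ∧
              |centerCharge g r i| ≤ C / r ∧
              |angularCharge k r i - J i| ≤ C / r)) ∧
        HasADMCharges g k E P 0 J := by
  obtain ⟨Q, ρ, j₁, j₃, hQ, hdet, hPQ, hJQ⟩ := exists_adapted_rotation P.ofLp J.ofLp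
  -- Rotations preserve the norm, so |ρ| is the norm of P and the timelike condition passes to the
  -- adapted frame.
  have hρ : |ρ| < E := by
    have h : ‖P‖ ^ 2 = ρ ^ 2 := by
      have h1 : ‖P‖ ^ 2 = P.ofLp ⬝ᵥ P.ofLp := by
        rw [EuclideanSpace.real_norm_sq_eq]; simp [dotProduct, sq]
      rw [h1, hPQ, dotProduct_rotation _ _ hQ]
      simp [sq]
    rwa [← abs_norm, (sq_eq_sq_iff_abs_eq_abs _ _).1 h] at hP
  obtain ⟨p, hm, hpE, hpP, hpC, hpJ1, hpJ3⟩ := BoostedKerr.exists_parameters hρ j₁ j₃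
  refine ⟨p.m, p.a, p.transformation (spacetimeRotation Q) (spacetimeRotation_minkowski hQ)
    (spacetimeRotation_det.trans hdet) spacetimeRotation_zero, hm, _, _, rfl, rfl, ?_⟩
  rw [BoostedKerr.transform_eq_rotatedMetric hQ hdet]
  set G := rotatedMetric Q p.metric
  have hEn := BoostedKerr.rotated_energyCharge_asymptotics (p := p) hQ
  have hMo := BoostedKerr.rotated_momentumCharge_asymptotics (p := p) hQ
  have hCe := BoostedKerr.rotated_centerCharge_asymptotics (p := p) hQ
  have hAn := BoostedKerr.rotated_angularCharge_asymptotics (p := p) hQ hdet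
  have z : ![(0 : ℝ), 0, 0] = 0 := by ext i; fin_cases i <;> rfl
  rw [hpE] at hEn
  rw [hpP, ← hPQ] at hMo
  simp only [hpC, mul_zero, z, Matrix.mulVec_zero, Pi.zero_apply, sub_zero] at hCe
  rw [hpJ1, hpJ3, ← hJQ] at hAn
  -- All bounds are indexed by pairs so that a single constant serves them all; vector components
  -- use the first index and the energy uses neither.
  have H : ∃ C, ∀ᶠ ε in 𝓝[>] (0 : ℝ), ∀ q : Fin 3 × Fin 3,
      (∀ y : E3, ‖y‖ = ε⁻¹ → |(inducedMetric G y - 1) q.1 q.2| ≤ C * ε ∧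
        |secondFundamentalForm G y q.1 q.2| ≤ C * ε ^ 2) ∧
      |energyCharge (inducedMetric G) ε⁻¹ - E| ≤ C * ε ∧
      |momentumCharge (secondFundamentalForm G) ε⁻¹ q.1 - P q.1| ≤ C * ε ∧
      |centerCharge (inducedMetric G) ε⁻¹ q.1| ≤ C * ε ∧
      |angularCharge (secondFundamentalForm G) ε⁻¹ q.1 - J q.1| ≤ C * ε := by
    refine exists_common_bound (P := fun (q : Fin 3 × Fin 3) C ε =>
      (∀ y : E3, ‖y‖ = ε⁻¹ → |(inducedMetric G y - 1) q.1 q.2| ≤ C * ε ∧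
        |secondFundamentalForm G y q.1 q.2| ≤ C * ε ^ 2) ∧
      |energyCharge (inducedMetric G) ε⁻¹ - E| ≤ C * ε ∧
      |momentumCharge (secondFundamentalForm G) ε⁻¹ q.1 - P q.1| ≤ C * ε ∧
      |centerCharge (inducedMetric G) ε⁻¹ q.1| ≤ C * ε ∧
      |angularCharge (secondFundamentalForm G) ε⁻¹ q.1 - J q.1| ≤ C * ε)
      (fun q C C' ε hε hC h => ?_) fun q => ?_
    · have h1 : C * ε ≤ C' * ε := by gcongr
      have h2 : C * ε ^ 2 ≤ C' * ε ^ 2 := by gcongr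
      exact ⟨fun y hy => ⟨(h.1 y hy).1.trans h1, (h.1 y hy).2.trans h2⟩, h.2.1.trans h1,
        h.2.2.1.trans h1, h.2.2.2.1.trans h1, h.2.2.2.2.trans h1⟩
    · obtain ⟨C₁, h₁⟩ := BoostedKerr.rotated_metric_decay (p := p) hQ q.1 q.2
      obtain ⟨C₂, h₂⟩ := BoostedKerr.rotated_secondForm_decay (p := p) hQ q.1 q.2
      obtain ⟨C₃, h₃⟩ := hEn
      obtain ⟨C₄, h₄⟩ := hMo q.1
      obtain ⟨C₅, h₅⟩ := hCe q.1
      obtain ⟨C₆, h₆⟩ := hAn q.1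
      refine ⟨|C₁| + |C₂| + |C₃| + |C₄| + |C₅| + |C₆|, ?_⟩
      filter_upwards [h₁, h₂, h₃, h₄, h₅, h₆, self_mem_nhdsWithin] with ε h₁ h₂ h₃ h₄ h₅ h₆ hε
      have hε : 0 < ε := hε
      have b₁ := le_abs_self C₁
      have b₂ := le_abs_self C₂
      have b₃ := le_abs_self C₃
      have b₄ := le_abs_self C₄
      have b₅ := le_abs_self C₅
      have b₆ := le_abs_self C₆
      have a₁ := abs_nonneg C₁
      have a₂ := abs_nonneg C₂
      have a₃ := abs_nonneg C₃
      have a₄ := abs_nonneg C₄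
      have a₅ := abs_nonneg C₅
      have a₆ := abs_nonneg C₆
      exact ⟨fun y hy => ⟨(h₁ y hy).trans (mul_le_mul_of_nonneg_right (by linarith) hε.le),
        (h₂ y hy).trans (mul_le_mul_of_nonneg_right (by linarith) (sq_nonneg ε))⟩,
        h₃.trans (mul_le_mul_of_nonneg_right (by linarith) hε.le),
        h₄.trans (mul_le_mul_of_nonneg_right (by linarith) hε.le),
        h₅.trans (mul_le_mul_of_nonneg_right (by linarith) hε.le),
        h₆.trans (mul_le_mul_of_nonneg_right (by linarith) hε.le)⟩
  obtain ⟨C, hC⟩ := H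
  -- The radius is R = δ⁻¹. A half-open interval is used so that ε = δ, that is r = R, is included.
  obtain ⟨δ, hδ, hall⟩ :=
    mem_nhdsGT_iff_exists_Ioc_subset.1 (hC.and (BoostedKerr.rotated_regular hQ hm))
  have hδ : 0 < δ := hδ
  have key := fun (r : ℝ) (hr : δ⁻¹ ≤ r) =>
    hall (show r⁻¹ ∈ Set.Ioc 0 δ from ⟨inv_pos.2 ((inv_pos.2 hδ).trans_le hr),
      inv_le_of_inv_le₀ hδ hr⟩)
  simp only [Set.mem_ofPred_eq, inv_inv, inv_pow, ← div_eq_mul_inv] at key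
  have hcharges : ∀ r : ℝ, δ⁻¹ ≤ r → |energyCharge (inducedMetric G) r - E| ≤ C / r ∧
      ∀ i, |momentumCharge (secondFundamentalForm G) r i - P i| ≤ C / r ∧
        |centerCharge (inducedMetric G) r i| ≤ C / r ∧
        |angularCharge (secondFundamentalForm G) r i - J i| ≤ C / r := fun r hr =>
    ⟨((key r hr).1 (0, 0)).2.1, fun i => ((key r hr).1 (i, 0)).2.2⟩
  refine ⟨⟨δ⁻¹, C, inv_pos.2 hδ, fun y hy => (key _ hy).2 y rfl,
    fun y hy i j => ((key _ hy).1 (i, j)).1 y rfl, hcharges⟩,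
    tendsto_of_eventually_abs_sub_le fun r hr => (hcharges r hr).1,
    fun i => tendsto_of_eventually_abs_sub_le fun r hr => ((hcharges r hr).2 i).1,
    fun i => tendsto_of_eventually_abs_sub_le (R := δ⁻¹) (C := C) fun r hr => ?_,
    fun i => tendsto_of_eventually_abs_sub_le fun r hr => ((hcharges r hr).2 i).2.2⟩
  have := ((hcharges r hr).2 i).2.1
  simpa using this
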